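/- **Setting.** Let $n\ge 1$ and let $X\in\{\mathtt A_n,\mathtt B_n,\mathtt C_n\}$ be the type of the coroot system. The apartment $\mathbb A$ is the real span of the root system $\Phi$, a point and a root being paired by the standard inner product, where $\Phi^+$ consists of $\epsilon_i-\epsilon_j$ ($1\le i<j\le n+1$, in $\mathbb R^{n+1}$) in type $\mathtt A_n$; of $\epsilon_i\pm\epsilon_j$ ($i<j$) and $2\epsilon_i$ in $\mathbb R^n$ in type $\mathtt B_n$; and of $\epsilon_i\pm\epsilon_j$ ($i<j$) and $\epsilon_i$ in $\mathbb R^n$ in type $\mathtt C_n$. The walls $\mathtt H_{\beta,k}=\{x:\langle\beta,x\rangle+k=0\}$ ($\beta\in\Phi$, $k\in\mathbb Z$) cut $\mathbb A$ into faces; $F^\circ$ denotes the relative interior of a face $F$, $s_{\beta,k}$ the reflection in $\mathtt H_{\beta,k}$, $W$ the Weyl group, $W^{\mathfrak a}$ the affine Weyl group, $C^+$ the dominant chamber. Vertices and edges are the faces of dimension $0$ and $1$; a vertex is special if every root has a wall through it. The type of a face $F$ is the set of walls of the fundamental alcove that contain the unique face of that alcove that is $W^{\mathfrak a}$-conjugate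 to $F$. A (combinatorial one-skeleton) gallery is a sequence $(V_0\subset E_0\supset V_1\subset\cdots\subset E_r\supset V_{r+1})$ of vertices $V_i$ and edges $E_i$ with $V_0,V_{r+1}$ special (a single special vertex is allowed); its type is the sequence of types of its faces. The fundamental coweights, in the Bourbaki enumeration, are $\omega_i=\epsilon_1+\dots+\epsilon_i$ (projected to the hyperplane of coordinate sum $0$ in type $\mathtt A_n$), except $\omega_n=\frac12(\epsilon_1+\dots+\epsilon_n)$ in type $\mathtt B_n$. The minuscule ones are all $\omega_i$ in type $\mathtt A_n$, $\omega_n$ in type $\mathtt B_n$, $\omega_1$ in type $\mathtt C_n$. Let $\gamma_{\omega_i}$ be the gallery from $0$ to $\omega_i$ with the single edge $[0,\omega_i]$ if $\omega_i$ is minuscule, and with the edges $[0,\frac12\omega_i]$, $[\frac12\omega_i,\omega_i]$ otherwise. For a dominant coweight $\lambda=\sum_i a_i\omega_i$, $a_i\in\mathbb Z_{\ge0}$, let $\gamma_{\underline\lambda}$ be the concatenation (with translations) of $a_1$ copies of $\gamma_{\omega_1}$, then $a_2$ copies of $\gamma_{\omega_2}$, and so on up to $a_n$ copies of $\gamma_{\omega_n}$.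 Let $\Gamma_\lambda$ be the set of galleries that start at $0$ and have the same type as $\gamma_{\underline\lambda}$. **Positively folded galleries.** A sector with vertex $v$ is a set $v+w(C^+)$, $w\in W$. A two-step gallery $(V_0\subset E\supset V\subset F)$ is *minimal* if $E\subset V_0+w(C^+)$ and $F\subset V+w(C^+)$ for some $w\in W$. It is *positively folded* if there are edges $F_0,\dots,F_s=F$ ($s\ge0$) containing $V$ such that $(V_0\subset E\supset V\subset F_0)$ is minimal and, for each $j\ge1$, $F_j=s_{\beta,k}(F_{j-1})$ for some wall $\mathtt H_{\beta,k}\ni V$ such that $F_{j-1}$ and $V-C^+$ lie in one closed half-space of $\mathtt H_{\beta,k}$ and $F_j^\circ$ in the opposite open one. A gallery $\gamma\in\Gamma_\lambda$ is *positively folded* if each $(V_{i-1}\subset E_{i-1}\supset V_i\subset E_i)$ is positively folded and there are $\tau_0\ge\tau_1\ge\dots\ge\tau_r$ in the Bruhat order of $W$ with $E_i\subset V_i+\tau_i(C^+)$ for all $i$. **Tableaux.** Let $m_j=1$ if $\omega_j$ is minuscule and $m_j=2$ otherwise, and let $p_{\underline\lambda}=(p_1,\dots,p_n)$ with $p_i=\sum_{j\ge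 i}m_ja_j$. Enumerate the columns $C_1,C_2,\dots$ of the Young diagram of $p_{\underline\lambda}$ from right to left. The alphabet is $1<\dots<n+1$ in type $\mathtt A_n$ and $1<\dots<n<\bar n<\dots<\bar1$ in types $\mathtt B_n,\mathtt C_n$, with $\bar{\bar k}=k$. A *Young tableau* of shape $p_{\underline\lambda}$ and type $X$ is a filling of the diagram by letters that is strictly increasing down the columns and such that, in types $\mathtt B_n$ and $\mathtt C_n$, no column contains both $k$ and $\bar k$, and moreover: in type $\mathtt B_n$, for $1\le j\le a_1+\dots+a_{n-1}$, the set of entries of $C_{2j}$ arises from that of $C_{2j-1}$ by exchanging some (possibly no) entries $k$ for $\bar k$; in type $\mathtt C_n$, for $1\le j\le a_2+\dots+a_n$, the set of entries of $C_{a_1+2j}$ arises from that of $C_{a_1+2j-1}$ by exchanging an even number (possibly $0$) of entries $k$ for $\bar k$. It is *semistandard* if in addition the rows are weakly increasing from left to right. **The correspondence.** Put $\epsilon_{\bar k}=-\epsilon_k$. For $\gamma\in\Gamma_\lambda$ and every $k\ge1$ up to the number of edges, $V_k-V_{k-1}$ is a positive multiple of (the projection to $\mathbb A$ of) $\epsilon_{j_1}+\dots+\epsilon_{j_i}$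 for letters $j_1<\dots<j_i$ forming one column (with no $k$ and $\bar k$ together in types $\mathtt B_n$, $\mathtt C_n$). Let $\mathcal T_\gamma$ be the filling whose column $C_k$ consists of these $j_1,\dots,j_i$. **Proposition.** For $X$ of type $\mathtt A_n$, $\mathtt B_n$ or $\mathtt C_n$ and every dominant coweight $\lambda$, the map $\gamma\mapsto\mathcal T_\gamma$ is a bijection from $\Gamma_\lambda$ onto the set of Young tableaux of shape $p_{\underline\lambda}$ and type $X$, and it restricts to a bijection from the set of positively folded galleries in $\Gamma_\lambda$ onto the set of semistandard Young tableaux of shape $p_{\underline\lambda}$ and type $X$. -/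

import Mathlib

open scoped Classical

noncomputable section

namespace OneSkeleton

/-! ## The three classical types

`A`, `B`, `C` name the type of the *coroot* system, that is, of the lattice in which galleries and
weights live.  So in type `B` the roots (affine functionals cutting out the walls) form a root system
of type `C_n` and the coweights are the weights of type `B_n`; in type `C` the roots form a root
system of type `B_n` and the coweights are the weights of type `C_n`. -/
inductive ClassicalType
  | A
  | B
  | C

open ClassicalType

/-- Number of coordinates: the apartment of type `A_n` lies in `ℝⁿ⁺¹`, the others are `ℝⁿ`. -/
def dim (X : ClassicalType) (n : ℕ) : ℕ :=
  match X with
  | A => n + 1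
  | B => n
  | C => n

/-- The coordinate space.  Roots and points of the apartment are both written in it, the pairing of
a root `α` with a point `x` is the standard dot product `α ⬝ᵥ x`. -/
abbrev Amb (X : ClassicalType) (n : ℕ) : Type := Fin (dim X n) → ℝ

/-- The `k`-th coordinate vector (`k = 0, 1, …`; it is `0` when `k` is out of range). -/
def e (X : ClassicalType) (n k : ℕ) : Amb X n := fun j => if (j : ℕ) = k then 1 else 0

/-- The set `Φ⁺` of positive roots. -/
def posRoots (X : ClassicalType) (n : ℕ) : Set (Amb X n) :=
  {x | ∃ i j : Fin (dim X n), i < j ∧ x = e X n i - e X n j} ∪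
    match X with
    | A => ∅
    | B => {x | ∃ i j : Fin n, i < j ∧ x = e B n i + e B n j} ∪
        {x | ∃ i : Fin n, x = (2 : ℝ) • e B n i}
    | C => {x | ∃ i j : Fin n, i < j ∧ x = e C n i + e C n j} ∪
        {x | ∃ i : Fin n, x = e C n i}

/-- The root system `Φ`. -/
def roots (X : ClassicalType) (n : ℕ) : Set (Amb X n) :=
  {x | x ∈ posRoots X n ∨ -x ∈ posRoots X n}

/-- The simple roots in the Bourbaki enumeration (here starting at `0`). -/
def simpleRoot (X : ClassicalType) (n : ℕ) (i : Fin n) : Amb X n :=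
  match X with
  | A => e A n i - e A n (i + 1)
  | B => if (i : ℕ) + 1 < n then e B n i - e B n (i + 1) else (2 : ℝ) • e B n i
  | C => if (i : ℕ) + 1 < n then e C n i - e C n (i + 1) else e C n i

/-- The fundamental coweights `ω_i`, the basis of the apartment dual to the simple roots.  In type
`A` this is `ε_1 + … + ε_i` where `ε_j` is the projection of the `j`-th coordinate vector to the
hyperplane of vectors with coordinate sum `0`. -/
def fundCoweight (X : ClassicalType) (n : ℕ) (i : Fin n) : Amb X n := fun j =>
  match X with
  | A => (if (j : ℕ) ≤ i then 1 else 0) - ((i : ℝ) + 1) / ((n : ℝ) + 1)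
  | B => if (i : ℕ) + 1 = n then 1 / 2 else (if (j : ℕ) ≤ i then 1 else 0)
  | C => if (j : ℕ) ≤ i then 1 else 0

/-- The minuscule fundamental coweights. -/
def Minuscule (X : ClassicalType) {n : ℕ} (i : Fin n) : Prop :=
  match X with
  | A => True
  | B => (i : ℕ) + 1 = n
  | C => (i : ℕ) = 0

/-! ## The apartment, faces, Weyl groups -/

/-- The apartment: the real span of the roots. -/
def apartment (X : ClassicalType) (n : ℕ) : Submodule ℝ (Amb X n) :=
  Submodule.span ℝ (roots X n)

variable {X : ClassicalType} {n : ℕ}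

/-- The affine hyperplane (wall) `H_{β,k}`. -/
def wall (β : Amb X n) (k : ℤ) : Set (Amb X n) := {x | x ∈ apartment X n ∧ β ⬝ᵥ x + k = 0}

/-- The closed half-space `H⁺_{β,k}`. -/
def posHalf (β : Amb X n) (k : ℤ) : Set (Amb X n) := {x | x ∈ apartment X n ∧ 0 ≤ β ⬝ᵥ x + k}

/-- The closed half-space `H⁻_{β,k}`. -/
def negHalf (β : Amb X n) (k : ℤ) : Set (Amb X n) := {x | x ∈ apartment X n ∧ β ⬝ᵥ x + k ≤ 0}

/-- The reflection `s_{β,k} : x ↦ x - (⟨β,x⟩ + k) β^∨`, where `β^∨ = 2β / ⟨β,β⟩`. -/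
def affReflFun (β : Amb X n) (k : ℤ) (x : Amb X n) : Amb X n :=
  x - ((β ⬝ᵥ x + k) * (2 / (β ⬝ᵥ β))) • β

theorem affReflFun_involutive (β : Amb X n) (k : ℤ) :
    Function.Involutive (affReflFun β k) := by
  intro x
  by_cases hβ : β = 0
  · simp [affReflFun, hβ]
  · have h : β ⬝ᵥ β ≠ 0 := fun h => hβ (dotProduct_self_eq_zero.mp h)
    simp only [affReflFun, dotProduct_sub, dotProduct_smul, smul_eq_mul]
    rw [sub_sub, ← add_smul]
    have : (β ⬝ᵥ x + k) * (2 / (β ⬝ᵥ β)) +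
        (β ⬝ᵥ x - (β ⬝ᵥ x + k) * (2 / (β ⬝ᵥ β)) * (β ⬝ᵥ β) + k) * (2 / (β ⬝ᵥ β)) = 0 := by
      field_simp
      ring
    rw [this, zero_smul, sub_zero]

/-- The affine reflection `s_{β,k}` as a permutation. -/
def affRefl (β : Amb X n) (k : ℤ) : Equiv.Perm (Amb X n) :=
  (affReflFun_involutive β k).toPerm

variable (X n) in
/-- The affine Weyl group, generated by all `s_{β,k}`. -/
def affWeyl : Subgroup (Equiv.Perm (Amb X n)) :=
  Subgroup.closure {g | ∃ β ∈ roots X n, ∃ k : ℤ, g = affRefl β k}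

variable (X n) in
/-- The finite Weyl group `W`, generated by all `s_{β,0}`. -/
def weyl : Subgroup (Equiv.Perm (Amb X n)) :=
  Subgroup.closure {g | ∃ β ∈ roots X n, g = affRefl β 0}

/-- The hyperplane or closed half-space selected by a sign. -/
def side (β : Amb X n) (k : ℤ) : SignType → Set (Amb X n)
  | .zero => wall β k
  | .pos => posHalf β k
  | .neg => negHalf β k

/-- The intersection of the closed half-spaces / hyperplanes selected by `s`. -/
def closedFace (s : Amb X n → ℤ → SignType) : Set (Amb X n) :=
  {x | x ∈ apartment X n ∧ ∀ β ∈ posRoots X n, ∀ k : ℤ, x ∈ side β k (s β k)}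

/-- The intersection of the open half-spaces / hyperplanes selected by `s`. -/
def openFace (s : Amb X n → ℤ → SignType) : Set (Amb X n) :=
  {x | x ∈ apartment X n ∧ ∀ β ∈ posRoots X n, ∀ k : ℤ, SignType.sign (β ⬝ᵥ x + k) = s β k}

/-- A (closed, nonempty) face of the apartment. -/
def IsFace (F : Set (Amb X n)) : Prop :=
  ∃ s : Amb X n → ℤ → SignType, (openFace s).Nonempty ∧ F = closedFace s

/-- The open face `F°` of a face `F`: the points of `F` that lie on no wall other than those that
contain `F`.  See `openPart_closedFace`. -/
def openPart (F : Set (Amb X n)) : Set (Amb X n) :=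
  {x | x ∈ F ∧ ∀ β ∈ posRoots X n, ∀ k : ℤ, x ∈ wall β k → F ⊆ wall β k}

theorem openPart_closedFace (s : Amb X n → ℤ → SignType) (hs : (openFace s).Nonempty) :
    openPart (closedFace s) = openFace s := by
  have hsub : openFace s ⊆ closedFace s := by
    rintro x ⟨hx, h⟩
    refine ⟨hx, fun β hβ k => ?_⟩
    have h1 := h β hβ k
    rcases lt_trichotomy (β ⬝ᵥ x + (k : ℝ)) 0 with h2 | h2 | h2
    · rw [← h1, sign_neg h2]; exact ⟨hx, h2.le⟩
    · rw [← h1, h2, sign_zero]; exact ⟨hx, h2⟩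
    · rw [← h1, sign_pos h2]; exact ⟨hx, h2.le⟩
  obtain ⟨y, hy⟩ := hs
  ext x
  constructor
  · rintro ⟨⟨hx, h⟩, h'⟩
    refine ⟨hx, fun β hβ k => ?_⟩
    have h1 := h β hβ k
    have hyk := hy.2 β hβ k
    by_cases h0 : β ⬝ᵥ x + (k : ℝ) = 0
    · have := (h' β hβ k ⟨hx, h0⟩ (hsub hy)).2
      rw [← hyk, this, h0]
    · cases hsk : s β k
      · rw [hsk] at h1; exact absurd h1.2 h0
      · rw [hsk] at h1; exact sign_neg (lt_of_le_of_ne h1.2 h0)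
      · rw [hsk] at h1; exact sign_pos (lt_of_le_of_ne h1.2 (Ne.symm h0))
  · intro hx
    refine ⟨hsub hx, fun β hβ k hw z hz => ?_⟩
    have h1 := hx.2 β hβ k
    rw [hw.2, sign_zero] at h1
    have h2 := hz.2 β hβ k
    rw [← h1] at h2
    exact h2

/-- Dimension of (the affine span of) a face. -/
def faceDim (F : Set (Amb X n)) : ℕ := Module.finrank ℝ (vectorSpan ℝ F)

/-- An edge: a face of dimension one. -/
def IsEdge (F : Set (Amb X n)) : Prop := IsFace F ∧ faceDim F = 1

/-- A vertex, given as a point: a face of dimension zero is a one-point set. -/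
def IsVertex (v : Amb X n) : Prop := IsFace {v}

/-- A special vertex: every root has a wall through `v`. -/
def IsSpecial (v : Amb X n) : Prop :=
  IsVertex v ∧ ∀ β ∈ roots X n, ∃ k : ℤ, v ∈ wall β k

variable (X n) in
/-- The dominant Weyl chamber `C⁺`. -/
def domChamber : Set (Amb X n) := {x | x ∈ apartment X n ∧ ∀ β ∈ posRoots X n, 0 ≤ β ⬝ᵥ x}

variable (X n) in
/-- The fundamental alcove `Δ_f`. -/
def fundAlcove : Set (Amb X n) :=
  {x | x ∈ apartment X n ∧ ∀ β ∈ posRoots X n, 0 ≤ β ⬝ᵥ x ∧ β ⬝ᵥ x ≤ 1}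

variable (X n) in
/-- The affine roots `(β,k)` whose wall meets the fundamental alcove in a codimension one face. -/
def alcoveWalls : Set (Amb X n × ℤ) :=
  {p | p.1 ∈ roots X n ∧ IsFace (fundAlcove X n ∩ wall p.1 p.2) ∧
    faceDim (fundAlcove X n ∩ wall p.1 p.2) + 1 = Module.finrank ℝ (apartment X n)}

/-- The type of a face `F`: the walls of the fundamental alcove that contain the face of the
fundamental alcove conjugate to `F` under the affine Weyl group. -/
def faceType (F : Set (Amb X n)) : Set (Amb X n × ℤ) :=
  {p | p ∈ alcoveWalls X n ∧
    ∃ w ∈ affWeyl X n, w '' F ⊆ fundAlcove X n ∧ w '' F ⊆ wall p.1 p.2}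

/-! ## Bruhat order -/

/-- Length of an element of `W` in the simple reflections. -/
def length (w : Equiv.Perm (Amb X n)) : ℕ :=
  sInf {m | ∃ l : List (Fin n), l.length = m ∧
    (l.map fun i => affRefl (simpleRoot X n i) 0).prod = w}

/-- Bruhat order `u ≤ v` on `W`: generated by `u < s_β u` whenever the length increases. -/
def BruhatLE (u v : Equiv.Perm (Amb X n)) : Prop :=
  Relation.ReflTransGen
    (fun x y => (∃ β ∈ roots X n, y = affRefl β 0 * x) ∧ length x < length y) u v

/-- The sector with vertex `v` in the class of the chamber `w(C⁺)`. -/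
def sector (v : Amb X n) (w : Equiv.Perm (Amb X n)) : Set (Amb X n) :=
  {x | ∃ z ∈ domChamber X n, x = v + w z}

/-- The anti-dominant sector `C⁻(v)` with vertex `v`. -/
def antiSector (v : Amb X n) : Set (Amb X n) := {x | ∃ z ∈ domChamber X n, x = v - z}

/-! ## One-skeleton galleries -/

/-- A sequence `V_0, E_0, V_1, E_1, …, E_{N-1}, V_N`, stored as the source `V_0` and the list of
the pairs `(E_k, V_{k+1})`. -/
@[ext]
structure Gallery (X : ClassicalType) (n : ℕ) where
  source : Amb X n
  steps : List (Set (Amb X n) × Amb X n)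

namespace Gallery

/-- The number `N` of edges. -/
def size (γ : Gallery X n) : ℕ := γ.steps.length

/-- The vertex `V_k` (used for `k ≤ N`). -/
def V (γ : Gallery X n) (k : ℕ) : Amb X n := (γ.source :: γ.steps.map Prod.snd).getD k 0

/-- The edge `E_k` (used for `k < N`). -/
def E (γ : Gallery X n) (k : ℕ) : Set (Amb X n) := (γ.steps.map Prod.fst).getD k ∅

/-- The target `V_N`. -/
def target (γ : Gallery X n) : Amb X n := γ.V γ.size

/-- Combinatorial one-skeleton galleries. -/
def IsCombinatorial (γ : Gallery X n) : Prop :=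
  IsSpecial γ.source ∧ IsSpecial γ.target ∧ (∀ k ≤ γ.size, IsVertex (γ.V k)) ∧
    ∀ k < γ.size, IsEdge (γ.E k) ∧ γ.V k ∈ γ.E k ∧ γ.V (k + 1) ∈ γ.E k

/-- The gallery of types. -/
def type (γ : Gallery X n) : Set (Amb X n × ℤ) × List (Set (Amb X n × ℤ) × Set (Amb X n × ℤ)) :=
  (faceType {γ.source}, γ.steps.map fun p => (faceType p.1, faceType {p.2}))

/-- Concatenation; the second gallery is displaced so that it starts at the target of the first. -/
def concat (γ δ : Gallery X n) : Gallery X n where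
  source := γ.source
  steps := γ.steps ++ δ.steps.map fun p =>
    ((fun x => x + (γ.target - δ.source)) '' p.1, p.2 + (γ.target - δ.source))

end Gallery

/-- The fundamental gallery `γ_{ω_i}` from the origin to `ω_i`: one edge if `ω_i` is minuscule,
and two edges with middle vertex `ω_i / 2` otherwise. -/
def fundGallery (X : ClassicalType) (n : ℕ) (i : Fin n) : Gallery X n where
  source := 0
  steps :=
    if Minuscule X i then [(segment ℝ 0 (fundCoweight X n i), fundCoweight X n i)]
    else [(segment ℝ 0 ((1 / 2 : ℝ) • fundCoweight X n i), (1 / 2 : ℝ) • fundCoweight X n i),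
      (segment ℝ ((1 / 2 : ℝ) • fundCoweight X n i) (fundCoweight X n i), fundCoweight X n i)]

/-- The gallery `γ_λ = γ_{ω_1} * ⋯ * γ_{ω_1} * ⋯ * γ_{ω_n} * ⋯ * γ_{ω_n}`, with `a_i` factors
`γ_{ω_i}`, for the dominant coweight `λ = ∑ a_i ω_i`. -/
def stdGallery (X : ClassicalType) (n : ℕ) (a : Fin n → ℕ) : Gallery X n :=
  (((List.finRange n).flatMap fun i => List.replicate (a i) (fundGallery X n i))).foldl
    Gallery.concat ⟨0, []⟩

/-- The combinatorial one-skeleton galleries starting at the origin of the same type as `γ_λ`. -/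
def galleries (X : ClassicalType) (n : ℕ) (a : Fin n → ℕ) : Set (Gallery X n) :=
  {γ | γ.IsCombinatorial ∧ γ.source = 0 ∧ γ.type = (stdGallery X n a).type}

/-! ## Positively folded galleries -/

/-- The two-step gallery `(V₀ ⊂ E ⊃ V ⊂ F)` is minimal. -/
def MinimalPair (V₀ : Amb X n) (E : Set (Amb X n)) (V : Amb X n) (F : Set (Amb X n)) : Prop :=
  ∃ w ∈ weyl X n, E ⊆ sector V₀ w ∧ F ⊆ sector V w

/-- The wall `H_{β,k}` separates the set `Ω` from the face `F`. -/
def Separates (β : Amb X n) (k : ℤ) (Ω F : Set (Amb X n)) : Prop :=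
  (Ω ⊆ negHalf β k ∧ openPart F ⊆ posHalf β k \ wall β k) ∨
    (Ω ⊆ posHalf β k ∧ openPart F ⊆ negHalf β k \ wall β k)

/-- `F'` is obtained from `F` by a positive folding at `V`. -/
def PosFolding (V : Amb X n) (F F' : Set (Amb X n)) : Prop :=
  ∃ β ∈ roots X n, ∃ k : ℤ, V ∈ wall β k ∧ F' = affRefl β k '' F ∧
    Separates β k (F ∪ antiSector V) F'

/-- The two-step gallery `(V₀ ⊂ E ⊃ V ⊂ F)` is positively folded. -/
def PosFoldedPair (V₀ : Amb X n) (E : Set (Amb X n)) (V : Amb X n) (F : Set (Amb X n)) : Prop :=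
  ∃ F₀ : Set (Amb X n), IsEdge F₀ ∧ V ∈ F₀ ∧ MinimalPair V₀ E V F₀ ∧
    Relation.ReflTransGen (PosFolding V) F₀ F

/-- Every two-step gallery of `γ` is positively folded. -/
def Gallery.LocallyPosFolded (γ : Gallery X n) : Prop :=
  ∀ k, k + 1 < γ.size → PosFoldedPair (γ.V k) (γ.E k) (γ.V (k + 1)) (γ.E (k + 1))

/-- There are sectors `𝔰_k ⊇ E_k` with vertex `V_k` whose classes `τ_k(C⁺)` are weakly decreasing in
the Bruhat order. -/
def Gallery.HasDefiningChain (γ : Gallery X n) : Prop :=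
  ∃ τ : ℕ → Equiv.Perm (Amb X n), (∀ k < γ.size, τ k ∈ weyl X n ∧ γ.E k ⊆ sector (γ.V k) (τ k)) ∧
    ∀ k, k + 1 < γ.size → BruhatLE (τ (k + 1)) (τ k)

/-- (Globally) positively folded galleries. -/
def Gallery.PosFolded (γ : Gallery X n) : Prop := γ.LocallyPosFolded ∧ γ.HasDefiningChain

/-! ## Young tableaux -/

/-- Size of the alphabet. -/
def alphabetSize (X : ClassicalType) (n : ℕ) : ℕ :=
  match X with
  | A => n + 1
  | B => 2 * n
  | C => 2 * n

/-- The alphabet.  In type `A` it is `1 < 2 < ⋯ < n + 1`; in types `B`, `C` it is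
`1 < 2 < ⋯ < n < n̄ < ⋯ < 2̄ < 1̄`, so that `ℓ ↦ ℓ̄` is the order reversal `Fin.rev`. -/
abbrev Letter (X : ClassicalType) (n : ℕ) : Type := Fin (alphabetSize X n)

/-- The vector `ε_ℓ` of a letter, where `ε_{k̄} = -ε_k` (in type `A`, before projecting to the
apartment). -/
def eps (ℓ : Letter X n) : Amb X n :=
  match X with
  | A => e A n ℓ
  | B => if (ℓ : ℕ) < n then e B n ℓ else -e B n ℓ.rev
  | C => if (ℓ : ℕ) < n then e C n ℓ else -e C n ℓ.rev

/-- The number of edges of `γ_{ω_i}`, which is also the number of columns of the tableaux of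
shape `p_{ω_i}`. -/
def mult (X : ClassicalType) {n : ℕ} (i : Fin n) : ℕ := if Minuscule X i then 1 else 2

/-- The partition `p_λ`: the length `p_i` of the `i`-th row is the sum of the `a_j`, `j ≥ i`, where
`a_j` is counted twice if `ω_j` is not minuscule. -/
def shape (X : ClassicalType) {n : ℕ} (a : Fin n → ℕ) (i : Fin n) : ℕ :=
  ∑ j ∈ Finset.univ.filter (fun j => i ≤ j), mult X j * a j

/-- The number of columns (the length of the first row). -/
def numCols (X : ClassicalType) {n : ℕ} (a : Fin n → ℕ) : ℕ := ∑ j, mult X j * a j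

/-- Fillings of the Young diagram of shape `p_λ`: `T i j` is the entry in row `i` (from the top) and
in the `j`-th box of that row (from the left), both counted from `0`. -/
abbrev Filling (X : ClassicalType) {n : ℕ} (a : Fin n → ℕ) : Type :=
  (i : Fin n) → Fin (shape X a i) → Letter X n

/-- The set of the entries of the column `C_k`, where columns are enumerated `C_1, C_2, …` from the
right to the left. -/
def column {a : Fin n → ℕ} (T : Filling X a) (k : ℕ) : Finset (Letter X n) :=
  Finset.univ.filter fun ℓ => ∃ i, ∃ j : Fin (shape X a i), (j : ℕ) + k = numCols X a ∧ T i j = ℓ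

/-- Replace the letters `ℓ ∈ S` of a column `c` by `ℓ̄`. -/
def exchange (c S : Finset (Letter X n)) : Finset (Letter X n) := (c \ S) ∪ S.image Fin.rev

/-- Entries are strictly increasing in the columns from top to bottom. -/
def ColumnStrict {a : Fin n → ℕ} (T : Filling X a) : Prop :=
  ∀ (i i' : Fin n) (j : Fin (shape X a i)) (j' : Fin (shape X a i')),
    i < i' → (j : ℕ) = j' → T i j < T i' j'

/-- A letter `ℓ` and its bar `ℓ̄` never occur in the same column. -/
def NoBarPair {a : Fin n → ℕ} (T : Filling X a) : Prop :=
  ∀ k, ∀ ℓ ∈ column T k, ℓ.rev ∉ column T k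

/-- Young tableaux of shape `p_λ` and type `A_n`, `B_n`, `C_n`. -/
def IsYoungTableau {a : Fin n → ℕ} (T : Filling X a) : Prop :=
  ColumnStrict T ∧
    match X with
    | A => True
    | B => NoBarPair T ∧
        ∀ q ∈ Finset.Icc 1 (∑ i ∈ Finset.univ.filter (fun i : Fin n => (i : ℕ) + 1 < n), a i),
          ∃ S ⊆ column T (2 * q - 1), column T (2 * q) = exchange (column T (2 * q - 1)) S
    | C => NoBarPair T ∧
        ∀ q ∈ Finset.Icc 1 (∑ i ∈ Finset.univ.filter (fun i : Fin n => 0 < (i : ℕ)), a i),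
          let a₁ := ∑ i ∈ Finset.univ.filter (fun i : Fin n => (i : ℕ) = 0), a i
          ∃ S ⊆ column T (a₁ + 2 * q - 1), Even S.card ∧
            column T (a₁ + 2 * q) = exchange (column T (a₁ + 2 * q - 1)) S

/-- Entries are weakly increasing in the rows from left to right. -/
def RowWeak {a : Fin n → ℕ} (T : Filling X a) : Prop := ∀ i, Monotone (T i)

variable (X) in
/-- The Young tableaux of shape `p_λ`. -/
def tableaux {n : ℕ} (a : Fin n → ℕ) : Set (Filling X a) := {T | IsYoungTableau T}

variable (X) in
/-- The semistandard Young tableaux of shape `p_λ`. -/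
def semistandardTableaux {n : ℕ} (a : Fin n → ℕ) : Set (Filling X a) :=
  {T | IsYoungTableau T ∧ RowWeak T}

/-! ## From galleries to tableaux -/

/-- The letters of a vector `x` in the apartment.  If `x` is a positive multiple of the weight
`ε_{j_1} + ⋯ + ε_{j_i}` (with the `j`'s as in a column of a tableau), they are `j_1, …, j_i`. -/
def letters (x : Amb X n) : Finset (Letter X n) := Finset.univ.filter fun ℓ => 0 < eps ℓ ⬝ᵥ x

theorem le_alphabetSize (X : ClassicalType) (n : ℕ) : n ≤ alphabetSize X n := by
  cases X <;> simp only [alphabetSize] <;> omega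

/-- The tableau `T_γ` of a gallery `γ` of the same type as `γ_λ`: the column `C_k` lists in increasing
order the letters of the weight of the `k`-th edge `E_{k-1}`, the multiple of `V_k - V_{k-1}`
conjugate to a fundamental coweight.  (The default value of `getD` is not used for such `γ`.) -/
def tableauOf {a : Fin n → ℕ} (γ : Gallery X n) : Filling X a := fun i j =>
  ((letters (γ.V (numCols X a - j) - γ.V (numCols X a - j - 1))).sort (· ≤ ·)).getD i
    (Fin.castLE (le_alphabetSize X n) i)

end OneSkeleton

end

open scoped Classical

noncomputable section

namespace OneSkeleton

open ClassicalType

variable {X : ClassicalType} {n : ℕ}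

/-! Everything is translated into the combinatorics of letters. With `eps` of a barred letter equal
to minus `eps` of the unbarred one, the positive roots of all three types are, up to a positive
factor, the differences `eps a - eps b` with `a < b`, and the Weyl group acts on the letters,
commuting with bars.

Galleries. The fundamental alcove is a simplex with vertices 0 and ω_i or ω_i/2 (`stepVec`).
Distinct ones are not conjugate under the affine Weyl group (`alcoveVertex_conj`), so the type of a
vertex determines its orbit, and an edge is determined up to conjugation by the types of its two
ends (`exists_conj_edge`). The edges of type i leaving an integral vertex V are therefore the
segments from V to V + σ(`stepVec` i) with σ in W. By transitivity of W on columns these directions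
correspond to the columns without opposite letters (`isStep_iff`). After the first edge d of a
two-edge block the vertex V + d need not be special. A second direction d' is then admissible
exactly when d - d' is a translation of the affine Weyl group (`conj_second_step_iff`). In terms of
columns, the second one arises from the first by barring or unbarring some letters, an even number
of them in type C (`dirOf_sub_mem_latticeT_iff`). This is the definition of a Young tableau, and
gives the first bijection.

Foldings. Rows increase weakly if and only if, for every letter l, the number of entries at most l
does not decrease on passing from a column to its left neighbour (`HasColumnLengths.rowWeak_iff`).
If a sector of class τ contains an edge, the column of the edge consists of the images under τ of
the first letters. Going up in the Bruhat order pushes these images up (`countLE_initCol_anti`), so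
a defining chain forces semistandardness. Conversely, given weakly increasing rows, the chain is
built from the last edge back to the first: an element whose initial column lies entrywise below a
given column is below, in the Bruhat order, some element that realises that column
(`exists_bruhatLE_of_le`).

The local conditions are then automatic. At a special vertex every root has a wall, and a Bruhat
chain yields a chain of positive foldings (`foldings_of_bruhatLE`). At a middle vertex the exchange
of letters with their bars is carried out by explicit foldings of at most two letters each
(`foldings_exchange`). Both facts are combined in `posFolded_iff`. -/

theorem dim_of_ne (hX : X ≠ A) : dim X n = n := by cases X <;> simp_all [dim]

theorem alphabetSize_of_ne (hX : X ≠ A) : alphabetSize X n = 2 * n := by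
  cases X <;> simp_all [alphabetSize]

theorem le_dim (X : ClassicalType) (n : ℕ) : n ≤ dim X n := by cases X <;> simp [dim]

/-! ### Letters and opposite letters -/

theorem val_rev_of_ne (hX : X ≠ A) (a : Letter X n) : (a.rev : ℕ) = 2 * n - 1 - a := by
  have h := alphabetSize_of_ne (n := n) hX
  rw [Fin.val_rev]; omega

theorem val_lt_of_ne (hX : X ≠ A) (a : Letter X n) : (a : ℕ) < 2 * n :=
  lt_of_lt_of_eq a.2 (alphabetSize_of_ne hX)

/-- Two letters are opposite if they are of the form `k`, `k̄`; this does not occur in type `A`. -/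
def Opp (a b : Letter X n) : Prop := X ≠ A ∧ b = a.rev

theorem opp_iff {a b : Letter X n} : Opp a b ↔ X ≠ A ∧ (a : ℕ) + b + 1 = 2 * n := by
  refine and_congr_right fun hX => ?_
  have h := val_lt_of_ne hX a
  rw [Fin.ext_iff, val_rev_of_ne hX]
  omega

theorem Opp.symm {a b : Letter X n} (h : Opp a b) : Opp b a := ⟨h.1, by rw [h.2, Fin.rev_rev]⟩

theorem opp_comm {a b : Letter X n} : Opp a b ↔ Opp b a := ⟨Opp.symm, Opp.symm⟩

theorem Opp.ne {a b : Letter X n} (h : Opp a b) : a ≠ b := by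
  rintro rfl
  have := (opp_iff.1 h).2
  omega

theorem Opp.right_unique {a b c : Letter X n} (h : Opp a b) (h' : Opp a c) : b = c :=
  h.2.trans h'.2.symm

theorem Opp.left_unique {a b c : Letter X n} (h : Opp a c) (h' : Opp b c) : a = b :=
  h.symm.right_unique h'.symm

/-! ### The vectors of the letters and their inner products -/

theorem e_dotProduct {k : ℕ} (hk : k < dim X n) (x : Amb X n) : e X n k ⬝ᵥ x = x ⟨k, hk⟩ := by
  simp only [dotProduct, e]
  rw [Finset.sum_eq_single ⟨k, hk⟩]
  · simp
  · intro j _ hj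
    have : (j : ℕ) ≠ k := fun h => hj (Fin.ext h)
    simp [this]
  · simp

theorem e_dotProduct_e {k l : ℕ} (hk : k < dim X n) :
    e X n k ⬝ᵥ e X n l = if k = l then 1 else 0 := by
  rw [e_dotProduct hk]; rfl

theorem eps_of_lt {a : Letter X n} (h : X = A ∨ (a : ℕ) < n) : eps a = e X n a := by
  cases X <;> simp_all [eps]

theorem eps_of_ge (hX : X ≠ A) {a : Letter X n} (h : n ≤ a) :
    eps a = -e X n (2 * n - 1 - a) := by
  rw [← val_rev_of_ne hX]
  cases X
  · exact absurd rfl hX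
  all_goals simp only [eps]; rw [if_neg (by omega)]

theorem val_lt_dim {a : Letter X n} (h : X = A ∨ (a : ℕ) < n) : (a : ℕ) < dim X n := by
  have := a.2
  cases X <;> simp_all [dim, alphabetSize]

theorem eq_A_or_lt_or_ge (a : Letter X n) : (X = A ∨ (a : ℕ) < n) ∨ (X ≠ A ∧ n ≤ a) := by
  by_cases h : X = A
  · exact .inl (.inl h)
  · rcases lt_or_ge (a : ℕ) n with h' | h'
    · exact .inl (.inr h')
    · exact .inr ⟨h, h'⟩

theorem eps_eq_neg_of_opp {a b : Letter X n} (h : Opp a b) : eps b = -eps a := by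
  have h1 := opp_iff.1 h
  rcases eq_A_or_lt_or_ge a with ha | ha <;> rcases eq_A_or_lt_or_ge b with hb | hb
  · rcases ha with ha | ha
    · exact absurd ha h1.1
    rcases hb with hb | hb
    · exact absurd hb h1.1
    omega
  · rw [eps_of_lt ha, eps_of_ge hb.1 hb.2]
    congr 2; omega
  · rw [eps_of_lt hb, eps_of_ge ha.1 ha.2, neg_neg]
    congr 1; omega
  · omega

theorem eps_dotProduct_eps (a b : Letter X n) :
    eps a ⬝ᵥ eps b = if a = b then 1 else if Opp a b then -1 else 0 := by
  simp only [opp_iff, Fin.ext_iff]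
  have h1 : X ≠ A → (a : ℕ) < 2 * n := fun h => val_lt_of_ne h a
  have h2 : X ≠ A → (b : ℕ) < 2 * n := fun h => val_lt_of_ne h b
  rcases eq_A_or_lt_or_ge a with ha | ha <;> rcases eq_A_or_lt_or_ge b with hb | hb
  · rw [eps_of_lt ha, eps_of_lt hb, e_dotProduct_e (val_lt_dim ha)]
    split_ifs with h3 h4
    · rfl
    · rcases ha with ha | ha
      · exact absurd ha h4.1
      rcases hb with hb | hb
      · exact absurd hb h4.1
      omega
    · rfl
  · rw [eps_of_lt ha, eps_of_ge hb.1 hb.2, dotProduct_neg, e_dotProduct_e (val_lt_dim ha)]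
    have h3 := h2 hb.1
    have h4 := ha.resolve_left hb.1
    simp only [ne_eq, hb.1, not_false_eq_true, true_and]
    split_ifs <;> first | omega | simp
  · have h3 := h1 ha.1
    rw [eps_of_lt hb, eps_of_ge ha.1 ha.2, neg_dotProduct,
      e_dotProduct_e (by rw [dim_of_ne ha.1]; omega)]
    have h4 := hb.resolve_left ha.1
    simp only [ne_eq, ha.1, not_false_eq_true, true_and]
    split_ifs <;> first | omega | simp
  · have h3 := h1 ha.1
    have h4 := h2 hb.1
    rw [eps_of_ge hb.1 hb.2, eps_of_ge ha.1 ha.2, neg_dotProduct, dotProduct_neg, neg_neg,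
      e_dotProduct_e (by rw [dim_of_ne ha.1]; omega)]
    split_ifs <;> first | omega | simp

theorem eps_dotProduct_self (a : Letter X n) : eps a ⬝ᵥ eps a = 1 := by
  simp [eps_dotProduct_eps]

theorem eps_injective : Function.Injective (eps : Letter X n → Amb X n) := by
  intro a b h
  by_contra hab
  have h1 := eps_dotProduct_self a
  nth_rewrite 2 [h] at h1
  rw [eps_dotProduct_eps, if_neg hab] at h1
  split_ifs at h1 <;> norm_num at h1

/-- A strictly dominant vector. -/
def rho (X : ClassicalType) (n : ℕ) : Amb X n := fun j => (dim X n : ℝ) - (j : ℕ)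

/-- The coordinates of `rho` are positive and strictly decreasing, so the values fall along the
unbarred letters, change sign after `n`, and keep falling along the barred ones. The order of
letters thereby becomes the sign of a linear functional. -/
theorem eps_dotProduct_rho_strictAnti :
    StrictAnti fun a : Letter X n => eps a ⬝ᵥ rho X n := by
  have key : ∀ a : Letter X n, (X = A ∨ (a : ℕ) < n) ∧ eps a ⬝ᵥ rho X n = dim X n - (a : ℕ) ∨
      (X ≠ A ∧ n ≤ a) ∧ eps a ⬝ᵥ rho X n = (n : ℝ) - 1 - (a : ℕ) := by
    intro a
    rcases eq_A_or_lt_or_ge a with h | h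
    · exact .inl ⟨h, by rw [eps_of_lt h, e_dotProduct (val_lt_dim h), rho]⟩
    · refine .inr ⟨h, ?_⟩
      have h1 := val_lt_of_ne h.1 a
      rw [eps_of_ge h.1 h.2, neg_dotProduct, e_dotProduct (by rw [dim_of_ne h.1]; omega)]
      simp only [rho, dim_of_ne h.1]
      rw [Nat.cast_sub (by omega), Nat.cast_sub (by omega)]
      push_cast
      ring
  intro a b hab
  have h0 : (a : ℕ) < b := hab
  have h1 : ((a : ℕ) : ℝ) + 1 ≤ (b : ℕ) := by exact_mod_cast h0
  have h2 : (n : ℝ) ≤ dim X n := by exact_mod_cast le_dim X n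
  show eps b ⬝ᵥ rho X n < eps a ⬝ᵥ rho X n
  rcases key a with ⟨h3, h4⟩ | ⟨h3, h4⟩ <;> rcases key b with ⟨h5, h6⟩ | ⟨h5, h6⟩ <;> rw [h4, h6]
  · linarith
  · linarith
  · have := h5.resolve_left h3.1
    omega
  · linarith

theorem lt_iff_rho {a b : Letter X n} : a < b ↔ 0 < (eps a - eps b) ⬝ᵥ rho X n := by
  rw [sub_dotProduct, sub_pos]
  exact eps_dotProduct_rho_strictAnti.lt_iff_gt.symm

/-! ### Positive roots as multiples of differences of letter vectors -/

theorem posRoots_eq (hX : X ≠ A) : posRoots X n =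
    {x | ∃ i j : Fin n, i < j ∧ x = e X n i - e X n j} ∪
    ({x | ∃ i j : Fin n, i < j ∧ x = e X n i + e X n j} ∪
      {x | ∃ i : Fin n, x = (if X = B then (2 : ℝ) else 1) • e X n i}) := by
  cases X
  · exact absurd rfl hX
  · simp only [posRoots, if_true]; rfl
  · simp only [posRoots, reduceCtorEq, if_false, one_smul]; rfl

/-- The factor by which `ε_a - ε_b` has to be multiplied to become a root. -/
def rootScale (a b : Letter X n) : ℝ := if Opp a b ∧ X = C then 1 / 2 else 1

theorem rootScale_pos (a b : Letter X n) : 0 < rootScale a b := by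
  unfold rootScale; split_ifs <;> norm_num

theorem rootScale_of_not_opp {a b : Letter X n} (h : ¬Opp a b) : rootScale a b = 1 :=
  if_neg fun h' => h h'.1

theorem rootScale_two_of_opp {a b : Letter X n} (h : Opp a b) :
    rootScale a b * 2 = if X = B then 2 else 1 := by
  have := h.1
  unfold rootScale
  cases X <;> simp_all

/-- The sum ε_i + ε_j is the difference for the letters i and j̄, and the remaining roots 2ε_i (type
B) or ε_i (type C) are multiples of the difference for i and ī. From here on the three types can be
treated together. -/
theorem exists_letters_of_mem_posRoots {β : Amb X n} (hβ : β ∈ posRoots X n) :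
    ∃ a b : Letter X n, a < b ∧ β = rootScale a b • (eps a - eps b) := by
  by_cases hX : X = A
  · subst hX
    rcases hβ with ⟨i, j, hij, rfl⟩ | h
    · exact ⟨i, j, hij, by simp [eps, rootScale]⟩
    · exact absurd h (Set.notMem_empty _)
  · have hN := alphabetSize_of_ne (n := n) hX
    let l : Fin n → Letter X n := fun i => ⟨i, by omega⟩
    have hl : ∀ i, eps (l i) = e X n i := fun i => eps_of_lt (.inr i.2)
    have hr : ∀ i, Opp (l i) (l i).rev := fun i => ⟨hX, rfl⟩
    have hr' : ∀ i, eps (l i).rev = -e X n i := fun i => by rw [eps_eq_neg_of_opp (hr i), hl]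
    have hv : ∀ i, ((l i).rev : ℕ) = 2 * n - 1 - i := fun i => val_rev_of_ne hX _
    have hv' : ∀ i, ((l i) : ℕ) = i := fun i => rfl
    rw [posRoots_eq hX] at hβ
    rcases hβ with ⟨i, j, hij, rfl⟩ | ⟨i, j, hij, rfl⟩ | ⟨i, rfl⟩
    · have : (i : ℕ) < j := hij
      refine ⟨l i, l j, hij, ?_⟩
      rw [rootScale_of_not_opp, one_smul, hl, hl]
      rw [opp_iff]
      have h1 := hv' i
      have h2 := hv' j
      omega
    · have : (i : ℕ) < j := hij
      refine ⟨l i, (l j).rev, ?_, ?_⟩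
      · have h1 := hv j
        have h2 := hv' i
        rw [Fin.lt_def]; omega
      rw [rootScale_of_not_opp, one_smul, hl, hr', sub_neg_eq_add]
      rw [opp_iff]
      have h1 := hv j
      have h2 := hv' i
      rintro ⟨-, h⟩
      omega
    · refine ⟨l i, (l i).rev, ?_, ?_⟩
      · rw [Fin.lt_def, hv, hv']; omega
      rw [hl, hr', sub_neg_eq_add, ← two_smul ℝ, smul_smul, rootScale_two_of_opp (hr i)]

theorem letters_mem_posRoots {a b : Letter X n} (hab : a < b) :
    rootScale a b • (eps a - eps b) ∈ posRoots X n := by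
  have h0 : (a : ℕ) < b := hab
  by_cases hX : X = A
  · subst hX
    rw [rootScale_of_not_opp (fun h => h.1 rfl), one_smul]
    exact .inl ⟨a, b, hab, rfl⟩
  · have ha' := val_lt_of_ne hX a
    have hb' := val_lt_of_ne hX b
    rw [posRoots_eq hX]
    rcases eq_A_or_lt_or_ge a with ha | ha <;> rcases eq_A_or_lt_or_ge b with hb | hb
    · have ha := ha.resolve_left hX
      have hb := hb.resolve_left hX
      rw [eps_of_lt (.inr ha), eps_of_lt (.inr hb), rootScale_of_not_opp, one_smul]
      · exact .inl ⟨⟨a, ha⟩, ⟨b, hb⟩, hab, rfl⟩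
      · rw [opp_iff]; omega
    · have ha := ha.resolve_left hX
      rw [eps_of_lt (.inr ha), eps_of_ge hb.1 hb.2, sub_neg_eq_add]
      -- Counting from 0, the barred letter `b` is the bar of `2 * n - 1 - b`. The root is ε_i +
      -- ε_j, with the indices in one order or the other, or a multiple of one ε_i.
      rcases lt_trichotomy (a : ℕ) (2 * n - 1 - b) with h | h | h
      · rw [rootScale_of_not_opp (by rw [opp_iff]; omega), one_smul]
        exact .inr (.inl ⟨⟨a, ha⟩, ⟨2 * n - 1 - b, by omega⟩, h, rfl⟩)
      · refine .inr (.inr ⟨⟨a, ha⟩, ?_⟩)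
        have : Opp a b := by rw [opp_iff]; exact ⟨hX, by omega⟩
        rw [← h, ← two_smul ℝ, smul_smul, rootScale_two_of_opp this]
      · rw [rootScale_of_not_opp (by rw [opp_iff]; omega), one_smul]
        exact .inr (.inl ⟨⟨2 * n - 1 - b, by omega⟩, ⟨a, ha⟩, h, add_comm _ _⟩)
    · have hb := hb.resolve_left hX
      omega
    · rw [eps_of_ge ha.1 ha.2, eps_of_ge hb.1 hb.2, rootScale_of_not_opp (by rw [opp_iff]; omega),
        one_smul]
      refine .inl ⟨⟨2 * n - 1 - b, by omega⟩, ⟨2 * n - 1 - a, by omega⟩, ?_, by simp; abel⟩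
      simp only [Fin.mk_lt_mk]; omega

/-! ### Reflections and the finite Weyl group -/

theorem perm_apply_inv {α : Type*} (w : Equiv.Perm α) (x : α) : w (w⁻¹ x) = x :=
  w.apply_symm_apply x

theorem perm_inv_apply {α : Type*} (w : Equiv.Perm α) (x : α) : w⁻¹ (w x) = x :=
  w.symm_apply_apply x

theorem affRefl_apply (β : Amb X n) (k : ℤ) (x : Amb X n) :
    affRefl β k x = x - ((β ⬝ᵥ x + k) * (2 / (β ⬝ᵥ β))) • β := rfl

theorem affRefl_inv (β : Amb X n) (k : ℤ) : (affRefl β k)⁻¹ = affRefl β k := rfl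

theorem affRefl_smul {r : ℝ} (hr : r ≠ 0) (β : Amb X n) : affRefl (r • β) 0 = affRefl β 0 := by
  ext1 x
  rw [affRefl_apply, affRefl_apply, smul_smul]
  congr 2
  simp only [smul_dotProduct, dotProduct_smul, smul_eq_mul, Int.cast_zero, add_zero]
  by_cases h : β ⬝ᵥ β = 0
  · simp [h]
  · field_simp

theorem affRefl_neg (β : Amb X n) : affRefl (-β) 0 = affRefl β 0 := by
  have := affRefl_smul (r := -1) (by norm_num) β
  rwa [neg_one_smul] at this

/-- The linear reflection along `ε_a - ε_b`. -/
def swapRefl (a b : Letter X n) : Equiv.Perm (Amb X n) := affRefl (eps a - eps b) 0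

theorem swapRefl_mul_self (a b : Letter X n) : swapRefl a b * swapRefl a b = 1 := by
  ext1 x
  exact affReflFun_involutive _ _ x

theorem swapRefl_inv (a b : Letter X n) : (swapRefl a b)⁻¹ = swapRefl a b := rfl

theorem swapRefl_comm (a b : Letter X n) : swapRefl a b = swapRefl b a := by
  rw [swapRefl, ← neg_sub, affRefl_neg]; rfl

theorem posRoots_subset_roots : posRoots X n ⊆ roots X n := fun _ h => .inl h

theorem neg_mem_roots {β : Amb X n} (h : β ∈ roots X n) : -β ∈ roots X n := by
  rcases h with h | h
  · exact .inr (by rwa [neg_neg])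
  · exact .inl h

theorem exists_letters_of_mem_roots {β : Amb X n} (hβ : β ∈ roots X n) :
    ∃ a b : Letter X n, a ≠ b ∧ β = rootScale a b • (eps a - eps b) := by
  rcases hβ with h | h
  · obtain ⟨a, b, hab, rfl⟩ := exists_letters_of_mem_posRoots h
    exact ⟨a, b, hab.ne, rfl⟩
  · obtain ⟨a, b, hab, h⟩ := exists_letters_of_mem_posRoots h
    refine ⟨b, a, hab.ne', ?_⟩
    rw [← neg_sub, smul_neg, ← neg_eq_iff_eq_neg, h, rootScale, rootScale, opp_comm]

theorem letters_mem_roots {a b : Letter X n} (hab : a ≠ b) :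
    rootScale a b • (eps a - eps b) ∈ roots X n := by
  rcases lt_or_gt_of_ne hab with h | h
  · exact .inl (letters_mem_posRoots h)
  · refine .inr ?_
    have := letters_mem_posRoots h
    rwa [← smul_neg, neg_sub, rootScale, opp_comm]

theorem affRefl_eq_swapRefl {β : Amb X n} (hβ : β ∈ roots X n) :
    ∃ a b : Letter X n, a < b ∧ affRefl β 0 = swapRefl a b := by
  obtain ⟨a, b, hab, rfl⟩ := exists_letters_of_mem_roots hβ
  rcases lt_or_gt_of_ne hab with h | h
  · exact ⟨a, b, h, affRefl_smul (rootScale_pos a b).ne' _⟩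
  · exact ⟨b, a, h, by rw [affRefl_smul (rootScale_pos a b).ne', swapRefl_comm]; rfl⟩

theorem swapRefl_eq_affRefl {a b : Letter X n} (hab : a ≠ b) :
    ∃ β ∈ roots X n, swapRefl a b = affRefl β 0 :=
  ⟨_, letters_mem_roots hab, (affRefl_smul (rootScale_pos a b).ne' _).symm⟩

theorem swapRefl_mem_weyl {a b : Letter X n} (hab : a ≠ b) : swapRefl a b ∈ weyl X n :=
  Subgroup.subset_closure (swapRefl_eq_affRefl hab)

theorem weyl_induction {p : Equiv.Perm (Amb X n) → Prop} (one : p 1)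
    (step : ∀ (a b : Letter X n), a < b → ∀ w ∈ weyl X n, p w → p (swapRefl a b * w))
    {w : Equiv.Perm (Amb X n)} (hw : w ∈ weyl X n) : p w := by
  induction hw using Subgroup.closure_induction_left with
  | one => exact one
  | mul_left x hx y hy h =>
    obtain ⟨β, hβ, rfl⟩ := hx
    obtain ⟨a, b, hab, e⟩ := affRefl_eq_swapRefl hβ
    rw [e]
    exact step a b hab y hy h
  | inv_mul_cancel x hx y hy h =>
    obtain ⟨β, hβ, rfl⟩ := hx
    obtain ⟨a, b, hab, e⟩ := affRefl_eq_swapRefl hβ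
    rw [affRefl_inv, e]
    exact step a b hab y hy h

/-! ### Weyl group elements as linear isometries -/

theorem affRefl_zero_apply (β x : Amb X n) :
    affRefl β 0 x = x - ((β ⬝ᵥ x) * (2 / (β ⬝ᵥ β))) • β := by
  rw [affRefl_apply, Int.cast_zero, add_zero]

theorem affRefl_zero_dotProduct (β x y : Amb X n) :
    affRefl β 0 x ⬝ᵥ affRefl β 0 y = x ⬝ᵥ y := by
  rw [affRefl_zero_apply, affRefl_zero_apply]
  by_cases h : β ⬝ᵥ β = 0
  · simp [h]
  · simp only [sub_dotProduct, dotProduct_sub, smul_dotProduct, dotProduct_smul, smul_eq_mul,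
      dotProduct_comm x β]
    field_simp
    ring

theorem exists_linearMap_of_mem_weyl {w : Equiv.Perm (Amb X n)} (hw : w ∈ weyl X n) :
    ∃ L : Amb X n →ₗ[ℝ] Amb X n, ∀ x, w x = L x := by
  refine weyl_induction (p := fun w => ∃ L : Amb X n →ₗ[ℝ] Amb X n, ∀ x, w x = L x)
    ⟨.id, fun x => rfl⟩ ?_ hw
  rintro a b hab w - ⟨L, hL⟩
  have h : ∃ M : Amb X n →ₗ[ℝ] Amb X n, ∀ x, swapRefl a b x = M x := by
    refine ⟨⟨⟨swapRefl a b, fun x y => ?_⟩, fun r x => ?_⟩, fun x => rfl⟩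
    · simp only [swapRefl, affRefl_zero_apply, dotProduct_add, add_mul, add_smul]
      abel
    · simp only [swapRefl, affRefl_zero_apply, dotProduct_smul, smul_eq_mul, RingHom.id_apply,
        smul_sub, smul_smul, mul_assoc]
  obtain ⟨M, hM⟩ := h
  exact ⟨M ∘ₗ L, fun x => by simp [hL, hM]⟩

section Weyl

variable {w : Equiv.Perm (Amb X n)}

theorem weyl_add (hw : w ∈ weyl X n) (x y : Amb X n) : w (x + y) = w x + w y := by
  obtain ⟨L, hL⟩ := exists_linearMap_of_mem_weyl hw
  simp [hL]

theorem weyl_smul (hw : w ∈ weyl X n) (r : ℝ) (x : Amb X n) : w (r • x) = r • w x := by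
  obtain ⟨L, hL⟩ := exists_linearMap_of_mem_weyl hw
  simp [hL]

theorem weyl_sub (hw : w ∈ weyl X n) (x y : Amb X n) : w (x - y) = w x - w y := by
  obtain ⟨L, hL⟩ := exists_linearMap_of_mem_weyl hw
  simp [hL]

theorem weyl_zero (hw : w ∈ weyl X n) : w 0 = 0 := by
  obtain ⟨L, hL⟩ := exists_linearMap_of_mem_weyl hw
  simp [hL]

theorem weyl_dotProduct (hw : w ∈ weyl X n) (x y : Amb X n) : w x ⬝ᵥ w y = x ⬝ᵥ y := by
  refine weyl_induction (p := fun w => w x ⬝ᵥ w y = x ⬝ᵥ y) rfl ?_ hw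
  rintro a b hab w - h
  rw [← h]
  exact affRefl_zero_dotProduct _ _ _

theorem weyl_dotProduct_left (hw : w ∈ weyl X n) (x y : Amb X n) : w x ⬝ᵥ y = x ⬝ᵥ w⁻¹ y := by
  rw [← weyl_dotProduct hw x (w⁻¹ y), perm_apply_inv]

theorem affRefl_conj (hw : w ∈ weyl X n) (β : Amb X n) :
    w * affRefl β 0 * w⁻¹ = affRefl (w β) 0 := by
  ext1 x
  simp only [Equiv.Perm.mul_apply, affRefl_zero_apply, weyl_sub hw, weyl_smul hw,
    perm_apply_inv, weyl_dotProduct_left hw, perm_inv_apply]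

end Weyl

/-- The action of `swapRefl a b` on letters. -/
def swapLetter (a b l : Letter X n) : Letter X n :=
  if l = a then b else if l = b then a else if Opp a l then b.rev else if Opp b l then a.rev else l

theorem opp_rev_of_opp {a b l : Letter X n} (h : Opp a l) : Opp b b.rev := ⟨h.1, rfl⟩

theorem opp_iff_dotProduct {a b : Letter X n} : Opp a b ↔ eps a ⬝ᵥ eps b = -1 := by
  rw [eps_dotProduct_eps]
  split_ifs with h1 h2
  · simp only [show (1 : ℝ) ≠ -1 by norm_num, iff_false]
    exact fun h => h.ne h1
  · simpa using h2
  · simpa using h2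

/-- If `a` and `b` are opposite, the root is proportional to `eps a` and the reflection just negates
this vector. Otherwise `eps a - eps b` has squared length 2, and the reflection interchanges `eps a`
and `eps b`, and with them their negatives. -/
theorem swapRefl_eps {a b : Letter X n} (hab : a ≠ b) (l : Letter X n) :
    swapRefl a b (eps l) = eps (swapLetter a b l) := by
  rw [swapRefl, affRefl_zero_apply, swapLetter]
  by_cases ho : Opp a b
  · have hb := eps_eq_neg_of_opp ho
    have h2 : eps a - eps b = (2 : ℝ) • eps a := by rw [hb, sub_neg_eq_add, two_smul]
    simp only [h2, smul_dotProduct, dotProduct_smul, eps_dotProduct_self, smul_eq_mul, smul_smul]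
    split_ifs with h3 h4 h5 h6
    · rw [h3, eps_dotProduct_self, hb]; module
    · rw [h4, hb, dotProduct_neg, eps_dotProduct_self]; module
    · exact absurd (h5.right_unique ho) h4
    · exact absurd (h6.right_unique ho.symm) h3
    · rw [eps_dotProduct_eps, if_neg (Ne.symm h3), if_neg h5]; module
  · have h2 : (eps a - eps b) ⬝ᵥ (eps a - eps b) = 2 := by
      simp only [sub_dotProduct, dotProduct_sub, eps_dotProduct_eps, if_true, if_neg hab,
        if_neg hab.symm, if_neg ho, if_neg (fun h => ho (Opp.symm h))]
      norm_num
    rw [h2, sub_dotProduct]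
    split_ifs with h3 h4 h5 h6
    · rw [h3, eps_dotProduct_self, eps_dotProduct_eps, if_neg hab.symm,
        if_neg (fun h => ho (Opp.symm h))]; module
    · rw [h4, eps_dotProduct_self, eps_dotProduct_eps, if_neg hab, if_neg ho]; module
    · rw [eps_eq_neg_of_opp (opp_rev_of_opp h5), eps_dotProduct_eps, if_neg (Ne.symm h3), if_pos h5,
        eps_dotProduct_eps, if_neg (Ne.symm h4), if_neg (fun h => hab (h5.left_unique h)),
        eps_eq_neg_of_opp h5]
      module
    · rw [eps_eq_neg_of_opp (opp_rev_of_opp h6), eps_dotProduct_eps, if_neg (Ne.symm h3), if_neg h5,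
        eps_dotProduct_eps, if_neg (Ne.symm h4), if_pos h6, eps_eq_neg_of_opp h6]
      module
    · rw [eps_dotProduct_eps, if_neg (Ne.symm h3), if_neg h5,
        eps_dotProduct_eps, if_neg (Ne.symm h4), if_neg h6]
      module

theorem exists_eps_eq {w : Equiv.Perm (Amb X n)} (hw : w ∈ weyl X n) (l : Letter X n) :
    ∃ m : Letter X n, eps m = w (eps l) := by
  refine weyl_induction (p := fun w => ∃ m : Letter X n, eps m = w (eps l)) ⟨l, rfl⟩ ?_ hw
  rintro a b hab w - ⟨m, hm⟩
  exact ⟨swapLetter a b m, by rw [Equiv.Perm.mul_apply, ← hm, swapRefl_eps hab.ne]⟩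

/-- The action of a Weyl group element on the letters. -/
def act (w : Equiv.Perm (Amb X n)) (l : Letter X n) : Letter X n :=
  if h : ∃ m : Letter X n, eps m = w (eps l) then h.choose else l

section act

variable {w v : Equiv.Perm (Amb X n)}

theorem eps_act (hw : w ∈ weyl X n) (l : Letter X n) : eps (act w l) = w (eps l) := by
  rw [act, dif_pos (exists_eps_eq hw l)]
  exact (exists_eps_eq hw l).choose_spec

theorem act_one (l : Letter X n) : act 1 l = l :=
  eps_injective (eps_act (one_mem _) l)

theorem act_mul (hw : w ∈ weyl X n) (hv : v ∈ weyl X n) (l : Letter X n) :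
    act (w * v) l = act w (act v l) := by
  apply eps_injective
  rw [eps_act (mul_mem hw hv), eps_act hw, eps_act hv]; rfl

theorem act_inv_act (hw : w ∈ weyl X n) (l : Letter X n) : act w⁻¹ (act w l) = l := by
  rw [← act_mul (inv_mem hw) hw, inv_mul_cancel, act_one]

theorem act_act_inv (hw : w ∈ weyl X n) (l : Letter X n) : act w (act w⁻¹ l) = l := by
  rw [← act_mul hw (inv_mem hw), mul_inv_cancel, act_one]

theorem act_injective (hw : w ∈ weyl X n) : Function.Injective (act w) :=
  Function.LeftInverse.injective (act_inv_act hw)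

theorem opp_act_iff (hw : w ∈ weyl X n) {a b : Letter X n} :
    Opp (act w a) (act w b) ↔ Opp a b := by
  rw [opp_iff_dotProduct, opp_iff_dotProduct, eps_act hw, eps_act hw, weyl_dotProduct hw]

theorem act_swapRefl {a b : Letter X n} (hab : a ≠ b) (l : Letter X n) :
    act (swapRefl a b) l = swapLetter a b l :=
  eps_injective (by rw [eps_act (swapRefl_mem_weyl hab), swapRefl_eps hab])

theorem swapRefl_conj (hw : w ∈ weyl X n) (a b : Letter X n) :
    w * swapRefl a b * w⁻¹ = swapRefl (act w a) (act w b) := by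
  rw [swapRefl, affRefl_conj hw, weyl_sub hw, ← eps_act hw, ← eps_act hw]; rfl

end act

theorem swapLetter_left (a b : Letter X n) : swapLetter a b a = b := if_pos rfl

theorem swapLetter_right (a b : Letter X n) : swapLetter a b b = a := by
  rw [swapLetter]
  by_cases h : b = a
  · rw [if_pos h, h]
  · rw [if_neg h, if_pos rfl]

/-- Barring both letters only changes the sign of the root. -/
theorem swapRefl_of_opp {a a' b b' : Letter X n} (h : Opp a a') (h' : Opp b b') :
    swapRefl a b = swapRefl a' b' := by
  rw [swapRefl_comm a', swapRefl, swapRefl, eps_eq_neg_of_opp h, eps_eq_neg_of_opp h']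
  congr 1
  abel

/-! ### Simple reflections, length and the exchange property -/

theorem lt_alphabetSize {k : ℕ} (i : Fin n) (h : k ≤ i + 1) : k < alphabetSize X n := by
  have := i.2
  cases X <;> simp only [alphabetSize] <;> omega

/-- The `i`-th letter. -/
def letter (X : ClassicalType) {n : ℕ} (i : Fin n) : Letter X n :=
  ⟨i, lt_alphabetSize i (by omega)⟩

/-- The letter following the `i`-th letter. -/
def nextLetter (X : ClassicalType) {n : ℕ} (i : Fin n) : Letter X n :=
  ⟨i + 1, lt_alphabetSize i (by omega)⟩

theorem letter_lt_nextLetter (i : Fin n) : letter X i < nextLetter X i := by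
  simp [letter, nextLetter, Fin.lt_def]

theorem simpleRoot_eq (i : Fin n) : simpleRoot X n i =
    rootScale (letter X i) (nextLetter X i) • (eps (letter X i) - eps (nextLetter X i)) := by
  have hi := i.2
  have h1 : ((letter X i : Letter X n) : ℕ) = i := rfl
  have h2 : ((nextLetter X i : Letter X n) : ℕ) = i + 1 := rfl
  by_cases hX : X = A
  · rw [rootScale_of_not_opp (fun h => h.1 hX), one_smul, eps_of_lt (.inl hX), eps_of_lt (.inl hX),
      h1, h2]
    subst hX; rfl
  · rw [eps_of_lt (.inr (by omega)), h1]
    by_cases h : (i : ℕ) + 1 < n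
    · rw [rootScale_of_not_opp (by rw [opp_iff]; omega), one_smul,
        eps_of_lt (.inr (by omega)), h2]
      cases X
      · exact absurd rfl hX
      all_goals simp [simpleRoot, h]
    · have ho : Opp (letter X i) (nextLetter X i) := by
        rw [opp_iff]
        exact ⟨hX, by omega⟩
      rw [eps_of_ge hX (by omega), h2, show 2 * n - 1 - (i + 1 : ℕ) = i by omega, sub_neg_eq_add,
        ← two_smul ℝ, smul_smul, rootScale_two_of_opp ho]
      cases X
      · exact absurd rfl hX
      all_goals simp [simpleRoot, h]

/-- The simple reflections. -/
def simpleRefl (X : ClassicalType) {n : ℕ} (i : Fin n) : Equiv.Perm (Amb X n) :=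
  swapRefl (letter X i) (nextLetter X i)

theorem affRefl_simpleRoot (i : Fin n) : affRefl (simpleRoot X n i) 0 = simpleRefl X i := by
  rw [simpleRoot_eq, affRefl_smul (rootScale_pos _ _).ne']; rfl

theorem simpleRefl_mem (i : Fin n) : simpleRefl X i ∈ weyl X n :=
  swapRefl_mem_weyl (letter_lt_nextLetter i).ne

/-- A simple reflection interchanges two neighbouring letters and their bars, so the only pairs it
can reverse are those neighbours, and these define the reflection itself. This is the fact that a
simple reflection permutes the positive roots not proportional to its own. -/
theorem act_simpleRefl_lt {a b : Letter X n} (i : Fin n) (hab : a < b) :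
    act (simpleRefl X i) a < act (simpleRefl X i) b ∨ swapRefl a b = simpleRefl X i := by
  have hi := i.2
  have h0 : (a : ℕ) < b := hab
  by_cases h1 : a = letter X i ∧ b = nextLetter X i
  · right; rw [h1.1, h1.2]; rfl
  by_cases h2 : Opp (nextLetter X i) a ∧ Opp (letter X i) b
  · right; rw [swapRefl_of_opp h2.1.symm h2.2.symm, swapRefl_comm]; rfl
  left
  rw [simpleRefl, act_swapRefl (letter_lt_nextLetter i).ne,
    act_swapRefl (letter_lt_nextLetter i).ne, Fin.lt_def]
  have e1 : ((letter X i : Letter X n) : ℕ) = i := rfl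
  have e2 : ((nextLetter X i : Letter X n) : ℕ) = i + 1 := rfl
  by_cases hX : X = A
  · simp only [swapLetter, Opp, hX, ne_eq, not_true_eq_false, false_and, if_false, Fin.ext_iff]
      at h1 ⊢
    split_ifs <;> omega
  · have e3 := val_rev_of_ne hX (letter X i)
    have e4 := val_rev_of_ne hX (nextLetter X i)
    have ha := val_lt_of_ne hX a
    have hb := val_lt_of_ne hX b
    simp only [swapLetter, opp_iff, Fin.ext_iff, hX, ne_eq, not_false_eq_true, true_and] at h1 h2 ⊢
    split_ifs <;> omega

/-- The product of a word in the simple reflections. -/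
def wordProd (X : ClassicalType) {n : ℕ} (l : List (Fin n)) : Equiv.Perm (Amb X n) :=
  (l.map (simpleRefl X)).prod

theorem wordProd_mem (l : List (Fin n)) : wordProd X l ∈ weyl X n := by
  refine Subgroup.list_prod_mem _ fun x hx => ?_
  obtain ⟨i, -, rfl⟩ := List.mem_map.1 hx
  exact simpleRefl_mem i

theorem wordProd_cons (i : Fin n) (l : List (Fin n)) :
    wordProd X (i :: l) = simpleRefl X i * wordProd X l := by simp [wordProd]

theorem simpleRefl_mul_self (i : Fin n) : simpleRefl X i * simpleRefl X i = 1 :=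
  swapRefl_mul_self _ _

/-- The exchange condition. If the first simple reflection keeps `a` and `b` in order, induction
applies to their images, and conjugation carries the result back. Otherwise it equals `swapRefl a b`
and is cancelled. -/
theorem exists_shorter_word (l : List (Fin n)) {a b : Letter X n} (hab : a < b)
    (h : act (wordProd X l)⁻¹ b < act (wordProd X l)⁻¹ a) :
    ∃ l' : List (Fin n), l'.length < l.length ∧ wordProd X l' = swapRefl a b * wordProd X l := by
  induction l generalizing a b with
  | nil => 
    simp only [wordProd, List.map_nil, List.prod_nil, inv_one, act_one] at h
    exact absurd h hab.not_gt
  | cons i t ih =>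
    have hi := simpleRefl_mem (X := X) i
    have hinv : (simpleRefl X i)⁻¹ = simpleRefl X i := rfl
    rcases act_simpleRefl_lt i hab with h1 | h1
    · rw [wordProd_cons, mul_inv_rev, act_mul (inv_mem (wordProd_mem t)) (inv_mem hi),
        act_mul (inv_mem (wordProd_mem t)) (inv_mem hi), hinv] at h
      obtain ⟨l', hl, e⟩ := ih h1 h
      refine ⟨i :: l', by simpa using hl, ?_⟩
      rw [wordProd_cons, e, ← swapRefl_conj hi, wordProd_cons, hinv]
      rw [← mul_assoc, ← mul_assoc, ← mul_assoc, simpleRefl_mul_self, one_mul, mul_assoc]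
    · exact ⟨t, by simp, by rw [wordProd_cons, h1, ← mul_assoc, simpleRefl_mul_self, one_mul]⟩

/-- Induction on the distance of the two letters: conjugation by a reflection in closer letters
brings the pair closer together, until it is a pair of neighbours. -/
theorem swapRefl_mem_closure (d : ℕ) : ∀ {a b : Letter X n}, a < b → (b : ℕ) - a ≤ d →
    swapRefl a b ∈ Subgroup.closure (Set.range (simpleRefl X (n := n))) := by
  induction d with
  | zero => intro a b hab h; have : (a : ℕ) < b := hab; omega
  | succ d ih =>
    intro a b hab h
    have h0 : (a : ℕ) < b := hab
    have key : ∀ c c' : Letter X n, c < c' → act (swapRefl c c') a < act (swapRefl c c') b →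
        (c' : ℕ) - c ≤ d → (act (swapRefl c c') b : ℕ) - act (swapRefl c c') a ≤ d →
        swapRefl a b ∈ Subgroup.closure (Set.range (simpleRefl X (n := n))) := by
      intro c c' hc h1 h2 h3
      have := swapRefl_conj (swapRefl_mem_weyl hc.ne) (act (swapRefl c c') a)
        (act (swapRefl c c') b)
      have hm := swapRefl_mem_weyl hc.ne
      have hs : swapRefl c c' = (swapRefl c c')⁻¹ := rfl
      have e : ∀ l, act (swapRefl c c') (act (swapRefl c c') l) = l := by
        intro l
        nth_rewrite 1 [hs]
        exact act_inv_act hm l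
      rw [e, e] at this
      rw [← this]
      exact mul_mem (mul_mem (ih hc h2) (ih h1 h3)) (inv_mem (ih hc h2))
    by_cases hX : X = A
    · by_cases h1 : (b : ℕ) = a + 1
      · refine Subgroup.subset_closure ⟨⟨a, ?_⟩, ?_⟩
        · have := b.2; subst hX; simp only [alphabetSize] at this; omega
        · rw [simpleRefl]; congr 1; ext; exact h1.symm
      · have hb := b.2
        let c : Letter X n := ⟨a + 1, by omega⟩
        have hc : (c : ℕ) = a + 1 := rfl
        have hac : a < c := by rw [Fin.lt_def]; omega
        have e1 : act (swapRefl a c) a = c := by rw [act_swapRefl hac.ne, swapLetter_left]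
        have e2 : act (swapRefl a c) b = b := by
          rw [act_swapRefl hac.ne, swapLetter, if_neg hab.ne', if_neg (by rw [Fin.ext_iff]; omega),
            if_neg (fun h => h.1 hX), if_neg (fun h => h.1 hX)]
        refine key a c hac ?_ (by omega) ?_
        · rw [e1, e2, Fin.lt_def]; omega
        · rw [e1, e2]; omega
    · have hN := alphabetSize_of_ne (n := n) hX
      have ha' := val_lt_of_ne hX a
      have hb' := val_lt_of_ne hX b
      by_cases h1 : (b : ℕ) = a + 1
      · by_cases h2 : (a : ℕ) < n
        · refine Subgroup.subset_closure ⟨⟨a, h2⟩, ?_⟩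
          rw [simpleRefl]; congr 1; ext; exact h1.symm
        · refine Subgroup.subset_closure ⟨⟨2 * n - 1 - b, by omega⟩, ?_⟩
          rw [simpleRefl, swapRefl_comm]
          refine swapRefl_of_opp ?_ ?_
          · rw [opp_iff]; exact ⟨hX, by simp only [nextLetter]; omega⟩
          · rw [opp_iff]; exact ⟨hX, by simp only [letter]; omega⟩
      -- Here `b` is the bar of `a + 1`. Interchanging `a` and `a + 1` would also raise `b` by one
      -- and leave the distance unchanged, so `b` is lowered instead.
      · by_cases h2 : (b : ℕ) + a + 2 = 2 * n
        · let c : Letter X n := ⟨b - 1, by omega⟩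
          have hc : (c : ℕ) = b - 1 := rfl
          have hac : c < b := by rw [Fin.lt_def]; omega
          have e1 : act (swapRefl c b) b = c := by rw [act_swapRefl hac.ne, swapLetter_right]
          have e2 : act (swapRefl c b) a = a := by
            rw [act_swapRefl hac.ne, swapLetter, if_neg (by rw [Fin.ext_iff]; omega), if_neg hab.ne,
              if_neg (by rw [opp_iff]; omega), if_neg (by rw [opp_iff]; omega)]
          refine key c b hac ?_ (by omega) ?_
          · rw [e1, e2, Fin.lt_def]; omega
          · rw [e1, e2]; omega
        · let c : Letter X n := ⟨a + 1, by omega⟩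
          have hc : (c : ℕ) = a + 1 := rfl
          have hac : a < c := by rw [Fin.lt_def]; omega
          have e1 : act (swapRefl a c) a = c := by rw [act_swapRefl hac.ne, swapLetter_left]
          have e2 : (act (swapRefl a c) b : ℕ) = b ∨
              (a : ℕ) + b + 1 = 2 * n ∧ (act (swapRefl a c) b : ℕ) = b - 1 := by
            have e3 := val_rev_of_ne hX c
            rw [act_swapRefl hac.ne, swapLetter, if_neg hab.ne',
              if_neg (by rw [Fin.ext_iff]; omega)]
            by_cases ho : Opp a b
            · rw [if_pos ho]; rw [opp_iff] at ho; omega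
            · rw [if_neg ho, if_neg (by rw [opp_iff]; omega)]; exact .inl rfl
          refine key a c hac ?_ (by omega) ?_
          · rw [e1, Fin.lt_def]; omega
          · rw [e1]; omega

theorem exists_wordProd_eq {w : Equiv.Perm (Amb X n)} (hw : w ∈ weyl X n) :
    ∃ l : List (Fin n), wordProd X l = w := by
  have h : w ∈ Subgroup.closure (Set.range (simpleRefl X (n := n))) := by
    refine weyl_induction (p := fun w => w ∈ Subgroup.closure (Set.range (simpleRefl X (n := n))))
      (one_mem _) (fun a b hab w _ h => mul_mem (swapRefl_mem_closure _ hab le_rfl) h) hw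
  clear hw
  have cons : ∀ x ∈ Set.range (simpleRefl X (n := n)), ∀ y,
      (∃ l, wordProd X l = y) → ∃ l : List (Fin n), wordProd X l = x * y := by
    rintro _ ⟨i, rfl⟩ _ ⟨l, rfl⟩
    exact ⟨i :: l, wordProd_cons i l⟩
  induction h using Subgroup.closure_induction_left with
  | one => exact ⟨[], rfl⟩
  | mul_left x hx y hy h => exact cons x hx y h
  | inv_mul_cancel x hx y hy h =>
    have : x⁻¹ = x := by obtain ⟨i, rfl⟩ := hx; rfl
    rw [this]
    exact cons x hx y h

theorem length_le (l : List (Fin n)) : length (wordProd X l) ≤ l.length := by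
  refine Nat.sInf_le ⟨l, rfl, ?_⟩
  simp only [affRefl_simpleRoot]; rfl

theorem exists_reduced_word {w : Equiv.Perm (Amb X n)} (hw : w ∈ weyl X n) :
    ∃ l : List (Fin n), l.length = length w ∧ wordProd X l = w := by
  obtain ⟨l, h⟩ := exists_wordProd_eq hw
  have := Nat.sInf_mem (s := {m | ∃ l : List (Fin n), l.length = m ∧
    (l.map fun i => affRefl (simpleRoot X n i) 0).prod = w})
    ⟨l.length, l, rfl, by simp only [affRefl_simpleRoot]; exact h⟩
  obtain ⟨l', h1, h2⟩ := this
  refine ⟨l', h1, ?_⟩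
  simp only [affRefl_simpleRoot] at h2
  exact h2

theorem length_swapRefl_mul_lt {w : Equiv.Perm (Amb X n)} (hw : w ∈ weyl X n) {a b : Letter X n}
    (hab : a < b) (h : act w⁻¹ b < act w⁻¹ a) : length (swapRefl a b * w) < length w := by
  obtain ⟨l, hl, rfl⟩ := exists_reduced_word hw
  obtain ⟨l', h1, h2⟩ := exists_shorter_word l hab h
  rw [← h2, ← hl]
  exact (length_le l').trans_lt h1

/-- The pair is reversed for `swapRefl a b * w`, so by `length_swapRefl_mul_lt` a second
multiplication by the reflection, which gives back `w`, shortens it. -/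
theorem bruhatLE_swapRefl_mul {w : Equiv.Perm (Amb X n)} (hw : w ∈ weyl X n) {a b : Letter X n}
    (hab : a < b) (h : act w⁻¹ a < act w⁻¹ b) : BruhatLE w (swapRefl a b * w) := by
  obtain ⟨β, hβ, e⟩ := swapRefl_eq_affRefl hab.ne
  refine Relation.ReflTransGen.single ⟨⟨β, hβ, by rw [e]⟩, ?_⟩
  have hs := swapRefl_mem_weyl hab.ne
  have := length_swapRefl_mul_lt (mul_mem hs hw) hab (by
    rw [mul_inv_rev, act_mul (inv_mem hw) (inv_mem hs), act_mul (inv_mem hw) (inv_mem hs),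
      swapRefl_inv, act_swapRefl hab.ne, act_swapRefl hab.ne, swapLetter_left, swapLetter_right]
    exact h)
  rwa [← mul_assoc, swapRefl_mul_self, one_mul] at this

/-- The length condition in a Bruhat step becomes a condition on letters: were the pair reversed by
`w⁻¹`, the length would drop. -/
theorem bruhat_induction {p : Equiv.Perm (Amb X n) → Prop} {u v : Equiv.Perm (Amb X n)}
    (hu : u ∈ weyl X n) (huv : BruhatLE u v) (base : p u)
    (step : ∀ w ∈ weyl X n, ∀ a b : Letter X n, a < b → act w⁻¹ a < act w⁻¹ b → p w →
      p (swapRefl a b * w)) : p v ∧ v ∈ weyl X n := by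
  induction huv with
  | refl => exact ⟨base, hu⟩
  | @tail x _ _ h ih =>
    obtain ⟨⟨β, hβ, rfl⟩, hl⟩ := h
    obtain ⟨a, b, hab, e⟩ := affRefl_eq_swapRefl hβ
    rw [e] at hl ⊢
    refine ⟨step _ ih.2 a b hab ?_ ih.1, mul_mem (swapRefl_mem_weyl hab.ne) ih.2⟩
    rcases lt_trichotomy (act x⁻¹ a) (act x⁻¹ b) with h | h | h
    · exact h
    · exact absurd (act_injective (inv_mem ih.2) h) hab.ne
    · exact absurd hl (length_swapRefl_mul_lt ih.2 hab h).not_gt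

/-! ### Bruhat order and columns -/

/-- The number of letters of `S` that are at most `l`. -/
def countLE (S : Finset (Letter X n)) (l : Letter X n) : ℕ := (S.filter (· ≤ l)).card

/-- The images of the first `p` letters under `w`. -/
def initCol (w : Equiv.Perm (Amb X n)) (p : ℕ) : Finset (Letter X n) :=
  (Finset.univ.filter fun l : Letter X n => (l : ℕ) < p).image (act w)

theorem mem_initCol {w : Equiv.Perm (Amb X n)} (hw : w ∈ weyl X n) {p : ℕ} {l : Letter X n} :
    l ∈ initCol w p ↔ (act w⁻¹ l : ℕ) < p := by
  simp only [initCol, Finset.mem_image, Finset.mem_filter, Finset.mem_univ, true_and]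
  constructor
  · rintro ⟨a, ha, rfl⟩
    rwa [act_inv_act hw]
  · intro h
    exact ⟨_, h, act_act_inv hw l⟩

/-- The difference of the vectors of `s l` and `l` is a multiple c of `eps a - eps b`. Since `a`
precedes `b` both before and after applying `w⁻¹`, the sign of c decides both comparisons in the
same way. -/
theorem act_swapRefl_lt {w : Equiv.Perm (Amb X n)} (hw : w ∈ weyl X n) {a b : Letter X n}
    (hab : a < b) (h : act w⁻¹ a < act w⁻¹ b) {l : Letter X n}
    (hl : act w⁻¹ (act (swapRefl a b) l) < act w⁻¹ l) : act (swapRefl a b) l < l := by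
  have hw' := inv_mem hw
  obtain ⟨c, hc⟩ : ∃ c : ℝ, eps (act (swapRefl a b) l) - eps l = c • (eps a - eps b) := by
    rw [eps_act (swapRefl_mem_weyl hab.ne), swapRefl, affRefl_zero_apply]
    exact ⟨-_, by rw [sub_sub_cancel_left, neg_smul]⟩
  rw [lt_iff_rho] at hab h hl ⊢
  rw [eps_act hw', eps_act hw', ← weyl_sub hw'] at h hl
  rw [hc, smul_dotProduct, smul_eq_mul]
  rw [hc, weyl_smul hw', smul_dotProduct, smul_eq_mul] at hl
  exact mul_pos (pos_of_mul_pos_left hl h.le) hab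

/-- For one Bruhat step, a letter at most `l` of the new column is kept if it already belongs to the
old column, and is replaced by its mirror image otherwise. The image is smaller by
`act_swapRefl_lt`, and the assignment is injective. -/
theorem countLE_initCol_anti {u v : Equiv.Perm (Amb X n)} (hu : u ∈ weyl X n) (huv : BruhatLE u v)
    (p : ℕ) (l : Letter X n) : countLE (initCol v p) l ≤ countLE (initCol u p) l := by
  refine (bruhat_induction (p := fun v => countLE (initCol v p) l ≤ countLE (initCol u p) l)
    hu huv le_rfl ?_).1
  intro w hw a b hab h ih
  refine le_trans ?_ ih
  have hs := swapRefl_mem_weyl hab.ne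
  have hm : ∀ m, m ∈ initCol (swapRefl a b * w) p ↔ act (swapRefl a b) m ∈ initCol w p := by
    intro m
    rw [mem_initCol (mul_mem hs hw), mem_initCol hw, mul_inv_rev,
      act_mul (inv_mem hw) (inv_mem hs), swapRefl_inv]
  have hss : ∀ m, act (swapRefl a b) (act (swapRefl a b) m) = m := fun m => by
    rw [← act_mul hs hs, swapRefl_mul_self, act_one]
  refine Finset.card_le_card_of_injOn
    (fun m => if m ∈ initCol w p then m else act (swapRefl a b) m) ?_ ?_
  · intro m hml
    simp only [Finset.coe_filter, Set.mem_ofPred_eq] at hml ⊢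
    split_ifs with h1
    · exact ⟨h1, hml.2⟩
    · have h2 := (hm m).1 hml.1
      refine ⟨h2, le_trans (act_swapRefl_lt hw hab h ?_).le hml.2⟩
      rw [mem_initCol hw] at h1 h2
      rw [Fin.lt_def]; omega
  · intro m hml m' hml' e
    simp only [Finset.coe_filter, Set.mem_ofPred_eq] at hml hml' e
    have h2 := (hm m).1 hml.1
    have h2' := (hm m').1 hml'.1
    split_ifs at e with h3 h4 h4
    · exact e
    · rw [e, hss] at h2
      exact absurd h2 h4
    · rw [← e, hss] at h2'
      exact absurd h2' h3
    · exact act_injective hs e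

theorem countLE_initCol_mono (w : Equiv.Perm (Amb X n)) {p q : ℕ} (hpq : p ≤ q) (l : Letter X n) :
    countLE (initCol w p) l ≤ countLE (initCol w q) l :=
  Finset.card_le_card (Finset.filter_subset_filter _ (Finset.image_subset_image
    (Finset.monotone_filter_right _ fun _ _ h => lt_of_lt_of_le h hpq)))

/-- The first `p` letters. -/
def firstLetters (X : ClassicalType) {n p : ℕ} (hp : p ≤ n) (i : Fin p) : Letter X n :=
  Fin.castLE (hp.trans (le_alphabetSize X n)) i

theorem not_opp_firstLetters {p : ℕ} (hp : p ≤ n) (i j : Fin p) :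
    ¬Opp (firstLetters X hp i) (firstLetters X hp j) := by
  rw [opp_iff]
  have h1 : (firstLetters X hp i : ℕ) = i := rfl
  have h2 : (firstLetters X hp j : ℕ) = j := rfl
  omega

/-- Let i be the last position where the two columns differ. The entry `f i` is raised to the least
larger letter b that is not the bar of an entry already in final position, so finished entries are
not disturbed. Usually only `f i` moves. If b is the bar of an unfinished entry `f m`, then `f m`
moves as well, and minimality of b forces both to rise by exactly one, which keeps them below the
target and in order. -/
theorem exists_swapRefl_step {p : ℕ} (hp : p ≤ n) {c : Fin p → Letter X n} (hc : StrictMono c)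
    (hopp : ∀ i j, ¬Opp (c i) (c j)) {w : Equiv.Perm (Amb X n)} (hw : w ∈ weyl X n)
    (hmono : StrictMono fun i => act w (firstLetters X hp i))
    (hle : ∀ i, act w (firstLetters X hp i) ≤ c i)
    (hne : ∃ i, act w (firstLetters X hp i) ≠ c i) :
    ∃ a b : Letter X n, a < b ∧ act w⁻¹ a < act w⁻¹ b ∧
      (StrictMono fun i => act (swapRefl a b * w) (firstLetters X hp i)) ∧
      (∀ i, act (swapRefl a b * w) (firstLetters X hp i) ≤ c i) ∧
      (∀ i, act w (firstLetters X hp i) ≤ act (swapRefl a b * w) (firstLetters X hp i)) ∧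
      ∃ i, act w (firstLetters X hp i) < act (swapRefl a b * w) (firstLetters X hp i) := by
  set f := fun i => act w (firstLetters X hp i) with hf
  have hfopp : ∀ i j, ¬Opp (f i) (f j) := fun i j h =>
    not_opp_firstLetters hp i j ((opp_act_iff hw).1 h)
  obtain ⟨i, hi, hmax⟩ : ∃ i, f i ≠ c i ∧ ∀ j, i < j → f j = c j := by
    have hs : (Finset.univ.filter fun i => f i ≠ c i).Nonempty := by
      obtain ⟨i, hi⟩ := hne
      exact ⟨i, by simpa using hi⟩
    refine ⟨_, (Finset.mem_filter.1 (Finset.max'_mem _ hs)).2, fun j hj => ?_⟩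
    by_contra h
    exact absurd (Finset.le_max' _ j (by simpa using h)) hj.not_ge
  have hi' : f i < c i := lt_of_le_of_ne (hle i) hi
  -- The target letter `c i` is itself a candidate, because `c` contains no opposite letters.
  have hP : ∃ b, f i < b ∧ ¬∃ m, Opp b (f m) ∧ f m = c m :=
    ⟨c i, hi', fun ⟨m, h, e⟩ => hopp i m (e ▸ h)⟩
  obtain ⟨b, ⟨hab, hb⟩, hmin⟩ : ∃ b, (f i < b ∧ ¬∃ m, Opp b (f m) ∧ f m = c m) ∧
      ∀ b', (f i < b' ∧ ¬∃ m, Opp b' (f m) ∧ f m = c m) → b ≤ b' := by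
    have hs : (Finset.univ.filter fun b => f i < b ∧ ¬∃ m, Opp b (f m) ∧ f m = c m).Nonempty := by
      obtain ⟨b, h⟩ := hP
      exact ⟨b, by simpa using h⟩
    refine ⟨_, (Finset.mem_filter.1 (Finset.min'_mem _ hs)).2, fun b' h => ?_⟩
    exact Finset.min'_le _ _ (by simpa using h)
  have hbc : b ≤ c i := hmin _ ⟨hi', fun ⟨m, h, e⟩ => hopp i m (e ▸ h)⟩
  have hgt : ∀ j, i < j → b < f j := fun j hj => by
    rw [hmax j hj]
    exact hbc.trans_lt (hc hj)
  have hbf : ∀ j, f j ≠ b := by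
    intro j e
    have h1 : i < j := hmono.lt_iff_lt.1 (show f i < f j by rwa [e])
    exact (hgt j h1).ne' e
  have hs := swapRefl_mem_weyl hab.ne
  have hact : ∀ j, act (swapRefl (f i) b * w) (firstLetters X hp j) = swapLetter (f i) b (f j) :=
    fun j => by rw [act_mul hs hw, act_swapRefl hab.ne]
  have hactne : ∀ j, j ≠ i → act (swapRefl (f i) b * w) (firstLetters X hp j) =
      if Opp b (f j) then (f i).rev else f j := fun j hj => by
    rw [hact, swapLetter, if_neg (fun h => hj (hmono.injective h)), if_neg (hbf j),
      if_neg (hfopp i j)]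
  have hacti : act (swapRefl (f i) b * w) (firstLetters X hp i) = b := by
    rw [hact, swapLetter_left]
  -- The preimage of `f i` is the letter number i. The preimage of `b` comes later, for otherwise
  -- `b` would be one of the entries `f j`.
  have hpos : act w⁻¹ (f i) < act w⁻¹ b := by
    rw [hf, act_inv_act hw]
    by_contra h
    have h1 : (act w⁻¹ b : ℕ) ≤ i := not_lt.1 h
    refine hbf ⟨act w⁻¹ b, by omega⟩ ?_
    exact act_act_inv hw b
  refine ⟨f i, b, hab, hpos, ?_⟩
  by_cases hm : ∃ m, m ≠ i ∧ Opp b (f m)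
  · obtain ⟨m, hmi, hm⟩ := hm
    have hX := hm.1
    have hmc : f m ≠ c m := fun e => hb ⟨m, hm, e⟩
    have hmc' : f m < c m := lt_of_le_of_ne (hle m) hmc
    have hmi' : m < i := by
      rcases lt_trichotomy m i with h | h | h
      · exact h
      · exact absurd h hmi
      · exact absurd (hmax m h) hmc
    have hm' := opp_iff.1 hm
    have hab' : (f i : ℕ) < b := hab
    -- Otherwise `b - 1` was rejected on account of a finished entry `f m'`, which equals `f m + 1`.
    -- Then `c m < c m' = f m + 1` contradicts `f m < c m`.
    have hba : (b : ℕ) = f i + 1 := by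
      by_contra hne'
      let b' : Letter X n := ⟨b - 1, by omega⟩
      have hb' : (b' : ℕ) = b - 1 := rfl
      have h1 : f i < b' := by rw [Fin.lt_def]; omega
      have h2 : b' < b := by rw [Fin.lt_def]; omega
      have h3 : ∃ m, Opp b' (f m) ∧ f m = c m := by
        by_contra h
        exact (hmin b' ⟨h1, h⟩).not_gt h2
      obtain ⟨m', h4, h5⟩ := h3
      have h6 := opp_iff.1 h4
      have h7 : m < m' := hmono.lt_iff_lt.1 (show f m < f m' by rw [Fin.lt_def]; omega)
      have h8 : (c m : ℕ) < c m' := hc h7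
      rw [← h5] at h8
      have h9 : (f m : ℕ) < c m := hmc'
      omega
    have hrev := val_rev_of_ne hX (f i)
    have hfi := val_lt_of_ne hX (f i)
    have hactm : (act (swapRefl (f i) b * w) (firstLetters X hp m) : ℕ) = f m + 1 := by
      rw [hactne m hmi, if_pos hm]; omega
    have hacto : ∀ j, j ≠ i → j ≠ m → act (swapRefl (f i) b * w) (firstLetters X hp j) = f j := by
      intro j h1 h2
      rw [hactne j h1, if_neg]
      intro h
      exact h2 (hmono.injective (h.right_unique hm))
    -- The letter `f m + 1` is the bar of `f i`, hence not an entry.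
    have hfm : ∀ j, (f j : ℕ) ≠ f m + 1 := by
      intro j h
      refine hfopp i j ?_
      rw [opp_iff]
      exact ⟨hX, by omega⟩
    have hmi'' : (f m : ℕ) < f i := hmono hmi'
    refine ⟨?_, ?_, ?_, ⟨i, ?_⟩⟩
    · intro j k hjk
      show act (swapRefl (f i) b * w) (firstLetters X hp j) <
        act (swapRefl (f i) b * w) (firstLetters X hp k)
      have hjk' : (f j : ℕ) < f k := hmono hjk
      rw [Fin.lt_def]
      by_cases h1 : j = i
      · subst h1
        have h2 : (b : ℕ) < f k := hgt k hjk
        have h3 : k ≠ m := by rintro rfl; exact absurd hjk hmi'.not_gt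
        rw [hacti, hacto k hjk.ne' h3]
        exact h2
      · by_cases h2 : k = i
        · subst h2
          rw [hacti]
          by_cases h3 : j = m
          · subst h3; rw [hactm]; omega
          · rw [hacto j h1 h3]; omega
        · by_cases h3 : j = m
          · subst h3
            rw [hactm, hacto k h2 hjk.ne']
            have := hfm k
            omega
          · rw [hacto j h1 h3]
            by_cases h4 : k = m
            · subst h4; rw [hactm]; omega
            · rw [hacto k h2 h4]; exact hjk'
    · intro j
      by_cases h1 : j = i
      · subst h1; rw [hacti]; exact hbc
      by_cases h2 : j = m
      · subst h2
        rw [Fin.le_def, hactm]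
        exact hmc'
      · rw [hacto j h1 h2]; exact hle j
    · intro j
      by_cases h1 : j = i
      · subst h1; rw [hacti]; exact hab.le
      by_cases h2 : j = m
      · subst h2
        rw [Fin.le_def, hactm]
        show (f j : ℕ) ≤ _
        omega
      · rw [hacto j h1 h2]
    · rw [hacti]; exact hab
  · have hacto : ∀ j, j ≠ i → act (swapRefl (f i) b * w) (firstLetters X hp j) = f j := by
      intro j h1
      rw [hactne j h1, if_neg fun h => hm ⟨j, h1, h⟩]
    refine ⟨?_, ?_, ?_, ⟨i, ?_⟩⟩
    · intro j k hjk
      show act (swapRefl (f i) b * w) (firstLetters X hp j) <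
        act (swapRefl (f i) b * w) (firstLetters X hp k)
      by_cases h1 : j = i
      · subst h1
        rw [hacti, hacto k hjk.ne']
        exact hgt k hjk
      · rw [hacto j h1]
        by_cases h2 : k = i
        · subst h2
          rw [hacti]
          exact (hmono hjk).trans hab
        · rw [hacto k h2]
          exact hmono hjk
    · intro j
      by_cases h1 : j = i
      · subst h1; rw [hacti]; exact hbc
      · rw [hacto j h1]; exact hle j
    · intro j
      by_cases h1 : j = i
      · subst h1; rw [hacti]; exact hab.le
      · rw [hacto j h1]
    · rw [hacti]; exact hab

/-- Iterate `exists_swapRefl_step`: each reflection goes up in the Bruhat order and increases the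
sum of the entries, which is bounded by that of `c`. -/
theorem exists_bruhatLE_of_le {p : ℕ} (hp : p ≤ n) {c : Fin p → Letter X n} (hc : StrictMono c)
    (hopp : ∀ i j, ¬Opp (c i) (c j)) {w : Equiv.Perm (Amb X n)} (hw : w ∈ weyl X n)
    (hmono : StrictMono fun i => act w (firstLetters X hp i))
    (hle : ∀ i, act w (firstLetters X hp i) ≤ c i) :
    ∃ v ∈ weyl X n, BruhatLE w v ∧ ∀ i, act v (firstLetters X hp i) = c i := by
  obtain ⟨N, hN⟩ : ∃ N, ∑ i, (c i : ℕ) = ∑ i, (act w (firstLetters X hp i) : ℕ) + N :=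
    Nat.exists_eq_add_of_le (Finset.sum_le_sum fun i _ => hle i)
  induction N using Nat.strong_induction_on generalizing w with
  | _ N ih =>
    by_cases hne : ∃ i, act w (firstLetters X hp i) ≠ c i
    · obtain ⟨a, b, hab, h, h1, h2, h3, i, h4⟩ := exists_swapRefl_step hp hc hopp hw hmono hle hne
      have hm := mul_mem (swapRefl_mem_weyl hab.ne) hw
      have hlt : ∑ i, (act w (firstLetters X hp i) : ℕ) <
          ∑ i, (act (swapRefl a b * w) (firstLetters X hp i) : ℕ) :=
        Finset.sum_lt_sum (fun i _ => h3 i) ⟨i, Finset.mem_univ _, h4⟩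
      obtain ⟨M, hM⟩ : ∃ M, ∑ i, (c i : ℕ) =
          ∑ i, (act (swapRefl a b * w) (firstLetters X hp i) : ℕ) + M :=
        Nat.exists_eq_add_of_le (Finset.sum_le_sum fun i _ => h2 i)
      obtain ⟨v, hv, h5, h6⟩ := ih M (by omega) hm h1 h2 hM
      exact ⟨v, hv, (bruhatLE_swapRefl_mul hw hab h).trans h5, h6⟩
    · push Not at hne
      exact ⟨w, hw, Relation.ReflTransGen.refl, hne⟩

theorem le_of_strictMono_fin {p : ℕ} (hp : p ≤ n) {c : Fin p → Letter X n} (hc : StrictMono c)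
    (i : Fin p) : firstLetters X hp i ≤ c i := by
  obtain ⟨i, hi⟩ := i
  induction i with
  | zero => rw [Fin.le_def]; exact Nat.zero_le _
  | succ k ih =>
    have h1 := ih (by omega)
    have h2 : c ⟨k, by omega⟩ < c ⟨k + 1, hi⟩ := hc (by simp)
    rw [Fin.le_def] at h1 ⊢
    have h3 : k ≤ (c ⟨k, by omega⟩ : ℕ) := h1
    rw [Fin.lt_def] at h2
    show k + 1 ≤ _
    omega

/-- The Weyl group acts transitively on the columns of a given length. -/
theorem exists_weyl_eq_column {p : ℕ} (hp : p ≤ n) {c : Fin p → Letter X n} (hc : StrictMono c)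
    (hopp : ∀ i j, ¬Opp (c i) (c j)) :
    ∃ v ∈ weyl X n, ∀ i, act v (firstLetters X hp i) = c i := by
  obtain ⟨v, hv, -, h⟩ := exists_bruhatLE_of_le hp hc hopp (one_mem _)
    (fun i j hij => by simp only [act_one]; exact hij)
    (fun i => by rw [act_one]; exact le_of_strictMono_fin hp hc i)
  exact ⟨v, hv, h⟩

/-! ### The apartment and the fundamental coweights -/

theorem sub_mem_apartment (a b : Letter X n) : eps a - eps b ∈ apartment X n := by
  by_cases hab : a = b
  · rw [hab, sub_self]; exact zero_mem _
  · have h := Submodule.smul_mem _ (rootScale a b)⁻¹ (Submodule.subset_span (letters_mem_roots hab))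
    rwa [smul_smul, inv_mul_cancel₀ (rootScale_pos a b).ne', one_smul] at h

theorem eq_sum_smul_e (x : Amb X n) : x = ∑ j : Fin (dim X n), x j • e X n j := by
  ext i
  rw [Finset.sum_apply, Finset.sum_eq_single i]
  · simp [e]
  · intro j _ hj
    have : (i : ℕ) ≠ j := fun h => hj (Fin.ext h.symm)
    simp [e, this]
  · simp

theorem exists_eps_eq_e (j : Fin (dim X n)) : ∃ l : Letter X n, (l : ℕ) = j ∧ eps l = e X n j := by
  have hj := j.2
  by_cases hX : X = A
  · subst hX
    exact ⟨j, rfl, rfl⟩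
  · have hN := alphabetSize_of_ne (n := n) hX
    have hd := dim_of_ne (n := n) hX
    exact ⟨⟨j, by omega⟩, rfl, eps_of_lt (.inr (by simp only; omega))⟩

theorem mem_apartment_iff {x : Amb X n} : x ∈ apartment X n ↔ (X = A → ∑ j, x j = 0) := by
  constructor
  · rintro hx rfl
    refine Submodule.span_induction (p := fun x _ => ∑ j, x j = 0) ?_ (by simp) ?_ ?_ hx
    · intro β hβ
      obtain ⟨a, b, -, rfl⟩ := exists_letters_of_mem_roots hβ
      rw [rootScale_of_not_opp (fun h => h.1 rfl), one_smul]
      simp only [Pi.sub_apply, Finset.sum_sub_distrib, eps]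
      have h1 := e_dotProduct (X := A) (n := n) a.2 1
      have h2 := e_dotProduct (X := A) (n := n) b.2 1
      rw [dotProduct_one] at h1 h2
      rw [h1, h2]
      simp
    · intro x y _ _ hx hy
      simp [Finset.sum_add_distrib, hx, hy]
    · intro r x _ hx
      simp [← Finset.mul_sum, hx]
  · intro h
    by_cases hX : X = A
    · have h0 := h hX
      -- As the coordinates sum to 0, a multiple of the first coordinate vector may be subtracted in
      -- every term, leaving differences of letter vectors.
      have h1 : x = ∑ j : Fin (dim X n), x j •
          (e X n j - e X n ((⟨0, by subst hX; simp [dim]⟩ : Fin (dim X n)) : ℕ)) := by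
        simp only [smul_sub, Finset.sum_sub_distrib, ← eq_sum_smul_e, ← Finset.sum_smul, h0,
          zero_smul, sub_zero]
      rw [h1]
      refine Submodule.sum_mem _ fun j _ => Submodule.smul_mem _ _ ?_
      obtain ⟨a, -, ha⟩ := exists_eps_eq_e j
      obtain ⟨b, -, hb⟩ := exists_eps_eq_e (⟨0, by subst hX; simp [dim]⟩ : Fin (dim X n))
      rw [← ha, ← hb]
      exact sub_mem_apartment a b
    · rw [eq_sum_smul_e x]
      refine Submodule.sum_mem _ fun j _ => Submodule.smul_mem _ _ ?_
      obtain ⟨a, -, ha⟩ := exists_eps_eq_e j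
      -- Outside type A, `eps a` is half the difference of `a` and its bar.
      have h1 := sub_mem_apartment a a.rev
      rw [eps_eq_neg_of_opp ⟨hX, rfl⟩, sub_neg_eq_add, ← two_smul ℝ] at h1
      have h2 := Submodule.smul_mem _ (1 / 2 : ℝ) h1
      rw [smul_smul] at h2
      norm_num at h2
      rwa [← ha]

/-- The sum of a fundamental coweight's coordinates at the letters: the letters `≤ i` count
positively, their opposites negatively. -/
def letterSign (i : Fin n) (l : Letter X n) : ℤ :=
  (if (l : ℕ) ≤ i then 1 else 0) - (if X ≠ A ∧ 2 * n ≤ l + i + 1 then 1 else 0)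

/-- The common nonzero absolute value of the coordinates of a fundamental coweight (before
projection in type `A`). -/
def coweightScale (X : ClassicalType) {n : ℕ} (i : Fin n) : ℝ :=
  if X = B ∧ (i : ℕ) + 1 = n then 1 / 2 else 1

theorem eps_dotProduct_fundCoweight (i : Fin n) (l : Letter X n) :
    eps l ⬝ᵥ fundCoweight X n i = coweightScale X i * letterSign i l -
      (if X = A then ((i : ℝ) + 1) / (n + 1) else 0) := by
  have hi := i.2
  rcases eq_A_or_lt_or_ge l with h | h
  · rw [eps_of_lt h, e_dotProduct (val_lt_dim h), letterSign, coweightScale]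
    have h2 : ¬(X ≠ A ∧ 2 * n ≤ (l : ℕ) + i + 1) := by
      rintro ⟨h1, h2⟩
      have := h.resolve_left h1
      omega
    rw [if_neg h2]
    cases X
    · simp [fundCoweight]
    · simp only [fundCoweight, reduceCtorEq, false_or, if_false, true_and] at h ⊢
      by_cases h3 : (i : ℕ) + 1 = n
      · simp only [h3, if_true, show (l : ℕ) ≤ i by omega]; norm_num
      · simp only [h3, if_false]; split_ifs <;> simp
    · simp [fundCoweight]
  · have hl := val_lt_of_ne h.1 l
    rw [eps_of_ge h.1 h.2, neg_dotProduct, e_dotProduct (by rw [dim_of_ne h.1]; omega), letterSign,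
      coweightScale, if_neg (by omega : ¬(l : ℕ) ≤ i), if_neg h.1]
    have h2 : (2 * n - 1 - (l : ℕ) ≤ i) ↔ (X ≠ A ∧ 2 * n ≤ (l : ℕ) + i + 1) :=
      ⟨fun h' => ⟨h.1, by omega⟩, fun h' => by omega⟩
    simp only [← h2]
    cases X
    · exact absurd rfl h.1
    · simp only [fundCoweight, true_and]
      by_cases h3 : (i : ℕ) + 1 = n
      · simp only [h3, if_true, show 2 * n - 1 - (l : ℕ) ≤ i by omega]; norm_num
      · simp only [h3, if_false]; split_ifs <;> simp
    · simp only [fundCoweight]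
      split_ifs <;> simp_all

theorem root_dotProduct_fundCoweight (i : Fin n) (a b : Letter X n) :
    (rootScale a b • (eps a - eps b)) ⬝ᵥ fundCoweight X n i =
      rootScale a b * coweightScale X i * (letterSign i a - letterSign i b : ℤ) := by
  rw [smul_dotProduct, sub_dotProduct, eps_dotProduct_fundCoweight, eps_dotProduct_fundCoweight]
  push_cast
  rw [smul_eq_mul]
  ring

theorem simpleRoot_dotProduct_fundCoweight (i j : Fin n) :
    simpleRoot X n i ⬝ᵥ fundCoweight X n j = if i = j then 1 else 0 := by
  have hi := i.2
  have hj := j.2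
  have e1 : ((letter X i : Letter X n) : ℕ) = i := rfl
  have e2 : ((nextLetter X i : Letter X n) : ℕ) = i + 1 := rfl
  rw [simpleRoot_eq, root_dotProduct_fundCoweight, rootScale, coweightScale]
  have h1 : letterSign j (letter X i) = if (i : ℕ) ≤ j then 1 else 0 := by
    rw [letterSign, e1, if_neg (c := _ ∧ _) (by omega), sub_zero]
  have h2 : letterSign j (nextLetter X i) = if (i : ℕ) < j then 1 else
      if X ≠ A ∧ (i : ℕ) = j ∧ (i : ℕ) + 1 = n then -1 else 0 := by
    rw [letterSign, e2]
    by_cases hX : X = A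
    · simp only [hX, ne_eq, not_true_eq_false, false_and, if_false]
      split_ifs <;> omega
    · simp only [hX, ne_eq, not_false_eq_true, true_and]
      split_ifs <;> omega
  have h3 : Opp (letter X i) (nextLetter X i) ↔ X ≠ A ∧ (i : ℕ) + 1 = n := by
    rw [opp_iff, e1, e2]
    refine and_congr_right fun _ => ?_
    omega
  rw [h1, h2]
  simp only [h3, Fin.ext_iff]
  rcases lt_trichotomy (i : ℕ) j with h | h | h
  · simp [h.le, h, h.ne]
  · simp only [h, le_refl, if_true, lt_irrefl, if_false, true_and]
    by_cases h4 : (j : ℕ) + 1 = n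
    · cases X <;> simp [h4]
    · simp [h4]
  · simp [h.not_ge, h.ne', h.not_gt]

theorem mult_eq (i : Fin n) : mult X i =
    if X = A ∨ (X = B ∧ (i : ℕ) + 1 = n) ∨ (X = C ∧ (i : ℕ) = 0) then 1 else 2 := by
  cases X <;> simp [mult, Minuscule] <;> congr

theorem mult_pos (i : Fin n) : 0 < mult X i := by
  unfold mult; split_ifs <;> norm_num

/-- The difference of two letter signs is 0, 1 or 2 for `a < b`. A factor 1/2 comes from the
coweight in type B and from the root in type C, and in either case the difference is even. -/
theorem posRoot_dotProduct_fundCoweight {β : Amb X n} (hβ : β ∈ posRoots X n) (i : Fin n) :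
    ∃ k : ℕ, k ≤ mult X i ∧ β ⬝ᵥ fundCoweight X n i = k := by
  obtain ⟨a, b, hab, rfl⟩ := exists_letters_of_mem_posRoots hβ
  have hi := i.2
  have hab' : (a : ℕ) < b := hab
  have ha : X ≠ A → (a : ℕ) < 2 * n := fun h => val_lt_of_ne h a
  have hb : X ≠ A → (b : ℕ) < 2 * n := fun h => val_lt_of_ne h b
  rw [root_dotProduct_fundCoweight, mult_eq]
  by_cases hX : X = A
  · have h1 : ∀ l : Letter X n, letterSign i l = if (l : ℕ) ≤ i then 1 else 0 := fun l => by
      rw [letterSign, if_neg (c := _ ∧ _) (by simp [hX]), sub_zero]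
    rw [rootScale_of_not_opp (fun h => h.1 hX), coweightScale, h1, h1]
    simp only [hX, reduceCtorEq, false_and, if_false, one_mul, true_or, if_true]
    by_cases h2 : (a : ℕ) ≤ i <;> by_cases h3 : (b : ℕ) ≤ i
    · exact ⟨0, by norm_num, by simp [h2, h3]⟩
    · exact ⟨1, by norm_num, by simp [h2, h3]⟩
    · omega
    · exact ⟨0, by norm_num, by simp [h2, h3]⟩
  have ha := ha hX
  have hb := hb hX
  have hl : ∀ l : Letter X n, letterSign i l =
      if (l : ℕ) ≤ i then 1 else if 2 * n ≤ l + i + 1 then -1 else 0 := fun l => by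
    rw [letterSign]
    simp only [ne_eq, hX, not_false_eq_true, true_and]
    split_ifs <;> omega
  obtain ⟨k, hk2, hk, hk'⟩ : ∃ k : ℕ, k ≤ 2 ∧ letterSign i a - letterSign i b = k ∧
      (k = 2 → (a : ℕ) ≤ i ∧ 2 * n ≤ b + i + 1) := by
    rw [hl, hl]
    split_ifs
    exacts [⟨0, by norm_num, rfl, by norm_num⟩, ⟨2, by norm_num, rfl, by omega⟩,
      ⟨1, by norm_num, rfl, by norm_num⟩, by omega, ⟨0, by norm_num, rfl, by norm_num⟩, by omega,
      by omega, ⟨1, by norm_num, rfl, by norm_num⟩, ⟨0, by norm_num, rfl, by norm_num⟩]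
  -- For the last coweight every letter sign is 1 or -1. Opposite letters have opposite signs. Both
  -- make the difference even.
  have hodd : (i : ℕ) + 1 = n ∨ Opp a b → k ≠ 1 := by
    rintro h rfl
    rw [opp_iff] at h
    rw [hl, hl] at hk
    rcases h with h | h <;> split_ifs at hk <;> omega
  rw [hk, Int.cast_natCast, rootScale, coweightScale]
  have half : k ≠ 1 → ∃ j : ℕ, j ≤ 1 ∧ (1 / 2 : ℝ) * k = j := by
    intro h
    rcases (show k = 0 ∨ k = 2 by omega) with rfl | rfl
    · exact ⟨0, by norm_num, by norm_num⟩
    · exact ⟨1, by norm_num, by norm_num⟩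
  cases X
  · exact absurd rfl hX
  · simp only [reduceCtorEq, and_false, false_and, if_false, one_mul, true_and, false_or, or_false]
    by_cases h : (i : ℕ) + 1 = n
    · simp only [h, if_true]
      exact half (hodd (.inl h))
    · simp only [h, if_false, one_mul]
      exact ⟨k, hk2, rfl⟩
  · simp only [reduceCtorEq, and_true, false_and, if_false, mul_one, true_and, false_or]
    by_cases h : Opp a b
    · simp only [h, if_true]
      obtain ⟨j, hj, e⟩ := half (hodd (.inr h))
      exact ⟨j, by split_ifs <;> omega, e⟩
    · simp only [h, if_false, one_mul]
      refine ⟨k, ?_, rfl⟩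
      split_ifs with h0
      · by_contra hk1
        have := hk' (by omega)
        rw [opp_iff] at h
        exact h ⟨hX, by omega⟩
      · exact hk2

/-- The root is ε_1 - ε_{n+1} in type A, 2ε_1 in type B, and ε_1 + ε_2 in type C, or ε_1 when `n =
1`. It attains the bound of `posRoot_dotProduct_fundCoweight` at all coweights simultaneously. -/
theorem exists_highestRoot (hn : 1 ≤ n) : ∃ θ ∈ posRoots X n,
    ∀ i, θ ⬝ᵥ fundCoweight X n i = mult X i := by
  have hlet : ∀ a b : Letter X n, a < b → (∀ i, rootScale a b * coweightScale X i *
      (letterSign i a - letterSign i b : ℤ) = mult X i) →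
      ∃ θ ∈ posRoots X n, ∀ i, θ ⬝ᵥ fundCoweight X n i = mult X i := fun a b hab h =>
    ⟨_, letters_mem_posRoots hab, fun i => by rw [root_dotProduct_fundCoweight, h]⟩
  cases X
  · refine hlet ⟨0, by simp [alphabetSize]⟩ ⟨n, by simp [alphabetSize]⟩ hn fun i => ?_
    rw [rootScale_of_not_opp (fun h => h.1 rfl), coweightScale]
    have := i.2
    simp [letterSign, mult, Minuscule]
  · refine hlet ⟨0, by simp [alphabetSize]; omega⟩ ⟨2 * n - 1, by simp [alphabetSize]; omega⟩
      (by simp [Fin.lt_def]; omega) fun i => ?_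
    have := i.2
    have h1 : ¬(2 * n - 1 ≤ (i : ℕ)) := by omega
    have h2 : 2 * n ≤ 2 * n - 1 + (i : ℕ) + 1 := by omega
    have h3 : ¬ (2 * n ≤ (i : ℕ) + 1) := by omega
    by_cases h : (i : ℕ) + 1 = n <;>
      simp [letterSign, mult, Minuscule, rootScale, coweightScale, h, h1, h2] <;> 
      rw [if_neg (by omega)] <;> norm_num
  · by_cases hn1 : n = 1
    · subst hn1
      refine hlet ⟨0, by simp [alphabetSize]⟩ ⟨1, by simp [alphabetSize]⟩
        (by simp [Fin.lt_def]) fun i => ?_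
      have ho : Opp (⟨0, by simp [alphabetSize]⟩ : Letter C 1) ⟨1, by simp [alphabetSize]⟩ := by
        rw [opp_iff]; simp
      rw [rootScale, if_pos ⟨ho, rfl⟩]
      obtain ⟨i, hi⟩ := i
      obtain rfl : i = 0 := by omega
      simp [letterSign, mult, Minuscule, coweightScale]
    · refine hlet ⟨0, by simp [alphabetSize]; omega⟩ ⟨2 * n - 2, by simp [alphabetSize]; omega⟩
        (by simp [Fin.lt_def]; omega) fun i => ?_
      rw [rootScale_of_not_opp (by rw [opp_iff]; simp; omega)]
      have := i.2
      have h1 : ¬(2 * n - 2 ≤ (i : ℕ)) := by omega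
      have h3 : ¬ (2 * n ≤ (i : ℕ) + 1) := by omega
      by_cases h : (i : ℕ) = 0
      · have h2 : ¬(2 * n ≤ 2 * n - 2 + (i : ℕ) + 1) := by omega
        simp only [letterSign, mult, Minuscule, coweightScale, h1, h2]
        simp [h]
        omega
      · have h2 : (2 * n ≤ 2 * n - 2 + (i : ℕ) + 1) := by omega
        simp only [letterSign, mult, Minuscule, coweightScale, h1, h2]
        simp [h]
        rw [if_neg (by omega)]
        norm_num

theorem simpleRoot_mem_posRoots (i : Fin n) : simpleRoot X n i ∈ posRoots X n := by
  rw [simpleRoot_eq]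
  exact letters_mem_posRoots (letter_lt_nextLetter i)

theorem fundCoweight_mem_apartment (i : Fin n) : fundCoweight X n i ∈ apartment X n := by
  rw [mem_apartment_iff]
  rintro rfl
  have hi := i.2
  have h0 : ∀ j : Fin (dim A n), fundCoweight A n i j =
      (if (j : ℕ) ≤ i then 1 else 0) - ((i : ℝ) + 1) / ((n : ℝ) + 1) := fun j => rfl
  have h1 : ∑ j : Fin (dim A n), (if (j : ℕ) ≤ i then (1 : ℝ) else 0) = i + 1 := by
    rw [Finset.sum_boole]
    have : (Finset.univ.filter fun j : Fin (dim A n) => (j : ℕ) ≤ i) =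
        Finset.Iic ⟨(i : ℕ), lt_of_lt_of_le hi (le_dim A n)⟩ := by
      ext j; simp [Fin.le_def]
    rw [this, Fin.card_Iic]
    push_cast
    rfl
  simp only [h0]
  rw [Finset.sum_sub_distrib, h1, Finset.sum_const, Finset.card_univ, Fintype.card_fin,
    nsmul_eq_mul, show dim A n = n + 1 from rfl]
  push_cast
  field_simp
  ring

/-- Neighbouring letters take equal values at `x`, so all coordinates coincide. The common value is
0 because the coordinate sum vanishes in type A, and because n and its bar take opposite values in
the other types. -/
theorem eq_zero_of_simpleRoot_dotProduct {x : Amb X n} (hx : x ∈ apartment X n)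
    (h : ∀ i, simpleRoot X n i ⬝ᵥ x = 0) : x = 0 := by
  have h1 : ∀ i : Fin n, eps (nextLetter X i) ⬝ᵥ x = eps (letter X i) ⬝ᵥ x := by
    intro i
    have := h i
    rw [simpleRoot_eq, smul_dotProduct, sub_dotProduct, smul_eq_mul] at this
    have := (mul_eq_zero.1 this).resolve_left (rootScale_pos _ _).ne'
    linarith
  obtain ⟨r, hr⟩ : ∃ r, ∀ l : Letter X n, (l : ℕ) ≤ n → eps l ⬝ᵥ x = r := by
    by_cases h0 : 0 < alphabetSize X n
    · refine ⟨eps (⟨0, h0⟩ : Letter X n) ⬝ᵥ x, ?_⟩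
      rintro ⟨k, hk⟩ hkn
      induction k with
      | zero => rfl
      | succ k ih =>
        rw [← ih (by omega) (Nat.le_of_succ_le hkn)]
        exact h1 ⟨k, hkn⟩
    · exact ⟨0, fun l => by have := l.2; omega⟩
  have h2 : ∀ j, x j = r := by
    intro j
    obtain ⟨l, hl, he⟩ := exists_eps_eq_e j
    have hj := j.2
    have : dim X n ≤ n + 1 := by cases X <;> simp [dim]
    rw [← hr l (by omega), he, e_dotProduct j.2]
  have h3 : dim X n ≠ 0 → r = 0 := by
    intro h0
    by_cases hX : X = A
    · have := mem_apartment_iff.1 hx hX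
      simp only [h2, Finset.sum_const, Finset.card_univ, Fintype.card_fin, nsmul_eq_mul] at this
      exact (mul_eq_zero.1 this).resolve_left (by exact_mod_cast h0)
    · rw [dim_of_ne hX] at h0
      have hN := alphabetSize_of_ne (n := n) hX
      have ha := hr ⟨n - 1, by omega⟩ (by simp)
      have hb := hr ⟨n, by omega⟩ le_rfl
      have ho : Opp (⟨n - 1, by omega⟩ : Letter X n) ⟨n, by omega⟩ := by
        rw [opp_iff]; exact ⟨hX, by simp; omega⟩
      rw [eps_eq_neg_of_opp ho, neg_dotProduct, ha] at hb
      linarith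
  ext j
  rw [h2 j, h3 (by have := j.2; omega)]; rfl

theorem eq_sum_fundCoweight {x : Amb X n} (hx : x ∈ apartment X n) :
    x = ∑ i, (simpleRoot X n i ⬝ᵥ x) • fundCoweight X n i := by
  rw [← sub_eq_zero]
  refine eq_zero_of_simpleRoot_dotProduct (sub_mem hx (Submodule.sum_mem _ fun i _ =>
    Submodule.smul_mem _ _ (fundCoweight_mem_apartment i))) fun j => ?_
  rw [dotProduct_sub, dotProduct_sum]
  simp [dotProduct_smul, simpleRoot_dotProduct_fundCoweight]

theorem dotProduct_eq_sum {x : Amb X n} (hx : x ∈ apartment X n) (β : Amb X n) :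
    β ⬝ᵥ x = ∑ i, (simpleRoot X n i ⬝ᵥ x) * (β ⬝ᵥ fundCoweight X n i) := by
  conv_lhs => rw [eq_sum_fundCoweight hx, dotProduct_sum]
  simp [dotProduct_smul]

/-- Coordinates of the apartment with respect to the fundamental coweights. -/
def coweightCoords (X : ClassicalType) (n : ℕ) : apartment X n ≃ₗ[ℝ] (Fin n → ℝ) where
  toFun x i := simpleRoot X n i ⬝ᵥ (x : Amb X n)
  invFun c := ⟨∑ i, c i • fundCoweight X n i, Submodule.sum_mem _ fun i _ =>
    Submodule.smul_mem _ _ (fundCoweight_mem_apartment i)⟩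
  map_add' x y := by ext i; simp [dotProduct_add]
  map_smul' r x := by ext i; simp [dotProduct_smul]
  left_inv x := by
    ext1
    exact (eq_sum_fundCoweight x.2).symm
  right_inv c := by
    ext j
    simp [dotProduct_sum, dotProduct_smul, simpleRoot_dotProduct_fundCoweight]

/-- At points where the simple roots are nonnegative, every positive root lies between 0 and the
highest root, since its coefficients lie between 0 and those of the highest root. -/
theorem mem_fundAlcove_iff (hn : 1 ≤ n) {x : Amb X n} : x ∈ fundAlcove X n ↔
    x ∈ apartment X n ∧ (∀ i, 0 ≤ simpleRoot X n i ⬝ᵥ x) ∧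
      ∑ i, (simpleRoot X n i ⬝ᵥ x) * mult X i ≤ 1 := by
  refine and_congr_right fun hx => ?_
  constructor
  · intro h
    refine ⟨fun i => (h _ (simpleRoot_mem_posRoots i)).1, ?_⟩
    obtain ⟨θ, hθ, e⟩ := exists_highestRoot (X := X) hn
    have := (h θ hθ).2
    rw [dotProduct_eq_sum hx] at this
    simpa only [e] using this
  · rintro ⟨h1, h2⟩ β hβ
    rw [dotProduct_eq_sum hx]
    refine ⟨Finset.sum_nonneg fun i _ => mul_nonneg (h1 i) ?_,
      le_trans (Finset.sum_le_sum fun i _ => mul_le_mul_of_nonneg_left ?_ (h1 i)) h2⟩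
    · obtain ⟨k, -, e⟩ := posRoot_dotProduct_fundCoweight hβ i
      rw [e]; positivity
    · obtain ⟨k, hk, e⟩ := posRoot_dotProduct_fundCoweight hβ i
      rw [e]; exact_mod_cast hk

/-! ### Faces -/

/-- The smallest face containing the point `y`. -/
def faceOf (y : Amb X n) : Set (Amb X n) :=
  {x | x ∈ apartment X n ∧ ∀ β ∈ roots X n, ∀ k : ℤ, 0 ≤ β ⬝ᵥ y + k → 0 ≤ β ⬝ᵥ x + k}

theorem mem_faceOf_self {y : Amb X n} (hy : y ∈ apartment X n) : y ∈ faceOf y :=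
  ⟨hy, fun _ _ _ h => h⟩

theorem mem_faceOf_iff {x y : Amb X n} : x ∈ faceOf y ↔ x ∈ apartment X n ∧
    ∀ β ∈ posRoots X n, ∀ k : ℤ, (0 ≤ β ⬝ᵥ y + k → 0 ≤ β ⬝ᵥ x + k) ∧
      (β ⬝ᵥ y + k ≤ 0 → β ⬝ᵥ x + k ≤ 0) := by
  refine and_congr_right fun hx => ⟨fun h β hβ k => ⟨h β (.inl hβ) k, fun h' => ?_⟩, ?_⟩
  · have := h (-β) (neg_mem_roots (.inl hβ)) (-k)
    simp only [neg_dotProduct] at this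
    push_cast at this
    linarith [this (by linarith)]
  · rintro h β (hβ | hβ) k h'
    · exact (h β hβ k).1 h'
    · have := (h (-β) hβ (-k)).2
      simp only [neg_dotProduct] at this
      push_cast at this
      linarith [this (by linarith)]

theorem closedFace_eq_faceOf {s : Amb X n → ℤ → SignType} {y : Amb X n} (hy : y ∈ openFace s) :
    closedFace s = faceOf y := by
  ext x
  rw [mem_faceOf_iff]
  refine and_congr_right fun hx => forall₃_congr fun β hβ k => ?_
  rw [← hy.2 β hβ k]
  rcases lt_trichotomy (β ⬝ᵥ y + (k : ℝ)) 0 with h | h | h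
  · rw [sign_neg h]
    exact ⟨fun h' => ⟨fun h'' => absurd h h''.not_gt, fun _ => h'.2⟩, fun h' => ⟨hx, h'.2 h.le⟩⟩
  · rw [h, sign_zero]
    exact ⟨fun h' => ⟨fun _ => h'.2.ge, fun _ => h'.2.le⟩,
      fun h' => ⟨hx, le_antisymm (h'.2 le_rfl) (h'.1 le_rfl)⟩⟩
  · rw [sign_pos h]
    exact ⟨fun h' => ⟨fun _ => h'.2, fun h'' => absurd h h''.not_gt⟩, fun h' => ⟨hx, h'.1 h.le⟩⟩

/-- Any point of the open face recovers the signs, so a face can be handled through a single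
generating point. -/
theorem isFace_iff {F : Set (Amb X n)} : IsFace F ↔ ∃ y ∈ apartment X n, F = faceOf y := by
  constructor
  · rintro ⟨s, ⟨y, hy⟩, rfl⟩
    exact ⟨y, hy.1, closedFace_eq_faceOf hy⟩
  · rintro ⟨y, hy, rfl⟩
    have h : y ∈ openFace fun β k => SignType.sign (β ⬝ᵥ y + k) := ⟨hy, fun _ _ _ => rfl⟩
    exact ⟨_, ⟨y, h⟩, (closedFace_eq_faceOf h).symm⟩

theorem isVertex_iff {v : Amb X n} : IsVertex v ↔ v ∈ apartment X n ∧ faceOf v = {v} := by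
  constructor
  · intro h
    obtain ⟨y, hy, e⟩ := isFace_iff.1 h
    have : y ∈ ({v} : Set (Amb X n)) := e ▸ mem_faceOf_self hy
    obtain rfl := Set.mem_singleton_iff.1 this
    exact ⟨hy, e.symm⟩
  · rintro ⟨h, e⟩
    exact isFace_iff.2 ⟨v, h, e.symm⟩

/-! ### Automorphisms of the arrangement of walls -/

/-- `g` maps the apartment to itself and pulls affine roots back to affine roots. -/
def PullsBack (g : Amb X n → Amb X n) : Prop :=
  (∀ x ∈ apartment X n, g x ∈ apartment X n) ∧
    ∀ β ∈ roots X n, ∀ k : ℤ, ∃ β' ∈ roots X n, ∃ k' : ℤ, ∀ x, β ⬝ᵥ g x + k = β' ⬝ᵥ x + k'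

theorem PullsBack.comp {g h : Amb X n → Amb X n} (hg : PullsBack g) (hh : PullsBack h) :
    PullsBack (g ∘ h) := by
  refine ⟨fun x hx => hg.1 _ (hh.1 x hx), fun β hβ k => ?_⟩
  obtain ⟨β', hβ', k', e⟩ := hg.2 β hβ k
  obtain ⟨β'', hβ'', k'', e'⟩ := hh.2 β' hβ' k'
  exact ⟨β'', hβ'', k'', fun x => by rw [Function.comp_apply, e, e']⟩

theorem PullsBack.faceOf_subset {g : Amb X n → Amb X n} (hg : PullsBack g) {x y : Amb X n}
    (h : x ∈ faceOf y) : g x ∈ faceOf (g y) := by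
  refine ⟨hg.1 x h.1, fun β hβ k h' => ?_⟩
  obtain ⟨β', hβ', k', e⟩ := hg.2 β hβ k
  rw [e] at h' ⊢
  exact h.2 β' hβ' k' h'

/-- Automorphisms of the arrangement of walls. -/
def IsAut (g : Equiv.Perm (Amb X n)) : Prop := PullsBack g ∧ PullsBack (g⁻¹ : Equiv.Perm (Amb X n))

theorem IsAut.mul {g h : Equiv.Perm (Amb X n)} (hg : IsAut g) (hh : IsAut h) : IsAut (g * h) :=
  ⟨hg.1.comp hh.1, by rw [mul_inv_rev]; exact hh.2.comp hg.2⟩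

theorem IsAut.image_faceOf {g : Equiv.Perm (Amb X n)} (hg : IsAut g) (y : Amb X n) :
    g '' faceOf y = faceOf (g y) := by
  ext x
  constructor
  · rintro ⟨x, hx, rfl⟩
    exact hg.1.faceOf_subset hx
  · intro hx
    refine ⟨g⁻¹ x, ?_, perm_apply_inv g x⟩
    have := hg.2.faceOf_subset hx
    rwa [perm_inv_apply] at this

theorem IsAut.isVertex {g : Equiv.Perm (Amb X n)} (hg : IsAut g) {v : Amb X n} (hv : IsVertex v) :
    IsVertex (g v) := by
  rw [isVertex_iff] at hv ⊢
  refine ⟨hg.1.1 v hv.1, ?_⟩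
  rw [← hg.image_faceOf, hv.2, Set.image_singleton]

/-! ### Integrality -/

theorem root_dotProduct_eps {β : Amb X n} (hβ : β ∈ roots X n) (l : Letter X n) :
    ∃ k : ℤ, β ⬝ᵥ eps l = k := by
  obtain ⟨a, b, hab, rfl⟩ := exists_letters_of_mem_roots hβ
  have hint : ∀ c : Letter X n, ∃ k : ℤ, eps c ⬝ᵥ eps l = k := fun c => by
    rw [eps_dotProduct_eps]
    split_ifs
    exacts [⟨1, by simp⟩, ⟨-1, by simp⟩, ⟨0, by simp⟩]
  obtain ⟨k, hk⟩ := hint a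
  obtain ⟨k', hk'⟩ := hint b
  rw [smul_dotProduct, sub_dotProduct, hk, hk', smul_eq_mul, rootScale]
  split_ifs with h
  · rw [eps_eq_neg_of_opp h.1, neg_dotProduct, hk] at hk'
    exact ⟨k, by rw [← hk']; ring⟩
  · exact ⟨k - k', by push_cast; ring⟩

/-- The coroot `2β / ⟨β,β⟩`. -/
def coroot (β : Amb X n) : Amb X n := (2 / (β ⬝ᵥ β)) • β

theorem affRefl_eq_sub_coroot (β : Amb X n) (k : ℤ) (x : Amb X n) :
    affRefl β k x = affRefl β 0 x - (k : ℝ) • coroot β := by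
  rw [affRefl_apply, affRefl_zero_apply, coroot, smul_smul, add_mul, add_smul, sub_sub]

theorem affRefl_zero_eq (β x : Amb X n) : affRefl β 0 x = x - (β ⬝ᵥ x) • coroot β := by
  rw [affRefl_zero_apply, coroot, smul_smul]

theorem coroot_eq {a b : Letter X n} (hab : a ≠ b) : coroot (rootScale a b • (eps a - eps b)) =
    if Opp a b ∧ X = B then eps a else eps a - eps b := by
  have h0 := (rootScale_pos a b).ne'
  rw [coroot, smul_dotProduct, dotProduct_smul, smul_eq_mul, smul_eq_mul, smul_smul]
  by_cases ho : Opp a b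
  · have hb := eps_eq_neg_of_opp ho
    have h2 : eps a - eps b = (2 : ℝ) • eps a := by rw [hb, sub_neg_eq_add, two_smul]
    have h3 := rootScale_two_of_opp ho
    simp only [h2, smul_dotProduct, dotProduct_smul, eps_dotProduct_self, smul_eq_mul, smul_smul]
    split_ifs with h4
    · rw [if_pos h4.2] at h3
      obtain h5 : rootScale a b = 1 := by linarith
      rw [h5]; norm_num
    · rw [if_neg (fun h => h4 ⟨ho, h⟩)] at h3
      obtain h5 : rootScale a b = 1 / 2 := by linarith
      rw [h5]; norm_num
  · have h2 : (eps a - eps b) ⬝ᵥ (eps a - eps b) = 2 := by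
      simp only [sub_dotProduct, dotProduct_sub, eps_dotProduct_eps, if_true, if_neg hab,
        if_neg hab.symm, if_neg ho, if_neg (fun h => ho (Opp.symm h))]
      norm_num
    rw [h2, if_neg (fun h => ho h.1), rootScale_of_not_opp ho]
    norm_num

theorem root_dotProduct_coroot {β β' : Amb X n} (hβ : β ∈ roots X n) (hβ' : β' ∈ roots X n) :
    ∃ k : ℤ, β ⬝ᵥ coroot β' = k := by
  obtain ⟨a, b, hab, rfl⟩ := exists_letters_of_mem_roots hβ'
  rw [coroot_eq hab]
  obtain ⟨k, hk⟩ := root_dotProduct_eps hβ a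
  obtain ⟨k', hk'⟩ := root_dotProduct_eps hβ b
  split_ifs
  · exact ⟨k, hk⟩
  · exact ⟨k - k', by rw [dotProduct_sub, hk, hk']; push_cast; ring⟩

theorem rootScale_act {w : Equiv.Perm (Amb X n)} (hw : w ∈ weyl X n) (a b : Letter X n) :
    rootScale (act w a) (act w b) = rootScale a b := by
  rw [rootScale, rootScale, opp_act_iff hw]

theorem weyl_mem_roots {w : Equiv.Perm (Amb X n)} (hw : w ∈ weyl X n) {β : Amb X n}
    (hβ : β ∈ roots X n) : w β ∈ roots X n := by
  obtain ⟨a, b, hab, rfl⟩ := exists_letters_of_mem_roots hβ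
  rw [weyl_smul hw, weyl_sub hw, ← eps_act hw, ← eps_act hw, ← rootScale_act hw]
  exact letters_mem_roots fun h => hab (act_injective hw h)

theorem weyl_mem_apartment {w : Equiv.Perm (Amb X n)} (hw : w ∈ weyl X n) {x : Amb X n}
    (hx : x ∈ apartment X n) : w x ∈ apartment X n := by
  induction hx using Submodule.span_induction with
  | mem β hβ => exact Submodule.subset_span (weyl_mem_roots hw hβ)
  | zero => rw [weyl_zero hw]; exact zero_mem _
  | add x y _ _ hx hy => rw [weyl_add hw]; exact add_mem hx hy
  | smul r x _ hx => rw [weyl_smul hw]; exact Submodule.smul_mem _ _ hx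

theorem affRefl_zero_mem_weyl {β : Amb X n} (hβ : β ∈ roots X n) : affRefl β 0 ∈ weyl X n :=
  Subgroup.subset_closure ⟨β, hβ, rfl⟩

theorem isAut_affRefl {β : Amb X n} (hβ : β ∈ roots X n) (k : ℤ) : IsAut (affRefl β k) := by
  have hs := affRefl_zero_mem_weyl hβ
  have h : PullsBack (affRefl β k) := by
    refine ⟨fun x hx => ?_, fun β' hβ' k' => ?_⟩
    · rw [affRefl_apply]
      exact sub_mem hx (Submodule.smul_mem _ _ (Submodule.subset_span hβ))
    · obtain ⟨c, hc⟩ := root_dotProduct_coroot hβ' hβ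
      refine ⟨affRefl β 0 β', weyl_mem_roots hs hβ', k' - k * c, fun x => ?_⟩
      rw [affRefl_eq_sub_coroot, dotProduct_sub, dotProduct_smul, hc, weyl_dotProduct_left hs,
        affRefl_inv, smul_eq_mul]
      push_cast
      ring
  exact ⟨h, h⟩

theorem isAut_one : IsAut (1 : Equiv.Perm (Amb X n)) :=
  have : PullsBack (id : Amb X n → Amb X n) :=
    ⟨fun _ hx => hx, fun β hβ k => ⟨β, hβ, k, fun _ => rfl⟩⟩
  ⟨this, this⟩

theorem affWeyl_induction {p : Equiv.Perm (Amb X n) → Prop} (one : p 1)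
    (step : ∀ β ∈ roots X n, ∀ k : ℤ, ∀ w ∈ affWeyl X n, p w → p (affRefl β k * w))
    {w : Equiv.Perm (Amb X n)} (hw : w ∈ affWeyl X n) : p w := by
  induction hw using Subgroup.closure_induction_left with
  | one => exact one
  | mul_left x hx y hy h =>
    obtain ⟨β, hβ, k, rfl⟩ := hx
    exact step β hβ k y hy h
  | inv_mul_cancel x hx y hy h =>
    obtain ⟨β, hβ, k, rfl⟩ := hx
    exact step β hβ k y hy h

theorem isAut_of_mem_affWeyl {g : Equiv.Perm (Amb X n)} (hg : g ∈ affWeyl X n) : IsAut g :=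
  affWeyl_induction isAut_one (fun _ hβ k _ _ h => (isAut_affRefl hβ k).mul h) hg

theorem affRefl_mem_affWeyl {β : Amb X n} (hβ : β ∈ roots X n) (k : ℤ) :
    affRefl β k ∈ affWeyl X n := Subgroup.subset_closure ⟨β, hβ, k, rfl⟩

theorem weyl_le_affWeyl : weyl X n ≤ affWeyl X n := by
  rw [weyl, Subgroup.closure_le]
  rintro _ ⟨β, hβ, rfl⟩
  exact affRefl_mem_affWeyl hβ 0

/-- Points on which all roots take integral values. -/
def Integral (v : Amb X n) : Prop :=
  v ∈ apartment X n ∧ ∀ β ∈ roots X n, ∃ k : ℤ, β ⬝ᵥ v = k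

/-- Translations. -/
def trans (t : Amb X n) : Equiv.Perm (Amb X n) := Equiv.addRight t

theorem trans_apply (t x : Amb X n) : trans t x = x + t := rfl

theorem trans_inv (t : Amb X n) : (trans t)⁻¹ = trans (-t) := by
  rw [inv_eq_iff_mul_eq_one]
  ext1 x
  simp [trans_apply]

theorem trans_add (s t : Amb X n) : trans (s + t) = trans t * trans s := by
  ext1 x
  simp [trans_apply, add_assoc]

theorem trans_zero : trans (0 : Amb X n) = 1 := by ext1 x; simp [trans_apply]

theorem Integral.neg {v : Amb X n} (hv : Integral v) : Integral (-v) := by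
  refine ⟨neg_mem hv.1, fun β hβ => ?_⟩
  obtain ⟨k, hk⟩ := hv.2 β hβ
  exact ⟨-k, by rw [dotProduct_neg, hk]; push_cast; rfl⟩

theorem Integral.add {v v' : Amb X n} (hv : Integral v) (hv' : Integral v') :
    Integral (v + v') := by
  refine ⟨add_mem hv.1 hv'.1, fun β hβ => ?_⟩
  obtain ⟨k, hk⟩ := hv.2 β hβ
  obtain ⟨k', hk'⟩ := hv'.2 β hβ
  exact ⟨k + k', by rw [dotProduct_add, hk, hk']; push_cast; rfl⟩

theorem integral_zero : Integral (0 : Amb X n) :=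
  ⟨zero_mem _, fun β _ => ⟨0, by simp⟩⟩

theorem isAut_trans {v : Amb X n} (hv : Integral v) : IsAut (trans v) := by
  have h : ∀ v : Amb X n, Integral v → PullsBack (trans v) := by
    intro v hv
    refine ⟨fun x hx => add_mem hx hv.1, fun β hβ k => ?_⟩
    obtain ⟨c, hc⟩ := hv.2 β hβ
    exact ⟨β, hβ, c + k, fun x => by rw [trans_apply, dotProduct_add, hc]; push_cast; ring⟩
  exact ⟨h v hv, by rw [trans_inv]; exact h _ hv.neg⟩

theorem isAut_neg : IsAut (Equiv.neg (Amb X n)) := by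
  have h : PullsBack (fun x : Amb X n => -x) := by
    refine ⟨fun x hx => neg_mem hx, fun β hβ k => ⟨-β, neg_mem_roots hβ, k, fun x => ?_⟩⟩
    rw [dotProduct_neg, neg_dotProduct]
  exact ⟨h, h⟩

theorem PullsBack.integral {g : Amb X n → Amb X n} (hg : PullsBack g) {v : Amb X n}
    (hv : Integral v) : Integral (g v) := by
  refine ⟨hg.1 v hv.1, fun β hβ => ?_⟩
  obtain ⟨β', hβ', k', e⟩ := hg.2 β hβ 0
  obtain ⟨c, hc⟩ := hv.2 β' hβ'
  have := e v
  rw [hc, Int.cast_zero, add_zero] at this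
  exact ⟨c + k', by rw [this]; push_cast; rfl⟩

/-- Since β takes an integral value c at `v`, the translation by `v` conjugates s_{β,0} into
s_{β,-c}. Thus the affine Weyl group contains a copy of W fixing `v`, even though the translation by
`v` need not belong to it. -/
theorem trans_conj_mem_affWeyl {v : Amb X n} (hv : Integral v) {w : Equiv.Perm (Amb X n)}
    (hw : w ∈ weyl X n) : trans v * w * (trans v)⁻¹ ∈ affWeyl X n := by
  refine weyl_induction (p := fun w => trans v * w * (trans v)⁻¹ ∈ affWeyl X n)
    (by rw [mul_one, mul_inv_cancel]; exact one_mem _) ?_ hw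
  intro a b hab w _ h
  obtain ⟨β, hβ, e⟩ := swapRefl_eq_affRefl hab.ne
  obtain ⟨c, hc⟩ := hv.2 β hβ
  have h1 : trans v * affRefl β 0 * (trans v)⁻¹ = affRefl β (-c) := by
    ext1 x
    rw [affRefl_eq_sub_coroot, trans_inv]
    simp only [Equiv.Perm.mul_apply, trans_apply, affRefl_zero_eq, dotProduct_add, dotProduct_neg,
      hc]
    push_cast
    module
  have h2 : trans v * (swapRefl a b * w) * (trans v)⁻¹ =
      (trans v * affRefl β 0 * (trans v)⁻¹) * (trans v * w * (trans v)⁻¹) := by rw [e]; group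
  rw [h2, h1]
  exact mul_mem (affRefl_mem_affWeyl hβ _) h

theorem trans_coroot_mem_affWeyl {β : Amb X n} (hβ : β ∈ roots X n) :
    trans (coroot β) ∈ affWeyl X n := by
  have : trans (coroot β) = affRefl β (-1) * affRefl β 0 := by
    ext1 x
    have h : affRefl β 0 (affRefl β 0 x) = x := affReflFun_involutive _ _ x
    rw [Equiv.Perm.mul_apply, affRefl_eq_sub_coroot, h, trans_apply]
    push_cast
    module
  rw [this]
  exact mul_mem (affRefl_mem_affWeyl hβ _) (affRefl_mem_affWeyl hβ _)

/-! ### The translation lattice -/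

/-- A lattice that contains the coroots and is stable under the Weyl group. -/
def latticeT (X : ClassicalType) (n : ℕ) : AddSubgroup (Amb X n) where
  carrier := {t | (∀ j, ∃ k : ℤ, t j = k) ∧ (X = C → ∃ k : ℤ, ∑ j, t j = 2 * k)}
  zero_mem' := ⟨fun _ => ⟨0, by simp⟩, fun _ => ⟨0, by simp⟩⟩
  add_mem' := by
    rintro s t ⟨h1, h2⟩ ⟨h3, h4⟩
    refine ⟨fun j => ?_, fun hX => ?_⟩
    · obtain ⟨k, hk⟩ := h1 j
      obtain ⟨k', hk'⟩ := h3 j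
      exact ⟨k + k', by rw [Pi.add_apply, hk, hk']; push_cast; rfl⟩
    · obtain ⟨k, hk⟩ := h2 hX
      obtain ⟨k', hk'⟩ := h4 hX
      exact ⟨k + k', by simp only [Pi.add_apply, Finset.sum_add_distrib, hk, hk']; push_cast; ring⟩
  neg_mem' := by
    rintro s ⟨h1, h2⟩
    refine ⟨fun j => ?_, fun hX => ?_⟩
    · obtain ⟨k, hk⟩ := h1 j
      exact ⟨-k, by rw [Pi.neg_apply, hk]; push_cast; rfl⟩
    · obtain ⟨k, hk⟩ := h2 hX
      exact ⟨-k, by simp only [Pi.neg_apply, Finset.sum_neg_distrib, hk]; push_cast; ring⟩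

theorem eps_apply_int (a : Letter X n) (j : Fin (dim X n)) : ∃ k : ℤ, (eps a : Amb X n) j = k := by
  obtain ⟨l, -, hl⟩ := exists_eps_eq_e j
  have : (eps a : Amb X n) j = eps l ⬝ᵥ eps a := by rw [hl, e_dotProduct j.2]
  rw [this, eps_dotProduct_eps]
  split_ifs
  exacts [⟨1, by simp⟩, ⟨-1, by simp⟩, ⟨0, by simp⟩]

theorem sum_eps (a : Letter X n) :
    ∑ j, (eps a : Amb X n) j = 1 ∨ ∑ j, (eps a : Amb X n) j = -1 := by
  have h : ∀ k, k < dim X n → ∑ j, e X n k j = 1 := fun k hk => by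
    have := e_dotProduct hk 1
    rwa [dotProduct_one] at this
  rcases eq_A_or_lt_or_ge a with ha | ha
  · left
    rw [eps_of_lt ha, h _ (val_lt_dim ha)]
  · right
    have := val_lt_of_ne ha.1 a
    rw [eps_of_ge ha.1 ha.2]
    simp only [Pi.neg_apply, Finset.sum_neg_distrib]
    rw [h _ (by rw [dim_of_ne ha.1]; omega)]

theorem eps_sub_eps_mem_latticeT (a b : Letter X n) : eps a - eps b ∈ latticeT X n := by
  refine ⟨fun j => ?_, fun _ => ?_⟩
  · obtain ⟨k, hk⟩ := eps_apply_int a j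
    obtain ⟨k', hk'⟩ := eps_apply_int b j
    exact ⟨k - k', by rw [Pi.sub_apply, hk, hk']; push_cast; rfl⟩
  · simp only [Pi.sub_apply, Finset.sum_sub_distrib]
    rcases sum_eps a with h | h <;> rcases sum_eps b with h' | h' <;> rw [h, h']
    exacts [⟨0, by simp⟩, ⟨1, by norm_num⟩, ⟨-1, by norm_num⟩, ⟨0, by simp⟩]

theorem coroot_mem_latticeT {β : Amb X n} (hβ : β ∈ roots X n) : coroot β ∈ latticeT X n := by
  obtain ⟨a, b, hab, rfl⟩ := exists_letters_of_mem_roots hβ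
  rw [coroot_eq hab]
  split_ifs with h
  · exact ⟨eps_apply_int a, fun hC => by rw [h.2] at hC; simp at hC⟩
  · exact eps_sub_eps_mem_latticeT a b

theorem root_dotProduct_int {β : Amb X n} (hβ : β ∈ roots X n) {t : Amb X n}
    (ht : ∀ j, ∃ k : ℤ, t j = k) : ∃ k : ℤ, β ⬝ᵥ t = k := by
  choose f hf using ht
  have h : ∀ j : Fin (dim X n), ∃ k : ℤ, β ⬝ᵥ e X n j = k := fun j => by
    obtain ⟨l, -, hl⟩ := exists_eps_eq_e j
    rw [← hl]
    exact root_dotProduct_eps hβ l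
  choose g hg using h
  refine ⟨∑ j, f j * g j, ?_⟩
  rw [eq_sum_smul_e t, dotProduct_sum]
  simp [dotProduct_smul, hg, hf]

theorem weyl_mem_latticeT {w : Equiv.Perm (Amb X n)} (hw : w ∈ weyl X n) {t : Amb X n}
    (ht : t ∈ latticeT X n) : w t ∈ latticeT X n := by
  refine weyl_induction (p := fun w => w t ∈ latticeT X n) ht ?_ hw
  intro a b hab w _ h
  obtain ⟨β, hβ, e⟩ := swapRefl_eq_affRefl hab.ne
  obtain ⟨k, hk⟩ := root_dotProduct_int hβ h.1
  rw [e, Equiv.Perm.mul_apply, affRefl_zero_eq, hk]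
  refine sub_mem h ?_
  rw [Int.cast_smul_eq_zsmul]
  exact zsmul_mem (coroot_mem_latticeT hβ) k

/-- Composing with s_{β,k} applies s_β to the translation part and subtracts a multiple of a coroot,
and `latticeT` is stable under both. -/
theorem affWeyl_decomp {g : Equiv.Perm (Amb X n)} (hg : g ∈ affWeyl X n) :
    ∃ w ∈ weyl X n, ∃ t ∈ latticeT X n, ∀ x, g x = w x + t := by
  refine affWeyl_induction (p := fun g => ∃ w ∈ weyl X n, ∃ t ∈ latticeT X n, ∀ x, g x = w x + t)
    ⟨1, one_mem _, 0, zero_mem _, fun x => by simp⟩ ?_ hg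
  rintro β hβ k g - ⟨w, hw, t, ht, h⟩
  have hs := affRefl_zero_mem_weyl hβ
  refine ⟨affRefl β 0 * w, mul_mem hs hw, affRefl β 0 t - (k : ℝ) • coroot β,
    sub_mem (weyl_mem_latticeT hs ht) ?_, fun x => ?_⟩
  · rw [Int.cast_smul_eq_zsmul]
    exact zsmul_mem (coroot_mem_latticeT hβ) k
  · rw [Equiv.Perm.mul_apply, Equiv.Perm.mul_apply, affRefl_eq_sub_coroot, h, weyl_add hs,
      add_sub_assoc]

/-! ### The fundamental alcove -/

/-- The weighted sum of the coordinates, which is the value of the highest root. -/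
def level (x : Amb X n) : ℝ := ∑ i, (simpleRoot X n i ⬝ᵥ x) * mult X i

theorem level_add (x y : Amb X n) : level (x + y) = level x + level y := by
  simp only [level, dotProduct_add, add_mul, Finset.sum_add_distrib]

theorem level_smul (r : ℝ) (x : Amb X n) : level (r • x) = r * level x := by
  simp only [level, dotProduct_smul, smul_eq_mul, Finset.mul_sum, mul_assoc]

/-- Positive roots take values in [0,1] on the alcove, so only `k = 0` and `k = -1` impose
conditions. If β vanishes at `y`, so do all coordinates with a nonzero coefficient in β. If β equals
1 at `y`, then so does the highest root, and all coordinates where the coefficients of the two roots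
differ vanish. These vanishing conditions pass from `y` to `x`. -/
theorem mem_faceOf_iff_of_mem_fundAlcove (hn : 1 ≤ n) {x y : Amb X n} (hy : y ∈ fundAlcove X n) :
    x ∈ faceOf y ↔ x ∈ fundAlcove X n ∧
      (∀ i, simpleRoot X n i ⬝ᵥ y = 0 → simpleRoot X n i ⬝ᵥ x = 0) ∧
        (level y = 1 → level x = 1) := by
  obtain ⟨θ, hθ, hθe⟩ := exists_highestRoot (X := X) hn
  have hlev : ∀ z ∈ apartment X n, θ ⬝ᵥ z = level z := fun z hz => by
    rw [dotProduct_eq_sum hz, level]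
    simp only [hθe]
  rw [mem_faceOf_iff]
  constructor
  · rintro ⟨hx, h⟩
    refine ⟨⟨hx, fun β hβ => ⟨?_, ?_⟩⟩, fun i hi => ?_, fun h1 => ?_⟩
    · have := (h β hβ 0).1 (by simpa using (hy.2 β hβ).1)
      simpa using this
    · have := (h β hβ (-1)).2 (by have := (hy.2 β hβ).2; push_cast; linarith)
      push_cast at this
      linarith
    · have := h _ (simpleRoot_mem_posRoots i) 0
      simp only [Int.cast_zero, add_zero, hi, le_refl, true_implies] at this
      exact le_antisymm this.2 this.1
    · have := h θ hθ (-1)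
      rw [hlev x hx, hlev y hy.1, h1] at this
      push_cast at this
      have h2 := this.1 (by norm_num)
      have h3 := this.2 (by norm_num)
      linarith
  · rintro ⟨hx, h0, h1⟩
    refine ⟨hx.1, fun β hβ k => ?_⟩
    have hyc := ((mem_fundAlcove_iff hn).1 hy).2
    have hb : ∀ i, 0 ≤ β ⬝ᵥ fundCoweight X n i ∧ β ⬝ᵥ fundCoweight X n i ≤ mult X i := fun i => by
      obtain ⟨k, hk, e⟩ := posRoot_dotProduct_fundCoweight hβ i
      rw [e]
      exact ⟨by positivity, by exact_mod_cast hk⟩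
    constructor
    · intro h
      rcases le_or_gt 0 k with hk | hk
      · have : (0 : ℝ) ≤ k := by exact_mod_cast hk
        have := (hx.2 β hβ).1
        linarith
      · have hk' : (k : ℝ) ≤ -1 := by exact_mod_cast Int.le_sub_one_of_lt hk
        have h2 := (hy.2 β hβ).2
        have h3 : β ⬝ᵥ y = 1 := by linarith
        have h4 : (k : ℝ) = -1 := by linarith
        have h5 : ∑ i, (simpleRoot X n i ⬝ᵥ y) * (mult X i - β ⬝ᵥ fundCoweight X n i) =
            level y - 1 := by
          rw [← h3, dotProduct_eq_sum hy.1 β, level]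
          simp only [mul_sub, Finset.sum_sub_distrib]
        have hnn : ∀ i ∈ Finset.univ, 0 ≤ (simpleRoot X n i ⬝ᵥ y) *
            (mult X i - β ⬝ᵥ fundCoweight X n i) :=
          fun i _ => mul_nonneg (hyc.1 i) (by linarith [(hb i).2])
        have h6 : level y = 1 := by
          have := Finset.sum_nonneg hnn
          have h7 : level y ≤ 1 := hyc.2
          linarith
        rw [h6, sub_self, Finset.sum_eq_zero_iff_of_nonneg hnn] at h5
        have h7 : ∑ i, (simpleRoot X n i ⬝ᵥ x) * (mult X i - β ⬝ᵥ fundCoweight X n i) = 0 := by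
          refine Finset.sum_eq_zero fun i hi => ?_
          rcases mul_eq_zero.1 (h5 i hi) with h | h
          · rw [h0 i h, zero_mul]
          · rw [h, mul_zero]
        simp only [mul_sub, Finset.sum_sub_distrib] at h7
        rw [← dotProduct_eq_sum hx.1] at h7
        have h8 : level x = 1 := h1 h6
        rw [level] at h8
        linarith
    · intro h
      rcases lt_or_ge k 0 with hk | hk
      · have hk' : (k : ℝ) ≤ -1 := by exact_mod_cast Int.le_sub_one_of_lt hk
        have := (hx.2 β hβ).2
        linarith
      · have hk' : (0 : ℝ) ≤ k := by exact_mod_cast hk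
        have h2 := (hy.2 β hβ).1
        have h3 : β ⬝ᵥ y = 0 := by linarith
        have hnn : ∀ i ∈ Finset.univ, 0 ≤ (simpleRoot X n i ⬝ᵥ y) *
            (β ⬝ᵥ fundCoweight X n i) := fun i _ => mul_nonneg (hyc.1 i) (hb i).1
        rw [dotProduct_eq_sum hy.1, Finset.sum_eq_zero_iff_of_nonneg hnn] at h3
        have h7 : β ⬝ᵥ x = 0 := by
          rw [dotProduct_eq_sum hx.1]
          refine Finset.sum_eq_zero fun i hi => ?_
          rcases mul_eq_zero.1 (h3 i hi) with h | h
          · rw [h0 i h, zero_mul]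
          · rw [h, mul_zero]
        rw [h7]
        linarith

/-- The direction of an edge of type `i`: `ω_i` if `ω_i` is minuscule and `ω_i / 2` otherwise. -/
def stepVec (X : ClassicalType) {n : ℕ} (i : Fin n) : Amb X n :=
  (mult X i : ℝ)⁻¹ • fundCoweight X n i

theorem mult_ne_zero (i : Fin n) : (mult X i : ℝ) ≠ 0 := by
  exact_mod_cast (mult_pos i).ne'

theorem stepVec_mem_apartment (i : Fin n) : stepVec X i ∈ apartment X n :=
  Submodule.smul_mem _ _ (fundCoweight_mem_apartment i)

theorem simpleRoot_dotProduct_stepVec (i j : Fin n) :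
    simpleRoot X n i ⬝ᵥ stepVec X j = if i = j then (mult X j : ℝ)⁻¹ else 0 := by
  rw [stepVec, dotProduct_smul, simpleRoot_dotProduct_fundCoweight]
  split_ifs <;> simp

theorem level_stepVec (i : Fin n) : level (stepVec X i) = 1 := by
  simp [level, simpleRoot_dotProduct_stepVec, inv_mul_cancel₀ (mult_ne_zero i)]

theorem smul_stepVec_mem_fundAlcove (hn : 1 ≤ n) (i : Fin n) {r : ℝ} (h0 : 0 ≤ r) (h1 : r ≤ 1) :
    r • stepVec X i ∈ fundAlcove X n := by
  rw [mem_fundAlcove_iff hn]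
  refine ⟨Submodule.smul_mem _ _ (stepVec_mem_apartment i), fun j => ?_, ?_⟩
  · rw [dotProduct_smul, simpleRoot_dotProduct_stepVec]
    refine mul_nonneg h0 ?_
    split_ifs <;> positivity
  · have := level_smul r (stepVec X i)
    rw [level_stepVec, mul_one, level] at this
    rw [this]
    exact h1

theorem eq_smul_stepVec {x : Amb X n} (hx : x ∈ apartment X n) (i : Fin n)
    (h : ∀ j, j ≠ i → simpleRoot X n j ⬝ᵥ x = 0) : x = level x • stepVec X i := by
  rw [← sub_eq_zero]
  refine eq_zero_of_simpleRoot_dotProduct (sub_mem hx (Submodule.smul_mem _ _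
    (stepVec_mem_apartment i))) fun j => ?_
  rw [dotProduct_sub, dotProduct_smul, simpleRoot_dotProduct_stepVec]
  by_cases hj : j = i
  · subst hj
    have : level x = (simpleRoot X n j ⬝ᵥ x) * mult X j := by
      rw [level, Finset.sum_eq_single j]
      · intro k _ hk
        rw [h k hk, zero_mul]
      · simp
    rw [this, if_pos rfl, smul_eq_mul, mul_assoc, mul_inv_cancel₀ (mult_ne_zero j), mul_one,
      sub_self]
  · rw [h j hj, if_neg hj, smul_zero, sub_zero]

theorem zero_mem_fundAlcove : (0 : Amb X n) ∈ fundAlcove X n :=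
  ⟨zero_mem _, fun β _ => by simp⟩

/-- The vertices of the fundamental alcove. -/
def alcoveVertex (X : ClassicalType) {n : ℕ} : Option (Fin n) → Amb X n
  | none => 0
  | some i => stepVec X i

theorem alcoveVertex_mem (hn : 1 ≤ n) (o : Option (Fin n)) : alcoveVertex X o ∈ fundAlcove X n := by
  cases o with
  | none => exact zero_mem_fundAlcove
  | some i =>
    have := smul_stepVec_mem_fundAlcove (X := X) hn i zero_le_one le_rfl
    rwa [one_smul] at this

theorem isVertex_alcoveVertex (hn : 1 ≤ n) (o : Option (Fin n)) : IsVertex (alcoveVertex X o) := by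
  have hm := alcoveVertex_mem (X := X) hn o
  refine isVertex_iff.2 ⟨hm.1, ?_⟩
  refine Set.eq_singleton_iff_unique_mem.2 ⟨mem_faceOf_self hm.1, fun x hx => ?_⟩
  obtain ⟨h1, h2, h3⟩ := (mem_faceOf_iff_of_mem_fundAlcove hn hm).1 hx
  cases o with
  | none => exact eq_zero_of_simpleRoot_dotProduct h1.1 fun i => h2 i (by simp [alcoveVertex])
  | some i =>
    rw [eq_smul_stepVec h1.1 i (fun j hj => h2 j (by
      simp [alcoveVertex, simpleRoot_dotProduct_stepVec, hj])), h3 (level_stepVec i), one_smul]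
    rfl

/-- If the level of `v` is 1, some coordinate i is nonzero and the face of `v` contains `stepVec X
i`; otherwise it contains 0. As the face is a single point, `v` is that point. -/
theorem eq_alcoveVertex (hn : 1 ≤ n) {v : Amb X n} (hv : IsVertex v) (hm : v ∈ fundAlcove X n) :
    ∃ o, v = alcoveVertex X o := by
  have hu : ∀ x ∈ faceOf v, x = v := fun x hx => by
    rw [(isVertex_iff.1 hv).2] at hx
    exact hx
  by_cases h : level v = 1
  · obtain ⟨i, hi⟩ : ∃ i, simpleRoot X n i ⬝ᵥ v ≠ 0 := by
      by_contra h0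
      push Not at h0
      simp [level, h0] at h
    refine ⟨some i, (hu _ ?_).symm⟩
    refine (mem_faceOf_iff_of_mem_fundAlcove hn hm).2
      ⟨alcoveVertex_mem hn (some i), fun j hj => ?_, fun _ => level_stepVec i⟩
    have : j ≠ i := by rintro rfl; exact hi hj
    simp [alcoveVertex, simpleRoot_dotProduct_stepVec, this]
  · refine ⟨none, (hu _ ?_).symm⟩
    exact (mem_faceOf_iff_of_mem_fundAlcove hn hm).2 ⟨alcoveVertex_mem hn none,
      fun j _ => by simp [alcoveVertex], fun h' => absurd h' h⟩

theorem faceOf_half_stepVec (hn : 1 ≤ n) (i : Fin n) :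
    faceOf ((1 / 2 : ℝ) • stepVec X i) = segment ℝ 0 (stepVec X i) := by
  have hm := smul_stepVec_mem_fundAlcove (X := X) hn i (r := 1 / 2) (by norm_num) (by norm_num)
  ext x
  rw [mem_faceOf_iff_of_mem_fundAlcove hn hm, segment_eq_image]
  constructor
  · rintro ⟨h1, h2, -⟩
    have h3 := eq_smul_stepVec h1.1 i (fun j hj => h2 j (by
      simp [dotProduct_smul, simpleRoot_dotProduct_stepVec, hj]))
    obtain ⟨-, h4, h5⟩ := (mem_fundAlcove_iff hn).1 h1
    have h6 : level x ≤ 1 := h5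
    refine ⟨level x, ⟨?_, h6⟩, ?_⟩
    · exact Finset.sum_nonneg fun j _ => mul_nonneg (h4 j) (by positivity)
    · simp only [smul_zero, zero_add]
      exact h3.symm
  · rintro ⟨r, ⟨h0, h1⟩, rfl⟩
    simp only [smul_zero, zero_add]
    refine ⟨smul_stepVec_mem_fundAlcove hn i h0 h1, fun j hj => ?_, fun h => ?_⟩
    · rw [dotProduct_smul, smul_eq_mul, mul_eq_zero] at hj ⊢
      exact .inr (hj.resolve_left (by norm_num))
    · rw [level_smul, level_stepVec] at h
      norm_num at h

/-! ### Moving points into the fundamental alcove -/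

theorem mult_sum_pos (X : ClassicalType) (hn : 1 ≤ n) : 0 < ∑ i : Fin n, (mult X i : ℝ) :=
  Finset.sum_pos (fun i _ => by exact_mod_cast mult_pos i) ⟨⟨0, hn⟩, Finset.mem_univ _⟩

theorem root_ne_zero {β : Amb X n} (hβ : β ∈ roots X n) : β ≠ 0 := by
  obtain ⟨a, b, hab, rfl⟩ := exists_letters_of_mem_roots hβ
  exact smul_ne_zero (rootScale_pos a b).ne' (sub_ne_zero.2 fun h => hab (eps_injective h))

theorem root_dotProduct_self_pos {β : Amb X n} (hβ : β ∈ roots X n) : 0 < β ⬝ᵥ β := by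
  refine lt_of_le_of_ne ?_ fun h => root_ne_zero hβ (dotProduct_self_eq_zero.1 h.symm)
  exact Finset.sum_nonneg fun i _ => mul_self_nonneg _

/-- There is a point in the interior of the fundamental alcove. -/
theorem exists_interior_point (hn : 1 ≤ n) : ∃ p : Amb X n,
    ∀ β ∈ posRoots X n, 0 < β ⬝ᵥ p ∧ β ⬝ᵥ p < 1 := by
  have hM := mult_sum_pos X hn
  refine ⟨(1 / (2 * ∑ i : Fin n, (mult X i : ℝ))) • ∑ i, fundCoweight X n i, fun β hβ => ?_⟩
  have hb : ∀ i ∈ Finset.univ, 0 ≤ β ⬝ᵥ fundCoweight X n i := fun i _ => by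
    obtain ⟨k, -, e⟩ := posRoot_dotProduct_fundCoweight hβ i
    rw [e]; positivity
  have h1 : 0 < ∑ i, β ⬝ᵥ fundCoweight X n i := by
    refine lt_of_le_of_ne (Finset.sum_nonneg hb) fun h => ?_
    have h2 := (Finset.sum_eq_zero_iff_of_nonneg hb).1 h.symm
    have h3 := root_dotProduct_self_pos (.inl hβ)
    rw [dotProduct_eq_sum (Submodule.subset_span (.inl hβ)) β] at h3
    refine h3.ne' (Finset.sum_eq_zero fun i hi => ?_)
    rw [h2 i hi, mul_zero]
  have h2 : ∑ i, β ⬝ᵥ fundCoweight X n i ≤ ∑ i : Fin n, (mult X i : ℝ) :=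
    Finset.sum_le_sum fun i _ => by
      obtain ⟨k, hk, e⟩ := posRoot_dotProduct_fundCoweight hβ i
      rw [e]; exact_mod_cast hk
  rw [dotProduct_smul, dotProduct_sum, smul_eq_mul]
  refine ⟨by positivity, ?_⟩
  rw [one_div, inv_mul_lt_iff₀ (by positivity)]
  linarith

theorem finite_int_sq_le (c R : ℝ) : {r : ℝ | ∃ k : ℤ, r = k + c ∧ r ^ 2 ≤ R}.Finite := by
  -- From `r ^ 2 ≤ R` follows |r| ≤ R + 1, which confines k to an interval.
  refine ((Set.finite_Icc ⌊-(|c| + R + 1)⌋ ⌈|c| + R + 1⌉).image fun k : ℤ => (k : ℝ) + c).subset ?_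
  rintro r ⟨k, rfl, h⟩
  refine ⟨k, ⟨?_, ?_⟩, rfl⟩
  · have : -(|c| + R + 1) ≤ k := by nlinarith [le_abs_self c, sq_nonneg ((k : ℝ) + c + 1)]
    exact Int.floor_le_iff.2 (by linarith)
  · have : (k : ℝ) ≤ |c| + R + 1 := by nlinarith [neg_abs_le c, sq_nonneg ((k : ℝ) + c - 1)]
    exact Int.le_ceil_iff.2 (by linarith)

/-- Every coordinate of a point of the orbit is the value of some letter at `y` plus an integer, and
only finitely many such numbers lie in a bounded interval. -/
theorem finite_orbit_ball (y p : Amb X n) (R : ℝ) :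
    {z | (∃ g ∈ affWeyl X n, z = g y) ∧ (z - p) ⬝ᵥ (z - p) ≤ R}.Finite := by
  have hfin : (Set.pi Set.univ fun j : Fin (dim X n) => ⋃ m : Letter X n,
      {r : ℝ | ∃ k : ℤ, r = k + (eps m ⬝ᵥ y - p j) ∧ r ^ 2 ≤ R}).Finite :=
    Set.Finite.pi fun j => Set.finite_iUnion fun m => finite_int_sq_le _ _
  refine (hfin.image fun z => z + p).subset ?_
  rintro z ⟨⟨g, hg, rfl⟩, h⟩
  refine ⟨g y - p, fun j _ => ?_, sub_add_cancel _ _⟩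
  obtain ⟨w, hw, t, ht, e⟩ := affWeyl_decomp hg
  obtain ⟨l, -, hl⟩ := exists_eps_eq_e j
  obtain ⟨k, hk⟩ := ht.1 j
  refine Set.mem_iUnion.2 ⟨act w⁻¹ l, k, ?_, ?_⟩
  · have h1 : w y j = eps (act w⁻¹ l) ⬝ᵥ y := by
      rw [eps_act (inv_mem hw), weyl_dotProduct_left (inv_mem hw), inv_inv, hl, e_dotProduct j.2]
    rw [Pi.sub_apply, e, Pi.add_apply, hk, h1]
    ring
  · refine le_trans ?_ h
    rw [sq]
    exact Finset.single_le_sum (f := fun j => (g y - p) j * (g y - p) j)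
      (fun i _ => mul_self_nonneg _) (Finset.mem_univ j)

theorem affRefl_dist (β : Amb X n) (hβ : β ∈ roots X n) (k : ℤ) (z p : Amb X n) :
    (affRefl β k z - p) ⬝ᵥ (affRefl β k z - p) = (z - p) ⬝ᵥ (z - p) +
      4 * (β ⬝ᵥ z + k) * (β ⬝ᵥ p + k) / (β ⬝ᵥ β) := by
  have h := (root_dotProduct_self_pos hβ).ne'
  rw [affRefl_apply]
  simp only [sub_dotProduct, dotProduct_sub, smul_dotProduct, dotProduct_smul, smul_eq_mul,
    dotProduct_comm z β, dotProduct_comm p β]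
  field_simp
  ring

/-- Take a point of the orbit closest to an interior point p of the alcove. By `affRefl_dist`,
reflecting in a wall separating it from p would bring it closer, so it lies on the side of p for
every wall. -/
theorem exists_mem_fundAlcove (hn : 1 ≤ n) {y : Amb X n} (hy : y ∈ apartment X n) :
    ∃ g ∈ affWeyl X n, g y ∈ fundAlcove X n := by
  obtain ⟨p, hp⟩ := exists_interior_point (X := X) hn
  obtain ⟨z, ⟨⟨g, hg, rfl⟩, hz⟩, hmin⟩ := Set.exists_min_image _ (fun z => (z - p) ⬝ᵥ (z - p))
    (finite_orbit_ball y p ((y - p) ⬝ᵥ (y - p))) ⟨y, ⟨1, one_mem _, rfl⟩, le_rfl⟩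
  have key : ∀ β ∈ roots X n, ∀ k : ℤ, 0 ≤ (β ⬝ᵥ g y + k) * (β ⬝ᵥ p + k) := by
    intro β hβ k
    by_contra h
    push Not at h
    have h0 := root_dotProduct_self_pos hβ
    have h1 := affRefl_dist β hβ k (g y) p
    have h2 : 4 * (β ⬝ᵥ g y + k) * (β ⬝ᵥ p + k) / (β ⬝ᵥ β) < 0 :=
      div_neg_of_neg_of_pos (by linarith) h0
    have h3 := hmin (affRefl β k (g y)) ⟨⟨affRefl β k * g,
      mul_mem (affRefl_mem_affWeyl hβ k) hg, rfl⟩, by linarith⟩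
    linarith
  refine ⟨g, hg, (isAut_of_mem_affWeyl hg).1.1 y hy, fun β hβ => ⟨?_, ?_⟩⟩
  · have h1 := key β (.inl hβ) 0
    simp only [Int.cast_zero, add_zero] at h1
    exact nonneg_of_mul_nonneg_left h1 (hp β hβ).1
  · have h1 := key β (.inl hβ) (-1)
    push_cast at h1
    have h2 := (hp β hβ).2
    by_contra h3
    push Not at h3
    nlinarith

/-! ### Vertices of the fundamental alcove are not conjugate -/

theorem eps_dotProduct_stepVec (i : Fin n) (l : Letter X n) :
    eps l ⬝ᵥ stepVec X i = (if X = C ∧ (i : ℕ) = 0 ∨ X = A then 1 else 1 / 2) * letterSign i l -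
      (if X = A then ((i : ℝ) + 1) / (n + 1) else 0) := by
  rw [stepVec, dotProduct_smul, eps_dotProduct_fundCoweight, smul_eq_mul, mult_eq, coweightScale]
  cases X
  · simp
  · by_cases h : (i : ℕ) + 1 = n <;> simp [h]
  · by_cases h : (i : ℕ) = 0 <;> simp [h]

/-- The finite Weyl group permutes the letters and the translation part has integral coordinates. So
the values of the letters modulo ℤ are an invariant, up to permutation. -/
theorem eps_dotProduct_conj {g : Equiv.Perm (Amb X n)} (hg : g ∈ affWeyl X n) (v : Amb X n) :
    ∃ σ : Equiv.Perm (Letter X n), ∀ l, ∃ k : ℤ, eps l ⬝ᵥ g v = eps (σ l) ⬝ᵥ v + k := by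
  obtain ⟨w, hw, t, ht, e⟩ := affWeyl_decomp hg
  refine ⟨⟨act w⁻¹, act w, act_act_inv hw, act_inv_act hw⟩, fun l => ?_⟩
  have ht' : ∃ k : ℤ, eps l ⬝ᵥ t = k := by
    choose f hf using ht.1
    choose f' hf' using eps_apply_int l
    exact ⟨∑ j, f' j * f j, by simp [dotProduct, hf, hf']⟩
  obtain ⟨k, hk⟩ := ht'
  refine ⟨k, ?_⟩
  rw [e, dotProduct_add, hk]
  show _ = eps (act w⁻¹ l) ⬝ᵥ v + _
  rw [eps_act (inv_mem hw),
    weyl_dotProduct_left (inv_mem hw), inv_inv]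

/-- The letters on which a point takes integral values. -/
def integralLetters (v : Amb X n) : Finset (Letter X n) :=
  Finset.univ.filter fun l => ∃ k : ℤ, eps l ⬝ᵥ v = k

theorem card_integralLetters_conj {g : Equiv.Perm (Amb X n)} (hg : g ∈ affWeyl X n) (v : Amb X n) :
    (integralLetters (g v)).card = (integralLetters v).card := by
  obtain ⟨σ, hσ⟩ := eps_dotProduct_conj hg v
  refine Finset.card_bij (fun l _ => σ l) ?_ (fun _ _ _ _ h => σ.injective h) ?_
  · intro l hl
    simp only [integralLetters, Finset.mem_filter, Finset.mem_univ, true_and] at hl ⊢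
    obtain ⟨k, hk⟩ := hl
    obtain ⟨k', hk'⟩ := hσ l
    exact ⟨k - k', by push_cast; linarith⟩
  · intro m hm
    refine ⟨σ.symm m, ?_, σ.apply_symm_apply m⟩
    simp only [integralLetters, Finset.mem_filter, Finset.mem_univ, true_and] at hm ⊢
    obtain ⟨k, hk⟩ := hm
    obtain ⟨k', hk'⟩ := hσ (σ.symm m)
    rw [σ.apply_symm_apply, hk] at hk'
    exact ⟨k + k', by push_cast; linarith⟩

/-- The number of a vertex of the fundamental alcove. -/
def vertexIndex : Option (Fin n) → ℕ
  | none => 0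
  | some i => i + 1

theorem vertexIndex_injective : Function.Injective (vertexIndex (n := n)) := by
  rintro (_ | i) (_ | j) h <;> simp only [vertexIndex] at h
  · rfl
  · omega
  · omega
  · congr 1; ext; omega

/-- Apart from ω_1 in type C, the vertex number k takes the values 1/2 and -1/2 at the first k
letters and their bars, and 0 elsewhere. -/
theorem mem_integralLetters_alcoveVertex (hX : X ≠ A) (o : Option (Fin n)) (l : Letter X n) :
    l ∈ integralLetters (alcoveVertex X o) ↔
      (X = C ∧ vertexIndex o = 1) ∨ (vertexIndex o ≤ l ∧ l + vertexIndex o < 2 * n) := by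
  have hl := val_lt_of_ne hX l
  simp only [integralLetters, Finset.mem_filter, Finset.mem_univ, true_and]
  cases o with
  | none => 
    simp only [alcoveVertex, vertexIndex, dotProduct_zero]
    exact ⟨fun _ => .inr (by omega), fun _ => ⟨0, by simp⟩⟩
  | some i =>
    have hi := i.2
    simp only [alcoveVertex, vertexIndex]
    rw [eps_dotProduct_stepVec, if_neg hX, sub_zero]
    simp only [hX, or_false]
    by_cases h : X = C ∧ (i : ℕ) = 0
    · rw [if_pos h, one_mul]
      exact ⟨fun _ => .inl ⟨h.1, by omega⟩, fun _ => ⟨_, rfl⟩⟩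
    · rw [if_neg h]
      have h' : ¬(X = C ∧ (i : ℕ) + 1 = 1) := fun hh => h ⟨hh.1, by omega⟩
      simp only [h', false_or]
      rw [letterSign]
      simp only [ne_eq, hX, not_false_eq_true, true_and]
      have half : ∀ s : ℤ, s = 1 ∨ s = -1 → ¬∃ k : ℤ, (1 / 2 : ℝ) * s = k := by
        rintro s hs ⟨k, hk⟩
        have h1 : s = 2 * k := by
          have : (s : ℝ) = 2 * k := by linarith
          exact_mod_cast this
        omega
      split_ifs with h1 h2 h2
      · omega
      · exact ⟨fun hh => absurd hh (half _ (.inl rfl)), fun hh => by omega⟩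
      · exact ⟨fun hh => absurd hh (half _ (.inr rfl)), fun hh => by omega⟩
      · exact ⟨fun _ => by omega, fun _ => ⟨0, by simp⟩⟩

theorem sum_stepVec_zero (i : Fin n) (h : (i : ℕ) = 0) : ∑ j, (stepVec C i : Amb C n) j = 1 := by
  have h1 : (stepVec C i : Amb C n) = e C n 0 := by
    ext j
    simp only [stepVec, mult_eq, h, and_self, or_true, if_true, Nat.cast_one, inv_one, one_smul,
      fundCoweight, e, nonpos_iff_eq_zero]
  have := e_dotProduct (X := C) (n := n) (k := 0) (h ▸ i.2) 1
  rw [dotProduct_one] at this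
  rw [h1, this]; rfl

/-- In type A all letters take the value -k/(n+1) modulo ℤ at the vertex number k, which determines
k. In types B and C the number of letters with integral value is 2n - 2k, except that in type C it
is 2n for both 0 and ω_1. These two are told apart by the parity of the coordinate sum, as in type C
the elements of `latticeT` have even sum. -/
theorem alcoveVertex_conj {o o' : Option (Fin n)} {g : Equiv.Perm (Amb X n)}
    (hg : g ∈ affWeyl X n) (h : g (alcoveVertex X o) = alcoveVertex X o') : o = o' := by
  apply vertexIndex_injective
  by_cases hX : X = A
  · subst hX
    obtain ⟨σ, hσ⟩ := eps_dotProduct_conj hg (alcoveVertex A o)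
    rw [h] at hσ
    have hval : ∀ o : Option (Fin n), ∀ l : Letter A n, ∃ k : ℤ, eps l ⬝ᵥ alcoveVertex A o =
        k - (vertexIndex o : ℝ) / (n + 1) := by
      rintro (_ | i) l
      · exact ⟨0, by simp [alcoveVertex, vertexIndex]⟩
      · refine ⟨letterSign i l, ?_⟩
        rw [alcoveVertex, eps_dotProduct_stepVec]
        simp [vertexIndex]
    obtain ⟨k, hk⟩ := hσ (⟨0, by simp [alphabetSize]⟩ : Letter A n)
    obtain ⟨k1, hk1⟩ := hval o (σ ⟨0, by simp [alphabetSize]⟩)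
    obtain ⟨k2, hk2⟩ := hval o' ⟨0, by simp [alphabetSize]⟩
    rw [hk1, hk2] at hk
    have hle : ∀ o : Option (Fin n), vertexIndex o < n + 1 := by
      rintro (_ | i) <;> simp [vertexIndex]
    have h1 := hle o
    have h2 := hle o'
    have h0 : (0 : ℝ) < n + 1 := by positivity
    have h3 : ((vertexIndex o' : ℤ) : ℝ) - (vertexIndex o : ℤ) =
        ((k2 - k1 - k : ℤ) : ℝ) * ((n + 1 : ℤ) : ℝ) := by
      push_cast
      field_simp at hk
      linarith
    have h4 : (vertexIndex o' : ℤ) - vertexIndex o = (k2 - k1 - k) * (n + 1) := by exact_mod_cast h3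
    have h5 : k2 - k1 - k = 0 := by
      by_contra h5
      rcases lt_or_gt_of_ne h5 with h6 | h6
      · have : (k2 - k1 - k) * (n + 1 : ℤ) ≤ -1 * (n + 1) :=
          mul_le_mul_of_nonneg_right (by omega) (by omega)
        omega
      · have : 1 * (n + 1 : ℤ) ≤ (k2 - k1 - k) * (n + 1) :=
          mul_le_mul_of_nonneg_right (by omega) (by omega)
        omega
    rw [h5] at h4
    omega
  · have hN := alphabetSize_of_ne (n := n) hX
    have hle : ∀ o : Option (Fin n), vertexIndex o ≤ n := by
      rintro (_ | i)
      · simp [vertexIndex]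
      · have := i.2; simp only [vertexIndex]; omega
    have hcard := card_integralLetters_conj hg (alcoveVertex X o)
    rw [h] at hcard
    have hpar : X = C → ¬(vertexIndex o + vertexIndex o' = 1) := by
      rintro rfl h1
      obtain ⟨w, hw, t, ht, e⟩ := affWeyl_decomp hg
      obtain ⟨k, hk⟩ := ht.2 rfl
      have key : ∀ i : Fin n, (i : ℕ) = 0 → ∀ s ∈ latticeT C n, stepVec C i ≠ s := by
        rintro i hi s hs rfl
        obtain ⟨k, hk⟩ := hs.2 rfl
        rw [sum_stepVec_zero i hi] at hk
        have : (1 : ℤ) = 2 * k := by exact_mod_cast hk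
        omega
      rcases o with _ | i <;> rcases o' with _ | i' <;> simp only [vertexIndex] at h1
      · omega
      · rw [e, alcoveVertex, alcoveVertex, weyl_zero hw, zero_add] at h
        exact key i' (by omega) t ht h.symm
      · rw [e, alcoveVertex, alcoveVertex] at h
        have : stepVec C i = w⁻¹ (-t) := by
          rw [← eq_neg_of_add_eq_zero_left h, perm_inv_apply]
        exact key i (by omega) _ (weyl_mem_latticeT (inv_mem hw) (neg_mem ht)) this
      · omega
    have mono : ∀ o o' : Option (Fin n), vertexIndex o < vertexIndex o' →
        ¬(X = C ∧ vertexIndex o' = 1) →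
        (integralLetters (alcoveVertex X o')).card < (integralLetters (alcoveVertex X o)).card := by
      intro o o' hlt h1
      have h2 := hle o'
      refine Finset.card_lt_card (Finset.ssubset_iff_subset_ne.2 ⟨fun l hl => ?_, fun heq => ?_⟩)
      · rw [mem_integralLetters_alcoveVertex hX] at hl ⊢
        have := hl.resolve_left h1
        exact .inr (by omega)
      · have hm : (⟨vertexIndex o' - 1, by omega⟩ : Letter X n) ∈
            integralLetters (alcoveVertex X o) := by
          rw [mem_integralLetters_alcoveVertex hX]
          right; simp only; omega
        rw [← heq, mem_integralLetters_alcoveVertex hX] at hm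
        have := hm.resolve_left h1
        simp only at this
        omega
    rcases lt_trichotomy (vertexIndex o) (vertexIndex o') with h1 | h1 | h1
    · by_cases h2 : X = C ∧ vertexIndex o' = 1
      · exact absurd (show vertexIndex o + vertexIndex o' = 1 by omega) (hpar h2.1)
      · exact absurd hcard (mono o o' h1 h2).ne
    · exact h1
    · by_cases h2 : X = C ∧ vertexIndex o = 1
      · exact absurd (show vertexIndex o + vertexIndex o' = 1 by omega) (hpar h2.1)
      · exact absurd hcard (mono o' o h1 h2).ne'

/-! ### Types of vertices -/

/-- The point p with coordinate i equal to 0 and all others equal to a small r generates the facet.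
Any small vector annihilated by the simple root can be added to p without leaving the facet, so the
facet spans a hyperplane. -/
theorem simpleRoot_wall_mem_alcoveWalls (hn : 1 ≤ n) (i : Fin n) :
    (simpleRoot X n i, (0 : ℤ)) ∈ alcoveWalls X n := by
  have hM := mult_sum_pos X hn
  -- This choice makes the level of p at most 1/2.
  set r : ℝ := 1 / (2 * ∑ j : Fin n, (mult X j : ℝ)) with hr
  have hr0 : 0 < r := by positivity
  have hM1 : 1 ≤ ∑ j : Fin n, (mult X j : ℝ) := by
    have h1 : (1 : ℝ) ≤ mult X i := by exact_mod_cast mult_pos i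
    exact h1.trans (Finset.single_le_sum (f := fun j => (mult X j : ℝ)) (fun j _ => by positivity)
      (Finset.mem_univ i))
  have hrM : r * ∑ j : Fin n, (mult X j : ℝ) = 1 / 2 := by rw [hr]; field_simp
  have hr2 : r ≤ 1 / 2 := by nlinarith
  set p : Amb X n := ∑ j, (if j = i then 0 else r) • fundCoweight X n j with hp
  have hpa : p ∈ apartment X n := Submodule.sum_mem _ fun j _ =>
    Submodule.smul_mem _ _ (fundCoweight_mem_apartment j)
  have hpc : ∀ j, simpleRoot X n j ⬝ᵥ p = if j = i then 0 else r := fun j => by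
    simp only [hp, dotProduct_sum, dotProduct_smul, simpleRoot_dotProduct_fundCoweight, smul_eq_mul,
      mul_ite, mul_one, mul_zero, Finset.sum_ite_eq, Finset.mem_univ, if_true]
  have hpl : level p ≤ 1 / 2 := by
    rw [← hrM, Finset.mul_sum, level]
    refine Finset.sum_le_sum fun j _ => mul_le_mul_of_nonneg_right ?_ (by positivity)
    rw [hpc]
    split_ifs
    · exact hr0.le
    · exact le_rfl
  have hpΔ : p ∈ fundAlcove X n := by
    rw [mem_fundAlcove_iff hn]
    refine ⟨hpa, fun j => ?_, ?_⟩
    · rw [hpc]; split_ifs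
      · exact le_rfl
      · exact hr0.le
    · have : level p ≤ 1 := by linarith
      exact this
  refine ⟨.inl (simpleRoot_mem_posRoots i), ?_, ?_⟩
  · refine isFace_iff.2 ⟨p, hpa, ?_⟩
    ext x
    rw [mem_faceOf_iff_of_mem_fundAlcove hn hpΔ]
    constructor
    · rintro ⟨h1, h2⟩
      refine ⟨h1, fun j hj => ?_, fun h => by linarith⟩
      rw [hpc] at hj
      split_ifs at hj with h
      · have := h2.2
        rw [h]
        simpa using this
      · exact absurd hj hr0.ne'
    · rintro ⟨h1, h2, -⟩
      refine ⟨h1, h1.1, ?_⟩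
      rw [h2 i (by rw [hpc, if_pos rfl])]
      simp
  · set φ : apartment X n →ₗ[ℝ] ℝ := LinearMap.proj i ∘ₗ (coweightCoords X n).toLinearMap with hφ
    have hφe : ∀ x, φ x = simpleRoot X n i ⬝ᵥ (x : Amb X n) := fun x => rfl
    have hφ0 : φ ≠ 0 := by
      intro h
      have h1 := hφe ⟨_, fundCoweight_mem_apartment i⟩
      rw [h, simpleRoot_dotProduct_fundCoweight, if_pos rfl] at h1
      simp at h1
    have hspan : vectorSpan ℝ (fundAlcove X n ∩ wall (simpleRoot X n i) 0) =
        (LinearMap.ker φ).map (apartment X n).subtype := by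
      apply le_antisymm
      · rw [vectorSpan, Submodule.span_le]
        rintro _ ⟨x, hx, y, hy, rfl⟩
        refine ⟨⟨x - y, sub_mem hx.1.1 hy.1.1⟩, ?_, rfl⟩
        rw [SetLike.mem_coe, LinearMap.mem_ker, hφe, dotProduct_sub]
        have h1 := hx.2.2
        have h2 := hy.2.2
        linarith
      · rintro _ ⟨u, hu, rfl⟩
        rw [SetLike.mem_coe, LinearMap.mem_ker, hφe] at hu
        -- K bounds every coordinate and the level of u. Adding (r/K)u to p keeps the coordinates
        -- nonnegative and the level at most 1/2 + r ≤ 1.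
        set K : ℝ := 1 + ∑ j, |simpleRoot X n j ⬝ᵥ (u : Amb X n)| * mult X j with hK
        have hK0 : 0 ≤ ∑ j, |simpleRoot X n j ⬝ᵥ (u : Amb X n)| * mult X j :=
          Finset.sum_nonneg fun j _ => by positivity
        have hK1 : 0 < K := by linarith
        have hKj : ∀ j, |simpleRoot X n j ⬝ᵥ (u : Amb X n)| ≤ K := fun j => by
          have h1 : (1 : ℝ) ≤ mult X j := by exact_mod_cast mult_pos j
          have h2 := Finset.single_le_sum
            (f := fun j => |simpleRoot X n j ⬝ᵥ (u : Amb X n)| * mult X j)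
            (fun j _ => by positivity) (Finset.mem_univ j)
          have h3 : |simpleRoot X n j ⬝ᵥ (u : Amb X n)| * 1 ≤
              |simpleRoot X n j ⬝ᵥ (u : Amb X n)| * mult X j :=
            mul_le_mul_of_nonneg_left h1 (abs_nonneg _)
          linarith
        have hKl : |level (u : Amb X n)| ≤ K := by
          refine (Finset.abs_sum_le_sum_abs _ _).trans ?_
          have : ∀ j : Fin n, |(simpleRoot X n j ⬝ᵥ (u : Amb X n)) * mult X j| =
              |simpleRoot X n j ⬝ᵥ (u : Amb X n)| * mult X j := fun j => by
            rw [abs_mul, Nat.abs_cast]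
          simp only [this]
          linarith
        set δ : ℝ := r / K with hδ
        have hδ0 : 0 < δ := by positivity
        have hδK : δ * K = r := by rw [hδ]; field_simp
        have hmem : p + δ • (u : Amb X n) ∈ fundAlcove X n ∩ wall (simpleRoot X n i) 0 := by
          have ha : p + δ • (u : Amb X n) ∈ apartment X n :=
            add_mem hpa (Submodule.smul_mem _ _ u.2)
          refine ⟨(mem_fundAlcove_iff hn).2 ⟨ha, fun j => ?_, ?_⟩, ha, ?_⟩
          · rw [dotProduct_add, dotProduct_smul, hpc, smul_eq_mul]
            split_ifs with h
            · rw [h, hu]; simp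
            · have h1 := neg_abs_le (simpleRoot X n j ⬝ᵥ (u : Amb X n))
              have h2 := hKj j
              nlinarith
          · have h0 : level (p + δ • (u : Amb X n)) ≤ 1 := by
              rw [level_add, level_smul]
              have h1 := le_abs_self (level (u : Amb X n))
              nlinarith
            exact h0
          · rw [dotProduct_add, dotProduct_smul, hpc, hu]
            simp
        have hp' : p ∈ fundAlcove X n ∩ wall (simpleRoot X n i) 0 :=
          ⟨hpΔ, hpa, by rw [hpc]; simp⟩
        have h1 := Submodule.smul_mem _ δ⁻¹ (vsub_mem_vectorSpan ℝ hmem hp')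
        rw [vsub_eq_sub, add_sub_cancel_left, smul_smul, inv_mul_cancel₀ hδ0.ne', one_smul] at h1
        exact h1
    rw [faceDim, hspan, Submodule.finrank_map_subtype_eq]
    exact Module.Dual.finrank_ker_add_one_of_ne_zero hφ0

theorem faceType_image {g : Equiv.Perm (Amb X n)} (hg : g ∈ affWeyl X n) (F : Set (Amb X n)) :
    faceType (g '' F) = faceType F := by
  ext p
  refine and_congr_right fun _ => ⟨?_, ?_⟩
  · rintro ⟨w, hw, h⟩
    exact ⟨w * g, mul_mem hw hg, by rwa [Equiv.Perm.coe_mul, Set.image_comp]⟩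
  · rintro ⟨w, hw, h⟩
    refine ⟨w * g⁻¹, mul_mem hw (inv_mem hg), ?_⟩
    have : (w * g⁻¹ : Equiv.Perm (Amb X n)) '' (g '' F) = w '' F := by
      rw [← Set.image_comp, ← Equiv.Perm.coe_mul, inv_mul_cancel_right]
    rwa [this]

theorem exists_conj_alcoveVertex (hn : 1 ≤ n) {v : Amb X n} (hv : IsVertex v) :
    ∃ g ∈ affWeyl X n, ∃ o, g v = alcoveVertex X o := by
  obtain ⟨g, hg, h⟩ := exists_mem_fundAlcove hn (isVertex_iff.1 hv).1
  exact ⟨g, hg, eq_alcoveVertex hn ((isAut_of_mem_affWeyl hg).isVertex hv) h⟩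

theorem eq_of_conj_of_mem_fundAlcove (hn : 1 ≤ n) {v : Amb X n} (hv : IsVertex v)
    {g h : Equiv.Perm (Amb X n)} (hg : g ∈ affWeyl X n) (hh : h ∈ affWeyl X n)
    (hgv : g v ∈ fundAlcove X n) (hhv : h v ∈ fundAlcove X n) : g v = h v := by
  obtain ⟨o, ho⟩ := eq_alcoveVertex hn ((isAut_of_mem_affWeyl hg).isVertex hv) hgv
  obtain ⟨o', ho'⟩ := eq_alcoveVertex hn ((isAut_of_mem_affWeyl hh).isVertex hv) hhv
  have : (h * g⁻¹) (alcoveVertex X o) = alcoveVertex X o' := by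
    rw [Equiv.Perm.mul_apply, ← ho, perm_inv_apply, ho']
  rw [ho, ho', alcoveVertex_conj (mul_mem hh (inv_mem hg)) this]

theorem mem_faceType_iff (hn : 1 ≤ n) {v : Amb X n} (hv : IsVertex v) {g : Equiv.Perm (Amb X n)}
    (hg : g ∈ affWeyl X n) (hgv : g v ∈ fundAlcove X n) (i : Fin n) :
    (simpleRoot X n i, (0 : ℤ)) ∈ faceType {v} ↔ simpleRoot X n i ⬝ᵥ g v = 0 := by
  simp only [faceType, Set.image_singleton, Set.singleton_subset_iff]
  constructor
  · rintro ⟨-, w, hw, h1, h2⟩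
    rw [eq_of_conj_of_mem_fundAlcove hn hv hg hw hgv h1]
    simpa using h2.2
  · intro h
    exact ⟨simpleRoot_wall_mem_alcoveWalls hn i, g, hg, hgv, hgv.1, by simpa using h⟩

/-- The walls of the simple roots already distinguish the vertices: all of them contain 0, and all
but the i-th contain `stepVec X i`. -/
theorem exists_conj_of_faceType_eq (hn : 1 ≤ n) {v v' : Amb X n} (hv : IsVertex v)
    (hv' : IsVertex v') (h : faceType {v} = faceType {v'}) : ∃ g ∈ affWeyl X n, g v = v' := by
  obtain ⟨g, hg, o, ho⟩ := exists_conj_alcoveVertex hn hv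
  obtain ⟨g', hg', o', ho'⟩ := exists_conj_alcoveVertex hn hv'
  have key : ∀ i, simpleRoot X n i ⬝ᵥ alcoveVertex X o = 0 ↔
      simpleRoot X n i ⬝ᵥ alcoveVertex X o' = 0 := fun i => by
    rw [← ho, ← ho', ← mem_faceType_iff hn hv hg (by rw [ho]; exact alcoveVertex_mem hn o),
      ← mem_faceType_iff hn hv' hg' (by rw [ho']; exact alcoveVertex_mem hn o'), h]
  have hne : ∀ i : Fin n, (mult X i : ℝ)⁻¹ ≠ 0 := fun i => inv_ne_zero (mult_ne_zero i)
  have : o = o' := by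
    rcases o with _ | i <;> rcases o' with _ | i'
    · rfl
    · have := key i'
      simp [alcoveVertex, simpleRoot_dotProduct_stepVec] at this
      exact absurd this (mult_pos _).ne'
    · have := key i
      simp [alcoveVertex, simpleRoot_dotProduct_stepVec] at this
      exact absurd this (mult_pos _).ne'
    · have := key i
      simp only [alcoveVertex, simpleRoot_dotProduct_stepVec, if_true, hne, false_iff] at this
      split_ifs at this with h
      · rw [h]
      · exact absurd rfl this
  refine ⟨g'⁻¹ * g, mul_mem (inv_mem hg') hg, ?_⟩
  rw [Equiv.Perm.mul_apply, ho, this, ← ho', perm_inv_apply]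

/-! ### Edges -/

/-- `v` and `v'` are the end points of an edge. -/
def IsEdgePair (v v' : Amb X n) : Prop :=
  v ≠ v' ∧ IsVertex v ∧ IsVertex v' ∧ segment ℝ v v' = faceOf ((1 / 2 : ℝ) • (v + v'))

/-- Affine automorphisms of the arrangement of walls. -/
def IsAffAut (g : Equiv.Perm (Amb X n)) : Prop :=
  IsAut g ∧ ∃ (L : Amb X n →ₗ[ℝ] Amb X n) (t : Amb X n), ∀ x, g x = L x + t

theorem isAffAut_of_mem_affWeyl {g : Equiv.Perm (Amb X n)} (hg : g ∈ affWeyl X n) :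
    IsAffAut g := by
  obtain ⟨w, hw, t, -, h⟩ := affWeyl_decomp hg
  obtain ⟨L, hL⟩ := exists_linearMap_of_mem_weyl hw
  exact ⟨isAut_of_mem_affWeyl hg, L, t, fun x => by rw [h, hL]⟩

theorem isAffAut_trans {v : Amb X n} (hv : Integral v) : IsAffAut (trans v) :=
  ⟨isAut_trans hv, LinearMap.id, v, fun _ => rfl⟩

theorem isAffAut_neg : IsAffAut (Equiv.neg (Amb X n)) :=
  ⟨isAut_neg, -LinearMap.id, 0, fun x => by simp⟩

theorem IsAffAut.image_segment {g : Equiv.Perm (Amb X n)} (hg : IsAffAut g) (x y : Amb X n) :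
    g '' segment ℝ x y = segment ℝ (g x) (g y) := by
  obtain ⟨-, L, t, h⟩ := hg
  have e : (g : Amb X n → Amb X n) = (fun z => t + z) ∘ L.toAffineMap := by
    ext1 z
    rw [Function.comp_apply, h, add_comm]; rfl
  rw [e, Set.image_comp, _root_.image_segment, segment_translate_image]; rfl

theorem IsAffAut.map_midpoint {g : Equiv.Perm (Amb X n)} (hg : IsAffAut g) (x y : Amb X n) :
    g ((1 / 2 : ℝ) • (x + y)) = (1 / 2 : ℝ) • (g x + g y) := by
  obtain ⟨-, L, t, h⟩ := hg
  rw [h, h, h, map_smul, map_add]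
  module

theorem IsEdgePair.map {g : Equiv.Perm (Amb X n)} (hg : IsAffAut g) {v v' : Amb X n}
    (h : IsEdgePair v v') : IsEdgePair (g v) (g v') :=
  ⟨fun e => h.1 (g.injective e), hg.1.isVertex h.2.1, hg.1.isVertex h.2.2.1, by
    rw [← hg.image_segment, h.2.2.2, hg.1.image_faceOf, hg.map_midpoint]⟩

theorem IsEdgePair.symm {v v' : Amb X n} (h : IsEdgePair v v') : IsEdgePair v' v :=
  ⟨h.1.symm, h.2.2.1, h.2.1, by rw [segment_symm, h.2.2.2, add_comm]⟩

theorem isEdgePair_zero_stepVec (hn : 1 ≤ n) (i : Fin n) : IsEdgePair 0 (stepVec X i) := by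
  refine ⟨fun h => ?_, isVertex_alcoveVertex hn none, isVertex_alcoveVertex hn (some i), ?_⟩
  · have := level_stepVec (X := X) i
    rw [← h] at this
    simp [level] at this
  · rw [zero_add, faceOf_half_stepVec hn]

theorem vectorSpan_segment (x y : Amb X n) : vectorSpan ℝ (segment ℝ x y) = ℝ ∙ (y - x) := by
  rw [← convexHull_pair, ← direction_affineSpan, affineSpan_convexHull, direction_affineSpan,
    vectorSpan_pair_rev]
  rfl

theorem IsEdgePair.mem_apartment {v v' : Amb X n} (h : IsEdgePair v v') :
    (1 / 2 : ℝ) • (v + v') ∈ apartment X n :=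
  Submodule.smul_mem _ _ (add_mem (isVertex_iff.1 h.2.1).1 (isVertex_iff.1 h.2.2.1).1)

theorem IsEdgePair.isEdge {v v' : Amb X n} (h : IsEdgePair v v') : IsEdge (segment ℝ v v') := by
  refine ⟨isFace_iff.2 ⟨_, h.mem_apartment, h.2.2.2⟩, ?_⟩
  rw [faceDim, vectorSpan_segment]
  exact finrank_span_singleton (sub_ne_zero.2 h.1.symm)

/-- A point y generating the edge lies on the line through `v` and `v'`. An affine root nonnegative
at y is so at both ends, hence at the midpoint. If it were nonnegative at the midpoint but negative
at y, it would be nonpositive at both ends, so zero on the whole line, a contradiction. Hence y and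
the midpoint generate the same face. -/
theorem IsEdge.eq_segment {E : Set (Amb X n)} (hE : IsEdge E) {v v' : Amb X n}
    (h : IsEdgePair v v') (hv : v ∈ E) (hv' : v' ∈ E) : E = segment ℝ v v' := by
  obtain ⟨y, hy, rfl⟩ := isFace_iff.1 hE.1
  obtain ⟨r, hr⟩ : ∃ r : ℝ, r • (v' - v) = y - v := by
    have h1 : v' - v ∈ vectorSpan ℝ (faceOf y) := vsub_mem_vectorSpan ℝ hv' hv
    have h2 : y - v ∈ vectorSpan ℝ (faceOf y) := vsub_mem_vectorSpan ℝ (mem_faceOf_self hy) hv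
    have h3 : (⟨v' - v, h1⟩ : vectorSpan ℝ (faceOf y)) ≠ 0 := by
      intro h0
      exact sub_ne_zero.2 h.1.symm (congrArg Subtype.val h0)
    obtain ⟨r, hr⟩ := (finrank_eq_one_iff_of_nonzero' _ h3).1 hE.2 ⟨y - v, h2⟩
    exact ⟨r, congrArg Subtype.val hr⟩
  rw [h.2.2.2]
  ext x
  refine and_congr_right fun _ => forall₃_congr fun β hβ k => ?_
  have hmid : β ⬝ᵥ ((1 / 2 : ℝ) • (v + v')) + k =
      1 / 2 * ((β ⬝ᵥ v + k) + (β ⬝ᵥ v' + k)) := by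
    rw [dotProduct_smul, dotProduct_add, smul_eq_mul]; ring
  suffices 0 ≤ β ⬝ᵥ y + k ↔ 0 ≤ β ⬝ᵥ ((1 / 2 : ℝ) • (v + v')) + k by rw [this]
  rw [hmid]
  constructor
  · intro h0
    have h1 := hv.2 β hβ k h0
    have h2 := hv'.2 β hβ k h0
    linarith
  · intro h0
    by_contra h1
    have h2 := hv.2 (-β) (neg_mem_roots hβ) (-k)
    have h3 := hv'.2 (-β) (neg_mem_roots hβ) (-k)
    simp only [neg_dotProduct] at h2 h3
    push_cast at h2 h3
    have h4 := h2 (by linarith)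
    have h5 := h3 (by linarith)
    have h6 : β ⬝ᵥ y = β ⬝ᵥ v + r * (β ⬝ᵥ v' - β ⬝ᵥ v) := by
      rw [← dotProduct_sub, ← smul_eq_mul, ← dotProduct_smul, hr, dotProduct_sub]; ring
    have h7 : β ⬝ᵥ v' - β ⬝ᵥ v = 0 := by linarith
    rw [h7] at h6
    linarith

/-- Both edges are moved into the fundamental alcove. There a vertex is determined by its orbit, so
the end points coincide, and `IsEdge.eq_segment` identifies the edges. -/
theorem exists_conj_edge (hn : 1 ≤ n) {v v' V V' : Amb X n} (h : IsEdgePair v v')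
    {E : Set (Amb X n)} (hE : IsEdge E) (hV : IsVertex V) (hV' : IsVertex V') (hVE : V ∈ E)
    (hVE' : V' ∈ E) (ht : faceType {v} = faceType {V}) (ht' : faceType {v'} = faceType {V'}) :
    ∃ w ∈ affWeyl X n, w v = V ∧ w v' = V' ∧ E = segment ℝ V V' := by
  obtain ⟨g, hg, rfl⟩ := exists_conj_of_faceType_eq hn h.2.1 hV ht
  obtain ⟨g', hg', rfl⟩ := exists_conj_of_faceType_eq hn h.2.2.1 hV' ht'
  have sub : ∀ y : Amb X n, y ∈ fundAlcove X n → faceOf y ⊆ fundAlcove X n := fun y hy x hx =>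
    ((mem_faceOf_iff_of_mem_fundAlcove hn hy).1 hx).1
  obtain ⟨k, hk, hkm⟩ := exists_mem_fundAlcove hn h.mem_apartment
  have hks : k '' segment ℝ v v' ⊆ fundAlcove X n := by
    rw [h.2.2.2, (isAut_of_mem_affWeyl hk).image_faceOf]
    exact sub _ hkm
  obtain ⟨y, hy, rfl⟩ := isFace_iff.1 hE.1
  obtain ⟨l, hl, hlm⟩ := exists_mem_fundAlcove hn hy
  have hls : l '' faceOf y ⊆ fundAlcove X n := by
    rw [(isAut_of_mem_affWeyl hl).image_faceOf]
    exact sub _ hlm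
  have e1 : (l * g) v = k v := eq_of_conj_of_mem_fundAlcove hn h.2.1 (mul_mem hl hg) hk
    (hls ⟨_, hVE, rfl⟩) (hks ⟨_, left_mem_segment ℝ v v', rfl⟩)
  have e2 : (l * g') v' = k v' := eq_of_conj_of_mem_fundAlcove hn h.2.2.1 (mul_mem hl hg') hk
    (hls ⟨_, hVE', rfl⟩) (hks ⟨_, right_mem_segment ℝ v v', rfl⟩)
  have hw := mul_mem (inv_mem hl) hk
  have e3 : (l⁻¹ * k) v = g v := by
    rw [Equiv.Perm.mul_apply, ← e1, Equiv.Perm.mul_apply, perm_inv_apply]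
  have e4 : (l⁻¹ * k) v' = g' v' := by
    rw [Equiv.Perm.mul_apply, ← e2, Equiv.Perm.mul_apply, perm_inv_apply]
  refine ⟨l⁻¹ * k, hw, e3, e4, ?_⟩
  have := h.map (isAffAut_of_mem_affWeyl hw)
  rw [e3, e4] at this
  exact hE.eq_segment this hVE hVE'

/-! ### Lattice translations -/

variable (X n) in
/-- The vectors whose translations belong to the affine Weyl group. -/
def affTranslations : AddSubgroup (Amb X n) where
  carrier := {t | trans t ∈ affWeyl X n}
  zero_mem' := by
    rw [Set.mem_ofPred_eq, trans_zero]
    exact one_mem _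
  add_mem' := fun {s t} hs ht => by
    rw [Set.mem_ofPred_eq, trans_add]
    exact mul_mem ht hs
  neg_mem' := fun {s} hs => by
    rw [Set.mem_ofPred_eq, ← trans_inv]
    exact inv_mem hs

theorem eps_mem_affTranslations (a : Letter B n) : (eps a : Amb B n) ∈ affTranslations B n := by
  have hn : a ≠ a.rev := fun h => by
    have h1 : Opp a a := ⟨by simp, h⟩
    exact h1.ne rfl
  have := trans_coroot_mem_affWeyl (letters_mem_roots hn)
  rwa [coroot_eq hn, if_pos ⟨⟨by simp, rfl⟩, rfl⟩] at this

theorem eps_sub_eps_mem_affTranslations (a b : Letter X n) :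
    eps a - eps b ∈ affTranslations X n := by
  by_cases hab : a = b
  · rw [hab, sub_self]; exact zero_mem _
  by_cases hX : X = B
  · subst hX
    exact sub_mem (eps_mem_affTranslations a) (eps_mem_affTranslations b)
  · have := trans_coroot_mem_affWeyl (letters_mem_roots hab)
    rwa [coroot_eq hab, if_neg (fun h => hX h.2)] at this

/-- Write t as a combination of differences of coordinate vectors plus its coordinate sum times one
coordinate vector ε. In type B each ε is a coroot. In type C the sum is even and 2ε is a coroot. -/
theorem trans_mem_affWeyl (hn : 1 ≤ n) (hX : X ≠ A) {t : Amb X n} (ht : t ∈ latticeT X n) :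
    trans t ∈ affWeyl X n := by
  have hd := dim_of_ne (n := n) hX
  obtain ⟨l₀, -, hl₀⟩ := exists_eps_eq_e (X := X) (n := n) ⟨0, by omega⟩
  choose f hf using ht.1
  have e1 : t = ∑ j, f j • (e X n j - eps l₀) + (∑ j, f j) • eps l₀ := by
    conv_lhs => rw [eq_sum_smul_e t]
    simp only [smul_sub, Finset.sum_sub_distrib, Finset.sum_smul, sub_add_cancel]
    exact Finset.sum_congr rfl fun j _ => by rw [hf, Int.cast_smul_eq_zsmul]
  suffices t ∈ affTranslations X n from this
  rw [e1]
  refine add_mem (sum_mem fun j _ => zsmul_mem ?_ _) ?_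
  · obtain ⟨l, -, hl⟩ := exists_eps_eq_e j
    rw [← hl]
    exact eps_sub_eps_mem_affTranslations l l₀
  · cases X with
    | A => exact absurd rfl hX
    | B => exact zsmul_mem (eps_mem_affTranslations l₀) _
    | C =>
      obtain ⟨m, hm⟩ := ht.2 rfl
      have h1 : ∑ j, f j = m * 2 := by
        have : ((∑ j, f j : ℤ) : ℝ) = ((m * 2 : ℤ) : ℝ) := by
          push_cast
          simp only [← hf]
          rw [hm, mul_comm]
        exact_mod_cast this
      have h2 : (2 : ℤ) • eps l₀ = eps l₀ - eps l₀.rev := by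
        rw [eps_eq_neg_of_opp (⟨by simp, rfl⟩ : Opp l₀ l₀.rev), sub_neg_eq_add, two_smul]
      rw [h1, mul_smul, h2]
      exact zsmul_mem (eps_sub_eps_mem_affTranslations _ _) _

/-- The vector v - w v is the translation part of the conjugate of w by the translation by v, which
lies in the affine Weyl group by integrality of v. -/
theorem affWeyl_apply_sub_mem_latticeT {v : Amb X n} (hv : Integral v)
    {g : Equiv.Perm (Amb X n)} (hg : g ∈ affWeyl X n) : g v - v ∈ latticeT X n := by
  obtain ⟨w, hw, t, ht, h⟩ := affWeyl_decomp hg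
  obtain ⟨w', hw', t', ht', h'⟩ := affWeyl_decomp (trans_conj_mem_affWeyl hv hw)
  have h0 := h' 0
  rw [weyl_zero hw', trans_inv, Equiv.Perm.mul_apply, Equiv.Perm.mul_apply, trans_apply,
    trans_apply, zero_add, zero_add, ← zero_sub, weyl_sub hw, weyl_zero hw] at h0
  have : g v - v = t - t' := by rw [h, ← h0]; abel
  rw [this]
  exact sub_mem ht ht'

/-! ### Integral points and steps -/

theorem integral_fundCoweight (i : Fin n) : Integral (fundCoweight X n i) := by
  have key : ∀ β ∈ posRoots X n, ∃ k : ℤ, β ⬝ᵥ fundCoweight X n i = k := fun β hβ => by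
    obtain ⟨k, -, hk⟩ := posRoot_dotProduct_fundCoweight hβ i
    exact ⟨k, by rw [hk]; simp⟩
  refine ⟨fundCoweight_mem_apartment i, fun β hβ => ?_⟩
  rcases hβ with h | h
  · exact key β h
  · obtain ⟨k, hk⟩ := key _ h
    rw [neg_dotProduct] at hk
    exact ⟨-k, by push_cast; linarith⟩

theorem Integral.isVertex (hn : 1 ≤ n) {v : Amb X n} (hv : Integral v) : IsVertex v := by
  have := (isAut_trans hv).isVertex (isVertex_alcoveVertex hn none)
  rwa [trans_apply, alcoveVertex, zero_add] at this

theorem Integral.isSpecial (hn : 1 ≤ n) {v : Amb X n} (hv : Integral v) : IsSpecial v := by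
  refine ⟨hv.isVertex hn, fun β hβ => ?_⟩
  obtain ⟨k, hk⟩ := hv.2 β hβ
  exact ⟨-k, hv.1, by rw [hk]; push_cast; ring⟩

theorem fundCoweight_of_mult_one {i : Fin n} (h : mult X i = 1) :
    fundCoweight X n i = stepVec X i := by
  rw [stepVec, h]; simp

theorem fundCoweight_of_mult_two {i : Fin n} (h : mult X i = 2) :
    fundCoweight X n i = stepVec X i + stepVec X i := by
  rw [stepVec, h]; push_cast; module

theorem mult_eq_one_or_two (i : Fin n) : mult X i = 1 ∨ mult X i = 2 := by
  unfold mult; split_ifs <;> simp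

theorem ne_A_of_mult_two {i : Fin n} (h : mult X i = 2) : X ≠ A := by
  rintro rfl
  simp [mult, Minuscule] at h

theorem Integral.isEdgePair (hn : 1 ≤ n) {u : Amb X n} (hu : Integral u) (i : Fin n) :
    IsEdgePair u (u + stepVec X i) := by
  have := (isEdgePair_zero_stepVec hn i).map (isAffAut_trans hu)
  rwa [trans_apply, trans_apply, zero_add, add_comm] at this

theorem Integral.isEdgePair_second (hn : 1 ≤ n) {u : Amb X n} (hu : Integral u) {i : Fin n}
    (h : mult X i = 2) :
    IsEdgePair (u + stepVec X i) (u + stepVec X i + stepVec X i) := by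
  have h1 := (isEdgePair_zero_stepVec (X := X) hn i).map isAffAut_neg
  have h2 := (h1.map (isAffAut_trans (hu.add (integral_fundCoweight i)))).symm
  simp only [trans_apply, Equiv.neg_apply, fundCoweight_of_mult_two h] at h2
  convert h2 using 1 <;> abel

/-- Only the linear part of w acts on s. Conversely, any linear part can be achieved by following
`g` with an element that fixes the integral point V. -/
theorem conj_step_iff {u V s V' : Amb X n} (hu : Integral u) {g : Equiv.Perm (Amb X n)}
    (hg : g ∈ affWeyl X n) (hgu : g u = V) :
    (∃ w ∈ affWeyl X n, w u = V ∧ w (u + s) = V') ↔ ∃ σ ∈ weyl X n, V' = V + σ s := by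
  constructor
  · rintro ⟨w, hw, rfl, rfl⟩
    obtain ⟨σ, hσ, t, -, h⟩ := affWeyl_decomp hw
    exact ⟨σ, hσ, by rw [h, h, weyl_add hσ]; abel⟩
  · rintro ⟨σ, hσ, rfl⟩
    obtain ⟨τ, hτ, t, -, h⟩ := affWeyl_decomp hg
    have hV : Integral V := hgu ▸ (isAut_of_mem_affWeyl hg).1.integral hu
    have hστ := mul_mem hσ (inv_mem hτ)
    have key : ∀ x, (trans V * (σ * τ⁻¹) * (trans V)⁻¹ * g) x = V + σ (x - u) := fun x => by
      have : g x - V = τ (x - u) := by rw [← hgu, h, h, weyl_sub hτ]; abel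
      simp only [trans_inv, Equiv.Perm.mul_apply, trans_apply]
      rw [← sub_eq_add_neg, this, perm_inv_apply, add_comm]
    refine ⟨_, mul_mem (trans_conj_mem_affWeyl hV hστ) hg, ?_, ?_⟩
    · rw [key, sub_self, weyl_zero hσ, add_zero]
    · rw [key, add_sub_cancel_left]

/-- The middle vertex V + d need not be integral, so not all linear parts are available there. An
element with linear part σ taking u + s to V + d takes u to V + d - σ s, and this point, being
conjugate to V, is a lattice translate of V. Conversely, the element supplied by `conj_step_iff` is
translated by d - σ s. -/
theorem conj_second_step_iff (hn : 1 ≤ n) (hX : X ≠ A) {u V s d V'' : Amb X n} (hu : Integral u)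
    {g : Equiv.Perm (Amb X n)} (hg : g ∈ affWeyl X n) (hgu : g u = V) :
    (∃ w ∈ affWeyl X n, w (u + s) = V + d ∧ w (u + s + s) = V'') ↔
      ∃ σ ∈ weyl X n, V'' = V + d + σ s ∧ d - σ s ∈ latticeT X n := by
  constructor
  · rintro ⟨w, hw, h1, rfl⟩
    obtain ⟨σ, hσ, t, -, h⟩ := affWeyl_decomp hw
    refine ⟨σ, hσ, ?_, ?_⟩
    · rw [← h1, h, h, weyl_add hσ (u + s)]; abel
    · have hV : Integral V := hgu ▸ (isAut_of_mem_affWeyl hg).1.integral hu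
      have h2 := affWeyl_apply_sub_mem_latticeT hV (mul_mem hw (inv_mem hg))
      rw [Equiv.Perm.mul_apply, ← hgu, perm_inv_apply, hgu] at h2
      have h3 : d - σ s = w u - V := by
        rw [← add_sub_cancel_left V d, ← h1, h, h, weyl_add hσ]; abel
      rwa [h3]
  · rintro ⟨σ, hσ, rfl, hT⟩
    obtain ⟨w, hw, h1, h2⟩ := (conj_step_iff (s := s) hu hg hgu).2 ⟨σ, hσ, rfl⟩
    obtain ⟨τ, hτ, t, -, h⟩ := affWeyl_decomp hw
    have h3 : w (u + s + s) = V + σ s + σ s := by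
      have h4 : τ s = σ s := by
        rw [h, weyl_add hτ, add_right_comm, ← h, h1] at h2
        exact add_left_cancel h2
      rw [h, weyl_add hτ (u + s), add_right_comm, ← h, h2, h4]
    refine ⟨trans (d - σ s) * w, mul_mem (trans_mem_affWeyl hn hX hT) hw, ?_, ?_⟩
    · rw [Equiv.Perm.mul_apply, h2, trans_apply]; abel
    · rw [Equiv.Perm.mul_apply, h3, trans_apply]; abel

/-- The type of the edge is redundant: by `exists_conj_edge` the types of its ends suffice. -/
theorem edge_step_iff (hn : 1 ≤ n) {u u' V V' : Amb X n} {E : Set (Amb X n)}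
    (hp : IsEdgePair u u') (hV : IsVertex V) (ht : faceType {u} = faceType {V}) :
    ((IsEdge E ∧ V ∈ E ∧ V' ∈ E ∧ IsVertex V') ∧ faceType E = faceType (segment ℝ u u') ∧
      faceType {V'} = faceType {u'}) ↔
    E = segment ℝ V V' ∧ ∃ w ∈ affWeyl X n, w u = V ∧ w u' = V' := by
  constructor
  · rintro ⟨⟨hE, h1, h2, hV'⟩, -, h4⟩
    obtain ⟨w, hw, e1, e2, e3⟩ := exists_conj_edge hn hp hE hV hV' h1 h2 ht h4.symm
    exact ⟨e3, w, hw, e1, e2⟩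
  · rintro ⟨rfl, w, hw, rfl, rfl⟩
    have h := hp.map (isAffAut_of_mem_affWeyl hw)
    refine ⟨⟨h.isEdge, left_mem_segment ℝ _ _, right_mem_segment ℝ _ _, h.2.2.1⟩, ?_, ?_⟩
    · rw [← (isAffAut_of_mem_affWeyl hw).image_segment, faceType_image hw]
    · rw [← Set.image_singleton, faceType_image hw]

/-! ### Galleries as sequences of steps -/

/-- The edges and vertices passed when walking from `x` along the given steps. -/
def pathSteps : Amb X n → List (Amb X n) → List (Set (Amb X n) × Amb X n)
  | _, [] => []
  | x, d :: ds => (segment ℝ x (x + d), x + d) :: pathSteps (x + d) ds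

theorem pathSteps_append (x : Amb X n) (ds ds' : List (Amb X n)) :
    pathSteps x (ds ++ ds') = pathSteps x ds ++ pathSteps (x + ds.sum) ds' := by
  induction ds generalizing x with
  | nil => simp [pathSteps]
  | cons d ds ih => simp [pathSteps, ih, add_assoc]

theorem length_pathSteps (x : Amb X n) (ds : List (Amb X n)) :
    (pathSteps x ds).length = ds.length := by
  induction ds generalizing x with
  | nil => rfl
  | cons d ds ih => simp [pathSteps, ih]

theorem map_pathSteps (x t : Amb X n) (ds : List (Amb X n)) :
    (pathSteps x ds).map (fun p => ((fun x => x + t) '' p.1, p.2 + t)) = pathSteps (x + t) ds := by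
  induction ds generalizing x with
  | nil => rfl
  | cons d ds ih =>
    have h : (fun z => z + t) '' segment ℝ x (x + d) = segment ℝ (x + t) (x + d + t) := by
      simp only [add_comm _ t]
      exact segment_translate_image ℝ t x (x + d)
    simp only [pathSteps, List.map_cons, ih, h, add_right_comm]

theorem V_mk_zero (x : Amb X n) (s : List (Set (Amb X n) × Amb X n)) :
    Gallery.V ⟨x, s⟩ 0 = x := rfl

theorem V_pathSteps (x : Amb X n) (ds : List (Amb X n)) {k : ℕ} (hk : k ≤ ds.length) :
    Gallery.V ⟨x, pathSteps x ds⟩ k = x + (ds.take k).sum := by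
  induction ds generalizing x k with
  | nil =>
    obtain rfl : k = 0 := by simpa using hk
    simp [V_mk_zero]
  | cons d ds ih =>
    cases k with
    | zero => simp [V_mk_zero]
    | succ k =>
      have := ih (x + d) (k := k) (by simpa using hk)
      rw [List.take_succ_cons, List.sum_cons, ← add_assoc, ← this]
      rfl

theorem E_pathSteps (x : Amb X n) (ds : List (Amb X n)) {k : ℕ} (hk : k < ds.length) :
    Gallery.E ⟨x, pathSteps x ds⟩ k =
      segment ℝ (x + (ds.take k).sum) (x + (ds.take k).sum + ds[k]) := by
  induction ds generalizing x k with
  | nil => simp at hk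
  | cons d ds ih =>
    cases k with
    | zero => simp [Gallery.E, pathSteps]
    | succ k =>
      have := ih (x + d) (k := k) (by simpa using hk)
      rw [List.take_succ_cons, List.sum_cons, List.getElem_cons_succ, ← add_assoc, ← this]
      rfl

theorem target_pathSteps (x : Amb X n) (ds : List (Amb X n)) :
    Gallery.target ⟨x, pathSteps x ds⟩ = x + ds.sum := by
  rw [Gallery.target, Gallery.size, V_pathSteps _ _ (length_pathSteps x ds).le, length_pathSteps,
    List.take_length]

theorem concat_pathSteps (x y : Amb X n) (ds ds' : List (Amb X n)) :
    Gallery.concat ⟨x, pathSteps x ds⟩ ⟨y, pathSteps y ds'⟩ = ⟨x, pathSteps x (ds ++ ds')⟩ := by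
  rw [Gallery.concat, target_pathSteps, map_pathSteps, pathSteps_append, add_sub_cancel]

/-- Replace every block `i` by its `mult X i` steps. -/
def expand (X : ClassicalType) {n : ℕ} (L : List (Fin n)) : List (Fin n) :=
  L.flatMap fun i => List.replicate (mult X i) i

theorem expand_cons (i : Fin n) (L : List (Fin n)) :
    expand X (i :: L) = List.replicate (mult X i) i ++ expand X L := rfl

/-- The sequence of the fundamental coweights of a dominant coweight. -/
def blocks {n : ℕ} (a : Fin n → ℕ) : List (Fin n) :=
  (List.finRange n).flatMap fun i => List.replicate (a i) i

theorem fundGallery_eq (i : Fin n) :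
    fundGallery X n i = ⟨0, pathSteps 0 ((List.replicate (mult X i) i).map (stepVec X))⟩ := by
  rw [fundGallery]
  congr 1
  by_cases h : Minuscule X i
  · have hm : mult X i = 1 := if_pos h
    rw [if_pos h, hm]
    simp [pathSteps, fundCoweight_of_mult_one hm]
  · have hm : mult X i = 2 := if_neg h
    have h2 : (1 / 2 : ℝ) • fundCoweight X n i = stepVec X i := by
      rw [stepVec, hm]; norm_num
    rw [if_neg h, h2, hm, fundCoweight_of_mult_two hm]
    simp [pathSteps, List.replicate]

theorem stdGallery_eq (a : Fin n → ℕ) :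
    stdGallery X n a = ⟨0, pathSteps 0 ((expand X (blocks a)).map (stepVec X))⟩ := by
  have h1 : ((List.finRange n).flatMap fun i => List.replicate (a i) (fundGallery X n i)) =
      (blocks a).map (fundGallery X n) := by
    rw [blocks, List.map_flatMap]
    simp only [List.map_replicate]
  have h2 : ∀ (L : List (Fin n)) (ds : List (Amb X n)),
      (L.map (fundGallery X n)).foldl Gallery.concat ⟨0, pathSteps 0 ds⟩ =
        ⟨0, pathSteps 0 (ds ++ (expand X L).map (stepVec X))⟩ := by
    intro L
    induction L with
    | nil => intro ds; simp [expand]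
    | cons i L ih =>
      intro ds
      rw [List.map_cons, List.foldl_cons, fundGallery_eq, concat_pathSteps, ih, expand_cons,
        List.map_append, List.append_assoc]
  rw [stdGallery, h1]
  exact h2 (blocks a) []

/-- Every edge of the list, starting from the vertex `v`, contains its two vertices. -/
def IsPath : Amb X n → List (Set (Amb X n) × Amb X n) → Prop
  | _, [] => True
  | v, p :: s => (IsEdge p.1 ∧ v ∈ p.1 ∧ p.2 ∈ p.1 ∧ IsVertex p.2) ∧ IsPath p.2 s

theorem isPath_iff (v : Amb X n) (s : List (Set (Amb X n) × Amb X n)) :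
    ((∀ k ≤ s.length, IsVertex (Gallery.V ⟨v, s⟩ k)) ∧ ∀ k < s.length,
      IsEdge (Gallery.E ⟨v, s⟩ k) ∧ Gallery.V ⟨v, s⟩ k ∈ Gallery.E ⟨v, s⟩ k ∧
        Gallery.V ⟨v, s⟩ (k + 1) ∈ Gallery.E ⟨v, s⟩ k) ↔ IsVertex v ∧ IsPath v s := by
  induction s generalizing v with
  | nil =>
    simp only [List.length_nil, Nat.le_zero, forall_eq, V_mk_zero, Nat.not_lt_zero,
      IsPath, false_imp_iff, implies_true]
  | cons p s ih =>
    have h := ih p.2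
    constructor
    · rintro ⟨h1, h2⟩
      have h3 := h.1 ⟨fun k hk => h1 (k + 1) (by simpa using hk),
        fun k hk => h2 (k + 1) (by simpa using hk)⟩
      have h4 := h2 0 (by simp)
      exact ⟨h1 0 (by simp), ⟨h4.1, h4.2.1, h4.2.2, h3.1⟩, h3.2⟩
    · rintro ⟨h1, ⟨h2, h3, h4, h5⟩, h6⟩
      have h7 := h.2 ⟨h5, h6⟩
      refine ⟨fun k hk => ?_, fun k hk => ?_⟩
      · cases k with
        | zero => exact h1
        | succ k => exact h7.1 k (by simpa using hk)
      · cases k with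
        | zero => exact ⟨h2, h3, h4⟩
        | succ k => exact h7.2 k (by simpa using hk)

/-- The conjugates of `stepVec X i` under the Weyl group. -/
def IsStep (i : Fin n) (d : Amb X n) : Prop := ∃ σ ∈ weyl X n, d = σ (stepVec X i)

/-- The sequences of steps of the galleries of a given type. -/
def StepsOK : List (Fin n) → List (Amb X n) → Prop
  | [], ds => ds = []
  | i :: L, ds =>
      (mult X i = 1 ∧ ∃ d ds', ds = d :: ds' ∧ IsStep i d ∧ StepsOK L ds') ∨
      (mult X i = 2 ∧ ∃ d d' ds', ds = d :: d' :: ds' ∧ IsStep i d ∧ IsStep i d' ∧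
        d - d' ∈ latticeT X n ∧ StepsOK L ds')

/-- The types of the faces of a gallery after its source. -/
def stepTypes (s : List (Set (Amb X n) × Amb X n)) :
    List (Set (Amb X n × ℤ) × Set (Amb X n × ℤ)) :=
  s.map fun p => (faceType p.1, faceType {p.2})

theorem isPath_cons_iff (hn : 1 ≤ n) {u u' V : Amb X n} (hp : IsEdgePair u u') (hV : IsVertex V)
    (ht : faceType {u} = faceType {V}) (s : List (Set (Amb X n) × Amb X n))
    (r : List (Set (Amb X n) × Amb X n)) :
    IsPath V s ∧ stepTypes s = stepTypes ((segment ℝ u u', u') :: r) ↔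
      ∃ V' s', s = (segment ℝ V V', V') :: s' ∧ (∃ w ∈ affWeyl X n, w u = V ∧ w u' = V') ∧
        IsPath V' s' ∧ stepTypes s' = stepTypes r := by
  cases s with
  | nil => simp [stepTypes]
  | cons p s =>
    obtain ⟨E, V'⟩ := p
    have key := edge_step_iff hn (E := E) (V' := V') hp hV ht
    simp only [IsPath, stepTypes, List.map_cons, List.cons.injEq, Prod.mk.injEq]
    constructor
    · rintro ⟨⟨h1, h2⟩, h3, h4⟩
      obtain ⟨rfl, h5⟩ := key.1 ⟨h1, h3⟩
      exact ⟨V', s, ⟨⟨rfl, rfl⟩, rfl⟩, h5, h2, h4⟩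
    · rintro ⟨V'', s', ⟨⟨rfl, rfl⟩, rfl⟩, h5, h2, h4⟩
      obtain ⟨h1, h3⟩ := key.2 ⟨rfl, h5⟩
      exact ⟨⟨h1, h2⟩, h3, h4⟩

/-- After each complete block the model vertex is integral again and conjugate to the vertex
reached, so the induction restarts there. The second edge of a block is compared with the integral
vertex where the block starts. -/
theorem path_iff_steps (hn : 1 ≤ n) (L : List (Fin n)) {u V : Amb X n} (hu : Integral u)
    {g : Equiv.Perm (Amb X n)} (hg : g ∈ affWeyl X n) (hgu : g u = V)
    (s : List (Set (Amb X n) × Amb X n)) :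
    (IsPath V s ∧ stepTypes s = stepTypes (pathSteps u ((expand X L).map (stepVec X)))) ↔
      ∃ ds, StepsOK L ds ∧ s = pathSteps V ds := by
  induction L generalizing u V g s with
  | nil =>
    simp only [expand, List.flatMap_nil, List.map_nil, pathSteps, StepsOK, exists_eq_left]
    constructor
    · rintro ⟨-, h⟩
      simpa [stepTypes] using h
    · rintro rfl
      exact ⟨trivial, rfl⟩
  | cons i L ih =>
    have hV : IsVertex V := hgu ▸ (isAut_of_mem_affWeyl hg).isVertex (hu.isVertex hn)
    have ht : faceType {u} = faceType {V} := by
      rw [← hgu, ← Set.image_singleton, faceType_image hg]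
    have huω := hu.add (integral_fundCoweight (X := X) i)
    rw [expand_cons, List.map_append]
    rcases mult_eq_one_or_two (X := X) i with hm | hm
    · rw [fundCoweight_of_mult_one hm] at huω
      rw [hm, List.replicate_one, List.map_singleton, List.singleton_append, pathSteps,
        isPath_cons_iff hn (hu.isEdgePair hn i) hV ht]
      constructor
      · rintro ⟨V', s', rfl, ⟨w, hw, h1, h2⟩, h3⟩
        obtain ⟨σ, hσ, h4⟩ := (conj_step_iff hu hg hgu).1 ⟨w, hw, h1, h2⟩
        obtain ⟨ds, h5, rfl⟩ := (ih huω hw h2 s').1 h3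
        refine ⟨_ :: ds, .inl ⟨hm, _, ds, rfl, ⟨σ, hσ, rfl⟩, h5⟩, ?_⟩
        rw [pathSteps, ← h4]
      · rintro ⟨ds, h | h, rfl⟩
        · obtain ⟨-, d, ds, rfl, ⟨σ, hσ, rfl⟩, h5⟩ := h
          obtain ⟨w, hw, h1, h2⟩ := (conj_step_iff hu hg hgu).2 ⟨σ, hσ, rfl⟩
          exact ⟨_, _, rfl, ⟨w, hw, h1, h2⟩, (ih huω hw h2 _).2 ⟨ds, h5, rfl⟩⟩
        · omega
    · rw [fundCoweight_of_mult_two hm, ← add_assoc] at huω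
      have hX := ne_A_of_mult_two hm
      rw [hm, show List.replicate 2 i = [i, i] from rfl, List.map_cons, List.map_singleton,
        List.cons_append, List.singleton_append, pathSteps, pathSteps,
        isPath_cons_iff hn (hu.isEdgePair hn i) hV ht]
      have hV2 : ∀ {w : Equiv.Perm (Amb X n)} {V' : Amb X n}, w ∈ affWeyl X n →
          w (u + stepVec X i) = V' →
          IsVertex V' ∧ faceType {u + stepVec X i} = faceType {V'} := by
        rintro w V' hw rfl
        refine ⟨(isAut_of_mem_affWeyl hw).isVertex (hu.isEdgePair hn i).2.2.1, ?_⟩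
        have := faceType_image hw {u + stepVec X i}
        rw [Set.image_singleton] at this
        exact this.symm
      constructor
      · rintro ⟨V', s', rfl, ⟨w, hw, h1, h2⟩, h3⟩
        obtain ⟨σ, hσ, rfl⟩ := (conj_step_iff hu hg hgu).1 ⟨w, hw, h1, h2⟩
        rw [isPath_cons_iff hn (hu.isEdgePair_second hn hm) (hV2 hw h2).1 (hV2 hw h2).2] at h3
        obtain ⟨V'', s'', rfl, ⟨w', hw', h1', h2'⟩, h3'⟩ := h3
        obtain ⟨σ', hσ', h4, h5⟩ := (conj_second_step_iff hn hX hu hg hgu).1 ⟨w', hw', h1', h2'⟩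
        obtain ⟨ds, h6, rfl⟩ := (ih huω hw' h2' s'').1 h3'
        refine ⟨_ :: _ :: ds, .inr ⟨hm, _, _, ds, rfl, ⟨σ, hσ, rfl⟩, ⟨σ', hσ', rfl⟩, h5, h6⟩, ?_⟩
        rw [pathSteps, pathSteps, ← h4]
      · rintro ⟨ds, h | h, rfl⟩
        · omega
        · obtain ⟨-, d, d', ds, rfl, ⟨σ, hσ, rfl⟩, ⟨σ', hσ', rfl⟩, h5, h6⟩ := h
          obtain ⟨w, hw, h1, h2⟩ := (conj_step_iff hu hg hgu).2 ⟨σ, hσ, rfl⟩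
          obtain ⟨w', hw', h1', h2'⟩ := (conj_second_step_iff hn hX hu hg hgu).2
            ⟨σ', hσ', rfl, h5⟩
          refine ⟨_, _, rfl, ⟨w, hw, h1, h2⟩, ?_⟩
          rw [isPath_cons_iff hn (hu.isEdgePair_second hn hm) (hV2 hw h2).1 (hV2 hw h2).2]
          exact ⟨_, _, rfl, ⟨w', hw', h1', h2'⟩, (ih huω hw' h2' _).2 ⟨ds, h6, rfl⟩⟩

theorem StepsOK.integral (hn : 1 ≤ n) {L : List (Fin n)} {ds : List (Amb X n)}
    (h : StepsOK L ds) {V : Amb X n} (hV : Integral V) : Integral (V + ds.sum) := by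
  induction L generalizing V ds with
  | nil =>
    rw [show ds = [] from h]
    simpa using hV
  | cons i L ih =>
    rcases h with ⟨hm, d, ds, rfl, ⟨σ, hσ, rfl⟩, h⟩ |
      ⟨hm, d, d', ds, rfl, ⟨σ, hσ, rfl⟩, ⟨σ', hσ', rfl⟩, hT, h⟩
    · have h1 := hV.add ((isAut_of_mem_affWeyl (weyl_le_affWeyl hσ)).1.integral
        (integral_fundCoweight (X := X) i))
      rw [fundCoweight_of_mult_one hm] at h1
      simpa [add_assoc] using ih h h1
    · obtain ⟨w, hw, -, h2⟩ := (conj_second_step_iff (s := stepVec X i) hn (ne_A_of_mult_two hm) hV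
        (one_mem (affWeyl X n)) rfl).2 ⟨σ', hσ', rfl, hT⟩
      have h1 := (isAut_of_mem_affWeyl hw).1.integral (hV.add (integral_fundCoweight (X := X) i))
      rw [fundCoweight_of_mult_two hm, ← add_assoc, h2] at h1
      simpa [add_assoc] using ih h h1

/-- The requirement that the ends be special is no restriction: the origin is integral, and so is
the target by `StepsOK.integral`. -/
theorem mem_galleries_iff (hn : 1 ≤ n) (a : Fin n → ℕ) (γ : Gallery X n) :
    γ ∈ galleries X n a ↔ ∃ ds, StepsOK (blocks a) ds ∧ γ = ⟨0, pathSteps 0 ds⟩ := by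
  obtain ⟨v, s⟩ := γ
  have h0 := integral_zero (X := X) (n := n)
  have key := path_iff_steps hn (blocks a) h0 (one_mem (affWeyl X n)) rfl s
  constructor
  · rintro ⟨⟨-, -, h1, h2⟩, rfl, h4⟩
    rw [stdGallery_eq] at h4
    obtain ⟨ds, h5, rfl⟩ := key.1 ⟨((isPath_iff _ _).1 ⟨h1, h2⟩).2, congrArg Prod.snd h4⟩
    exact ⟨ds, h5, rfl⟩
  · rintro ⟨ds, h, e⟩
    obtain ⟨rfl, rfl⟩ := Gallery.mk.inj e
    obtain ⟨h1, h2⟩ := key.2 ⟨ds, h, rfl⟩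
    have h3 := (isPath_iff _ _).2 ⟨h0.isVertex hn, h1⟩
    refine ⟨⟨h0.isSpecial hn, ?_, h3.1, h3.2⟩, rfl, ?_⟩
    · rw [target_pathSteps]
      exact (h.integral hn h0).isSpecial hn
    · rw [stdGallery_eq]
      exact Prod.ext rfl h2

/-! ### Steps and columns -/

/-- Sets of letters that may occur as a column of length `i + 1`. -/
def IsColumn (i : Fin n) (c : Finset (Letter X n)) : Prop :=
  c.card = i + 1 ∧ ∀ a ∈ c, ∀ b ∈ c, ¬Opp a b

/-- The common absolute value of the coordinates of a step. -/
def stepScale (X : ClassicalType) {n : ℕ} (i : Fin n) : ℝ :=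
  if X = C ∧ (i : ℕ) = 0 ∨ X = A then 1 else 1 / 2

theorem stepScale_pos (i : Fin n) : 0 < stepScale X i := by
  unfold stepScale; split_ifs <;> norm_num

theorem stepScale_of_mult_two {i : Fin n} (hm : mult X i = 2) : stepScale X i = 1 / 2 := by
  rw [stepScale, if_neg]
  intro h
  rw [mult_eq, if_pos (by tauto)] at hm
  omega

/-- The step belonging to a column of length `i + 1`. -/
def dirOf (i : Fin n) (c : Finset (Letter X n)) : Amb X n :=
  stepScale X i • ∑ l ∈ c, eps l - (if X = A then ((i : ℝ) + 1) / (n + 1) else 0) • 1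

theorem eps_dotProduct_one (hX : X = A) (l : Letter X n) : eps l ⬝ᵥ (1 : Amb X n) = 1 := by
  rw [eps_of_lt (.inl hX), e_dotProduct (val_lt_dim (.inl hX))]; rfl

theorem eps_dotProduct_dirOf {i : Fin n} {c : Finset (Letter X n)} (l : Letter X n) :
    eps l ⬝ᵥ dirOf i c = stepScale X i *
      ((if l ∈ c then 1 else 0) - (if ∃ m ∈ c, Opp l m then 1 else 0)) -
        (if X = A then ((i : ℝ) + 1) / (n + 1) else 0) := by
  have h1 : eps l ⬝ᵥ ∑ m ∈ c, eps m =
      (if l ∈ c then 1 else 0) - (if ∃ m ∈ c, Opp l m then 1 else 0) := by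
    have h2 : ∀ m : Letter X n, eps l ⬝ᵥ eps m =
        (if l = m then (1 : ℝ) else 0) - (if Opp l m then 1 else 0) := fun m => by
      rw [eps_dotProduct_eps]
      by_cases h : l = m
      · have : ¬Opp l m := fun h' => h'.ne h
        rw [if_pos h, if_pos h, if_neg this, sub_zero]
      · rw [if_neg h, if_neg h, zero_sub]
        split_ifs <;> simp
    rw [dotProduct_sum, Finset.sum_congr rfl fun m _ => h2 m, Finset.sum_sub_distrib,
      Finset.sum_ite_eq]
    congr 1
    split_ifs with h
    · obtain ⟨m, hm, hlm⟩ := h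
      rw [Finset.sum_eq_single_of_mem m hm fun b _ hb => if_neg fun h' => hb (h'.right_unique hlm),
        if_pos hlm]
    · exact Finset.sum_eq_zero fun m hm => if_neg fun h' => h ⟨m, hm, h'⟩
  rw [dirOf, dotProduct_sub, dotProduct_smul, dotProduct_smul, h1, smul_eq_mul, smul_eq_mul]
  congr 1
  by_cases hX : X = A
  · rw [eps_dotProduct_one hX, mul_one]
  · rw [if_neg hX, zero_mul]

theorem ext_eps {x y : Amb X n} (h : ∀ l : Letter X n, eps l ⬝ᵥ x = eps l ⬝ᵥ y) : x = y := by
  ext j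
  obtain ⟨l, -, hl⟩ := exists_eps_eq_e j
  have := h l
  rwa [hl, e_dotProduct j.2, e_dotProduct j.2] at this

theorem not_opp_of_A (hX : X = A) (a b : Letter X n) : ¬Opp a b := fun h => h.1 hX

theorem stepVec_eq_dirOf (i : Fin n) :
    stepVec X i = dirOf i (Finset.univ.filter fun l : Letter X n => (l : ℕ) ≤ i) := by
  refine ext_eps fun l => ?_
  rw [eps_dotProduct_stepVec, eps_dotProduct_dirOf, letterSign, stepScale]
  congr 2
  push_cast
  congr 1
  · simp
  · have hi := i.2
    have : (X ≠ A ∧ 2 * n ≤ (l : ℕ) + i + 1) ↔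
        ∃ m ∈ Finset.univ.filter (fun l : Letter X n => (l : ℕ) ≤ i), Opp l m := by
      simp only [Finset.mem_filter, Finset.mem_univ, true_and, opp_iff]
      constructor
      · rintro ⟨hX, h⟩
        have := val_lt_of_ne hX l
        refine ⟨⟨2 * n - 1 - l, ?_⟩, ?_, hX, ?_⟩
        · have := lt_alphabetSize (X := X) (k := 2 * n - 1 - l) i (by omega)
          exact this
        · show 2 * n - 1 - (l : ℕ) ≤ i
          omega
        · show (l : ℕ) + (2 * n - 1 - l) + 1 = 2 * n
          omega
      · rintro ⟨m, hm, hX, h⟩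
        exact ⟨hX, by omega⟩
    by_cases h : X ≠ A ∧ 2 * n ≤ (l : ℕ) + i + 1
    · rw [if_pos h, if_pos (this.1 h)]
    · rw [if_neg h, if_neg (fun h' => h (this.2 h'))]

theorem weyl_dirOf {w : Equiv.Perm (Amb X n)} (hw : w ∈ weyl X n) (i : Fin n)
    (c : Finset (Letter X n)) : w (dirOf i c) = dirOf i (c.image (act w)) := by
  refine ext_eps fun l => ?_
  rw [dotProduct_comm, weyl_dotProduct_left hw, ← eps_act (inv_mem hw), dotProduct_comm,
    eps_dotProduct_dirOf, eps_dotProduct_dirOf]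
  have h1 : act w⁻¹ l ∈ c ↔ l ∈ c.image (act w) := by
    rw [Finset.mem_image]
    constructor
    · exact fun h => ⟨_, h, act_act_inv hw l⟩
    · rintro ⟨m, hm, rfl⟩
      rwa [act_inv_act hw]
  have h2 : (∃ m ∈ c, Opp (act w⁻¹ l) m) ↔ ∃ m ∈ c.image (act w), Opp l m := by
    rw [Finset.exists_mem_image]
    refine exists_congr fun m => and_congr_right fun _ => ?_
    rw [← opp_act_iff hw, act_act_inv hw]
  simp only [h1, h2]

/-- In type A the projection subtracts (i+1)/(n+1), a number strictly between 0 and 1, so the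
members of the column are still exactly the letters with positive value. Otherwise the values off
the column are 0 or negative. -/
theorem IsColumn.letters_dirOf {i : Fin n} {c : Finset (Letter X n)} (hc : IsColumn i c) :
    letters (dirOf i c) = c := by
  ext l
  have hi : ((i : ℕ) : ℝ) < n := by exact_mod_cast i.2
  have hs := stepScale_pos (X := X) i
  rw [letters, Finset.mem_filter, eps_dotProduct_dirOf]
  simp only [Finset.mem_univ, true_and]
  by_cases hX : X = A
  · have h1 : ((i : ℝ) + 1) / (n + 1) < 1 := by rw [div_lt_one (by positivity)]; linarith
    have h2 : 0 < ((i : ℝ) + 1) / (n + 1) := by positivity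
    have h3 : stepScale X i = 1 := if_pos (.inr hX)
    simp only [if_pos hX, h3, not_opp_of_A hX, and_false, exists_false, if_false]
    by_cases h : l ∈ c
    · simp only [h, if_true, iff_true]; linarith
    · simp only [h, if_false, iff_false, not_lt]; linarith
  · simp only [if_neg hX, sub_zero]
    by_cases h : l ∈ c
    · have h1 : ¬∃ m ∈ c, Opp l m := fun ⟨m, hm, h'⟩ => hc.2 l h m hm h'
      simp only [h, h1, if_true, if_false, iff_true]; linarith
    · simp only [h, if_false, iff_false, not_lt]
      split_ifs <;> linarith

theorem isColumn_initial (i : Fin n) :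
    IsColumn i (Finset.univ.filter fun l : Letter X n => (l : ℕ) ≤ i) := by
  have hi := i.2
  have hle := le_alphabetSize X n
  constructor
  · have : (Finset.univ.filter fun l : Letter X n => (l : ℕ) ≤ i) =
        Finset.Iic (⟨i, by omega⟩ : Letter X n) := by
      ext l; simp [Fin.le_def]
    rw [this, Fin.card_Iic]
  · simp only [Finset.mem_filter, Finset.mem_univ, true_and, opp_iff]
    rintro a ha b hb ⟨-, h⟩
    omega

theorem IsColumn.image_act {i : Fin n} {c : Finset (Letter X n)} (hc : IsColumn i c)
    {w : Equiv.Perm (Amb X n)} (hw : w ∈ weyl X n) : IsColumn i (c.image (act w)) := by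
  refine ⟨by rw [Finset.card_image_of_injective _ (act_injective hw), hc.1], ?_⟩
  simp only [Finset.mem_image]
  rintro _ ⟨a, ha, rfl⟩ _ ⟨b, hb, rfl⟩ h
  exact hc.2 a ha b hb ((opp_act_iff hw).1 h)

theorem IsColumn.exists_act {i : Fin n} {c : Finset (Letter X n)} (hc : IsColumn i c) :
    ∃ w ∈ weyl X n, (Finset.univ.filter fun l : Letter X n => (l : ℕ) ≤ i).image (act w) = c := by
  have hp : (i : ℕ) + 1 ≤ n := i.2
  obtain ⟨w, hw, h⟩ := exists_weyl_eq_column hp (c.orderEmbOfFin hc.1).strictMono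
    (fun j k => hc.2 _ (Finset.orderEmbOfFin_mem c hc.1 j) _ (Finset.orderEmbOfFin_mem c hc.1 k))
  refine ⟨w, hw, Finset.eq_of_subset_of_card_le ?_ ?_⟩
  · rw [Finset.image_subset_iff]
    intro l hl
    have hl' : (l : ℕ) ≤ i := (Finset.mem_filter.1 hl).2
    have := h ⟨l, by omega⟩
    rw [show firstLetters X hp ⟨l, by omega⟩ = l from rfl] at this
    rw [this]
    exact Finset.orderEmbOfFin_mem c hc.1 _
  · rw [((isColumn_initial i).image_act hw).1, hc.1]

/-- The dominant step belongs to the column of the first letters, and W acts transitively on columns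
of a given length. -/
theorem isStep_iff (i : Fin n) (d : Amb X n) :
    IsStep i d ↔ ∃ c, IsColumn i c ∧ d = dirOf i c := by
  constructor
  · rintro ⟨σ, hσ, rfl⟩
    exact ⟨_, (isColumn_initial i).image_act hσ, by rw [stepVec_eq_dirOf, weyl_dirOf hσ]⟩
  · rintro ⟨c, hc, rfl⟩
    obtain ⟨w, hw, h⟩ := hc.exists_act
    exact ⟨w, hw, by rw [stepVec_eq_dirOf, weyl_dirOf hw, h]⟩

theorem IsStep.isColumn_letters {i : Fin n} {d : Amb X n} (h : IsStep i d) :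
    IsColumn i (letters d) := by
  obtain ⟨c, hc, rfl⟩ := (isStep_iff i d).1 h
  rwa [hc.letters_dirOf]

theorem IsStep.dirOf_letters {i : Fin n} {d : Amb X n} (h : IsStep i d) :
    dirOf i (letters d) = d := by
  obtain ⟨c, hc, rfl⟩ := (isStep_iff i d).1 h
  rw [hc.letters_dirOf]

theorem opp_rev (hX : X ≠ A) (l : Letter X n) : Opp l l.rev := ⟨hX, rfl⟩

/-- In a two-step block the letters have coefficient 1/2, so barring `l` changes the direction by
exactly `eps l`. -/
theorem dirOf_sub_dirOf_exchange (hX : X ≠ A) {i : Fin n} (hm : mult X i = 2)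
    {c S : Finset (Letter X n)} (hc : IsColumn i c) (hS : S ⊆ c) :
    dirOf i c - dirOf i (exchange c S) = ∑ l ∈ S, eps l := by
  have hs := stepScale_of_mult_two hm
  have hdisj : Disjoint (c \ S) (S.image Fin.rev) := by
    rw [Finset.disjoint_left]
    intro l hl hl'
    obtain ⟨m, hm, rfl⟩ := Finset.mem_image.1 hl'
    exact hc.2 m (hS hm) _ (Finset.mem_sdiff.1 hl).1 (opp_rev hX m)
  have h1 : ∑ l ∈ exchange c S, (eps l : Amb X n) = ∑ l ∈ c, eps l - (2 : ℝ) • ∑ l ∈ S, eps l := by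
    rw [exchange, Finset.sum_union hdisj, Finset.sum_image fun a _ b _ h => Fin.rev_injective h,
      ← Finset.sum_sdiff hS]
    have : ∑ l ∈ S, (eps l.rev : Amb X n) = -∑ l ∈ S, eps l := by
      rw [← Finset.sum_neg_distrib]
      exact Finset.sum_congr rfl fun l _ => eps_eq_neg_of_opp (opp_rev hX l)
    rw [this]
    module
  rw [dirOf, dirOf, h1, hs]
  module

theorem sum_sum_eps (S : Finset (Letter X n)) :
    ∃ k : ℤ, ∑ j, (∑ l ∈ S, eps l : Amb X n) j = S.card + 2 * k := by
  simp only [Finset.sum_apply]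
  rw [Finset.sum_comm]
  induction S using Finset.induction_on with
  | empty => exact ⟨0, by simp⟩
  | insert a S ha ih =>
    obtain ⟨k, hk⟩ := ih
    rw [Finset.sum_insert ha, hk, Finset.card_insert_of_notMem ha]
    rcases sum_eps a with h | h <;> rw [h]
    · exact ⟨k, by push_cast; ring⟩
    · exact ⟨k - 1, by push_cast; ring⟩

/-- Each `eps l` has coordinate sum 1 or -1, so the parity of the coordinate sum is that of the
cardinality of `S`. -/
theorem sum_eps_mem_latticeT_iff (S : Finset (Letter X n)) :
    ∑ l ∈ S, eps l ∈ latticeT X n ↔ (X = C → Even S.card) := by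
  obtain ⟨k, hk⟩ := sum_sum_eps S
  constructor
  · rintro ⟨-, h⟩ hX
    obtain ⟨k', hk'⟩ := h hX
    rw [hk] at hk'
    have : (S.card : ℤ) = 2 * (k' - k) := by
      have h1 : (S.card : ℝ) = ((2 * (k' - k) : ℤ) : ℝ) := by push_cast; linarith
      exact_mod_cast h1
    rw [← Int.even_coe_nat, this]
    exact even_two_mul _
  · intro h
    refine ⟨fun j => ?_, fun hX => ?_⟩
    · choose f hf using fun a : Letter X n => eps_apply_int a j
      exact ⟨∑ l ∈ S, f l, by simp [Finset.sum_apply, hf]⟩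
    · obtain ⟨m, hm⟩ := h hX
      exact ⟨m + k, by rw [hk, hm]; push_cast; ring⟩

theorem mem_exchange {c S : Finset (Letter X n)} {l : Letter X n} :
    l ∈ exchange c S ↔ l ∈ c ∧ l ∉ S ∨ l.rev ∈ S := by
  rw [exchange, Finset.mem_union, Finset.mem_sdiff, Finset.mem_image]
  refine or_congr_right ⟨?_, fun h => ⟨_, h, Fin.rev_rev l⟩⟩
  rintro ⟨m, hm, rfl⟩
  rwa [Fin.rev_rev]

/-- The coordinates of both directions are 0, 1/2 or -1/2. Integrality of the difference forces the
same support, so the columns differ only by bars. The difference is then a sum of letter vectors,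
and the parity condition in type C is that of `sum_eps_mem_latticeT_iff`. -/
theorem dirOf_sub_mem_latticeT_iff {i : Fin n} (hm : mult X i = 2) {c c' : Finset (Letter X n)}
    (hc : IsColumn i c) (hc' : IsColumn i c') :
    dirOf i c - dirOf i c' ∈ latticeT X n ↔
      ∃ S ⊆ c, (X = C → Even S.card) ∧ c' = exchange c S := by
  have hX := ne_A_of_mult_two hm
  constructor
  · intro h
    have hsub : ∀ d d' : Finset (Letter X n), IsColumn i d → dirOf i d - dirOf i d' ∈ latticeT X n →
        ∀ l ∈ d, l ∈ d' ∨ l.rev ∈ d' := by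
      intro d d' hd h l hl
      by_contra! hl'
      have hs := stepScale_of_mult_two hm
      have h1 : ∃ k : ℤ, eps l ⬝ᵥ (dirOf i d - dirOf i d') = k := by
        choose f hf using h.1
        choose f' hf' using eps_apply_int l
        exact ⟨∑ j, f' j * f j, by simp only [dotProduct, hf, hf']; push_cast; rfl⟩
      obtain ⟨k, hk⟩ := h1
      have h2 : ¬∃ m ∈ d, Opp l m := fun ⟨m, hm, h'⟩ => hd.2 l hl m hm h'
      have h3 : ¬∃ m ∈ d', Opp l m := fun ⟨m, hm, h'⟩ => hl'.2 (h'.2 ▸ hm)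
      rw [dotProduct_sub, eps_dotProduct_dirOf, eps_dotProduct_dirOf, if_pos hl, if_neg hl'.1,
        if_neg h2, if_neg h3, hs] at hk
      have h4 : ((1 : ℤ) : ℝ) = ((2 * k : ℤ) : ℝ) := by push_cast; linarith
      have h5 : (1 : ℤ) = 2 * k := by exact_mod_cast h4
      omega
    have h' : dirOf i c' - dirOf i c ∈ latticeT X n := by
      rw [← neg_sub]; exact neg_mem h
    have e1 : c' = exchange c (c.filter fun l => l.rev ∈ c') := by
      ext l
      rw [mem_exchange, Finset.mem_filter, Finset.mem_filter, Fin.rev_rev]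
      constructor
      · intro hl
        rcases hsub c' c hc' h' l hl with h1 | h1
        · exact .inl ⟨h1, fun h2 => hc'.2 l hl _ h2.2 (opp_rev hX l)⟩
        · exact .inr ⟨h1, hl⟩
      · rintro (⟨h1, h2⟩ | h1)
        · exact (hsub c c' hc h l h1).resolve_right fun h3 => h2 ⟨h1, h3⟩
        · exact h1.2
    refine ⟨_, Finset.filter_subset _ _, ?_, e1⟩
    rwa [← sum_eps_mem_latticeT_iff, ← dirOf_sub_dirOf_exchange hX hm hc (Finset.filter_subset _ _),
      ← e1]
  · rintro ⟨S, hS, h, rfl⟩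
    rwa [dirOf_sub_dirOf_exchange hX hm hc hS, sum_eps_mem_latticeT_iff]

/-! ### Positions of the steps -/

/-- The positions of the first steps of the blocks with two steps satisfy `P`. -/
def PairCond (X : ClassicalType) {n : ℕ} : List (Fin n) → (ℕ → Prop) → Prop
  | [], _ => True
  | i :: L, P => (mult X i = 2 → P 0) ∧ PairCond X L fun k => P (k + mult X i)

theorem pairCond_append (L L' : List (Fin n)) (P : ℕ → Prop) :
    PairCond X (L ++ L') P ↔
      PairCond X L P ∧ PairCond X L' fun k => P (k + (expand X L).length) := by
  induction L generalizing P with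
  | nil => simp [PairCond, expand]
  | cons i L ih =>
    rw [List.cons_append, PairCond, PairCond, ih, and_assoc, expand_cons, List.length_append,
      List.length_replicate]
    simp only [add_assoc, add_comm (mult X i)]

theorem pairCond_of_mult_one {L : List (Fin n)} (hL : ∀ i ∈ L, mult X i = 1) (P : ℕ → Prop) :
    PairCond X L P ∧ (expand X L).length = L.length := by
  induction L generalizing P with
  | nil => simp [PairCond, expand]
  | cons i L ih =>
    have h1 := hL i (by simp)
    obtain ⟨h2, h3⟩ := ih (fun j hj => hL j (by simp [hj])) fun k => P (k + mult X i)
    refine ⟨⟨by omega, h2⟩, ?_⟩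
    rw [expand_cons, List.length_append, h3, List.length_replicate, h1, List.length_cons, add_comm]

theorem pairCond_of_mult_two {L : List (Fin n)} (hL : ∀ i ∈ L, mult X i = 2) (P : ℕ → Prop) :
    PairCond X L P ↔ ∀ j < L.length, P (2 * j) := by
  induction L generalizing P with
  | nil => simp [PairCond]
  | cons i L ih =>
    have h1 := hL i (by simp)
    rw [PairCond, ih fun j hj => hL j (by simp [hj]), h1, List.length_cons]
    simp only [true_imp_iff, Nat.forall_lt_succ_left, mul_zero, mul_add, mul_one]

theorem length_blocks_list (l : List (Fin n)) (a : Fin n → ℕ) :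
    (l.flatMap fun i => List.replicate (a i) i).length = (l.map a).sum := by
  simp [List.length_flatMap]

theorem pairCond_blocks_A (a : Fin n → ℕ) (P : ℕ → Prop) : PairCond A (blocks a) P :=
  (pairCond_of_mult_one (fun i _ => by simp [mult, Minuscule]) P).1

/-- Only the last coweight is minuscule, so the two-step blocks come first and start at the even
positions. -/
theorem pairCond_blocks_B (a : Fin n → ℕ) (P : ℕ → Prop) :
    PairCond B (blocks a) P ↔
      ∀ q ∈ Finset.Icc 1 (∑ i ∈ Finset.univ.filter (fun i : Fin n => (i : ℕ) + 1 < n), a i),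
        P (2 * (q - 1)) := by
  cases n with
  | zero => simp [blocks, PairCond]
  | succ m =>
    have h1 : ∀ i ∈ ((List.finRange m).map Fin.castSucc).flatMap
        (fun i => List.replicate (a i) i), mult B i = 2 := by
      intro i hi
      obtain ⟨j, hj, hi⟩ := List.mem_flatMap.1 hi
      obtain ⟨k, -, rfl⟩ := List.mem_map.1 hj
      rw [(List.mem_replicate.1 hi).2]
      have := k.2
      exact if_neg (fun h : (k : ℕ) + 1 = m + 1 => by omega)
    have h2 : ∀ i ∈ [Fin.last m].flatMap (fun i => List.replicate (a i) i), mult B i = 1 := by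
      intro i hi
      obtain ⟨j, hj, hi⟩ := List.mem_flatMap.1 hi
      rw [(List.mem_replicate.1 hi).2, List.mem_singleton.1 hj]
      simp [mult, Minuscule]
    have h3 : ∑ i ∈ Finset.univ.filter (fun i : Fin (m + 1) => (i : ℕ) + 1 < m + 1), a i =
        (((List.finRange m).map Fin.castSucc).map a).sum := by
      rw [Finset.sum_filter, Fin.sum_univ_castSucc, List.map_map, ← List.ofFn_eq_map, List.sum_ofFn]
      simp
    rw [blocks, List.finRange_succ_last, List.flatMap_append, pairCond_append,
      and_iff_left (pairCond_of_mult_one h2 _).1, pairCond_of_mult_two h1, length_blocks_list, h3]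
    constructor
    · intro h q hq
      rw [Finset.mem_Icc] at hq
      exact h (q - 1) (by omega)
    · intro h j hj
      exact h (j + 1) (Finset.mem_Icc.2 ⟨by omega, by omega⟩)

/-- Only the first coweight is minuscule, so its one-step blocks come first and shift the two-step
blocks by the number of copies of ω_1. -/
theorem pairCond_blocks_C (a : Fin n → ℕ) (P : ℕ → Prop) :
    PairCond C (blocks a) P ↔
      ∀ q ∈ Finset.Icc 1 (∑ i ∈ Finset.univ.filter (fun i : Fin n => 0 < (i : ℕ)), a i),
        P (∑ i ∈ Finset.univ.filter (fun i : Fin n => (i : ℕ) = 0), a i + 2 * (q - 1)) := by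
  cases n with
  | zero => simp [blocks, PairCond]
  | succ m =>
    have h1 : ∀ i ∈ ((List.finRange m).map Fin.succ).flatMap
        (fun i => List.replicate (a i) i), mult C i = 2 := by
      intro i hi
      obtain ⟨j, hj, hi⟩ := List.mem_flatMap.1 hi
      obtain ⟨k, -, rfl⟩ := List.mem_map.1 hj
      rw [(List.mem_replicate.1 hi).2]
      simp [mult, Minuscule]
    have h2 : ∀ i ∈ List.replicate (a 0) (0 : Fin (m + 1)), mult C i = 1 := by
      intro i hi
      rw [(List.mem_replicate.1 hi).2]
      simp [mult, Minuscule]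
    have h3 : ∑ i ∈ Finset.univ.filter (fun i : Fin (m + 1) => 0 < (i : ℕ)), a i =
        (((List.finRange m).map Fin.succ).map a).sum := by
      rw [Finset.sum_filter, Fin.sum_univ_succ, List.map_map, ← List.ofFn_eq_map, List.sum_ofFn]
      simp
    have h4 : ∑ i ∈ Finset.univ.filter (fun i : Fin (m + 1) => (i : ℕ) = 0), a i = a 0 := by
      rw [Finset.sum_filter, Fin.sum_univ_succ]
      simp
    rw [blocks, List.finRange_succ, List.flatMap_cons, pairCond_append,
      and_iff_right (pairCond_of_mult_one h2 _).1, (pairCond_of_mult_one h2 P).2,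
      pairCond_of_mult_two h1, length_blocks_list, h3, h4, List.length_replicate]
    constructor
    · intro h q hq
      rw [Finset.mem_Icc] at hq
      rw [add_comm]
      exact h (q - 1) (by omega)
    · intro h j hj
      rw [add_comm]
      exact h (j + 1) (Finset.mem_Icc.2 ⟨by omega, by omega⟩)

theorem stepsOK_iff (L : List (Fin n)) (ds : List (Amb X n)) :
    StepsOK L ds ↔ List.Forall₂ IsStep (expand X L) ds ∧
      PairCond X L fun k => ds.getD k 0 - ds.getD (k + 1) 0 ∈ latticeT X n := by
  induction L generalizing ds with
  | nil => simp [StepsOK, PairCond, expand]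
  | cons i L ih =>
    rw [StepsOK, PairCond, expand_cons]
    rcases mult_eq_one_or_two (X := X) i with hm | hm
    · simp only [hm, ih, List.replicate_one, List.singleton_append, List.forall₂_cons_left_iff]
      constructor
      · rintro (⟨-, d, ds', rfl, h1, h2, h3⟩ | h)
        · exact ⟨⟨d, ds', h1, h2, rfl⟩, by omega, h3⟩
        · omega
      · rintro ⟨⟨d, ds', h1, h2, rfl⟩, -, h3⟩
        exact .inl ⟨trivial, d, ds', rfl, h1, h2, h3⟩
    · simp only [hm, ih, show List.replicate 2 i = [i, i] from rfl, List.cons_append,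
        List.nil_append, List.forall₂_cons_left_iff]
      constructor
      · rintro (h | ⟨-, d, d', ds', rfl, h1, h2, h3, h4, h5⟩)
        · omega
        · exact ⟨⟨d, _, h1, ⟨d', ds', h2, h4, rfl⟩, rfl⟩, fun _ => h3, h5⟩
      · rintro ⟨⟨d, _, h1, ⟨d', ds', h2, h4, rfl⟩, rfl⟩, h3, h5⟩
        exact .inr ⟨trivial, d, d', ds', rfl, h1, h2, h3 trivial, h4, h5⟩

/-! ### Positive foldings -/

theorem mem_segment_add_iff {x y d : Amb X n} :
    y ∈ segment ℝ x (x + d) ↔ ∃ r : ℝ, 0 ≤ r ∧ r ≤ 1 ∧ y = x + r • d := by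
  rw [segment_eq_image']
  simp only [add_sub_cancel_left, Set.mem_image, Set.mem_Icc]
  constructor
  · rintro ⟨r, ⟨h0, h1⟩, rfl⟩
    exact ⟨r, h0, h1, rfl⟩
  · rintro ⟨r, h0, h1, rfl⟩
    exact ⟨r, ⟨h0, h1⟩, rfl⟩

theorem segment_add_subset_apartment {x y d : Amb X n} (hx : x ∈ apartment X n)
    (hd : d ∈ apartment X n) (hy : y ∈ segment ℝ x (x + d)) : y ∈ apartment X n := by
  obtain ⟨r, -, -, rfl⟩ := mem_segment_add_iff.1 hy
  exact add_mem hx (Submodule.smul_mem _ _ hd)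

/-- The wall through V of the positive root β has the antidominant sector on its negative side. The
inequality puts d there too, so the reflected direction points to the positive side. -/
theorem posFolding_swapRefl {a b : Letter X n} (hab : a < b) {V d : Amb X n}
    (hV : V ∈ apartment X n) (hd : d ∈ apartment X n)
    (hint : ∃ k : ℤ, (rootScale a b • (eps a - eps b)) ⬝ᵥ V = k)
    (hlt : eps a ⬝ᵥ d < eps b ⬝ᵥ d) :
    PosFolding V (segment ℝ V (V + d)) (segment ℝ V (V + swapRefl a b d)) := by
  obtain ⟨k, hk⟩ := hint
  have hβ := letters_mem_posRoots hab
  have hs : swapRefl a b = affRefl (rootScale a b • (eps a - eps b)) 0 :=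
    (affRefl_smul (rootScale_pos a b).ne' _).symm
  have hβd : (rootScale a b • (eps a - eps b)) ⬝ᵥ d < 0 := by
    rw [smul_dotProduct, sub_dotProduct, smul_eq_mul]
    exact mul_neg_of_pos_of_neg (rootScale_pos a b) (by linarith)
  rw [hs]
  set β := rootScale a b • (eps a - eps b) with hβe
  have hβr := posRoots_subset_roots hβ
  have hβd' : β ⬝ᵥ affRefl β 0 d = -(β ⬝ᵥ d) := by
    have h0 := root_dotProduct_self_pos hβr
    rw [affRefl_zero_apply, dotProduct_sub, dotProduct_smul, smul_eq_mul]
    field_simp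
    ring
  have hd' := weyl_mem_apartment (affRefl_zero_mem_weyl hβr) hd
  have himg : ∀ x, affRefl β (-k) (V + x) = V + affRefl β 0 x := fun x => by
    rw [affRefl_eq_sub_coroot, affRefl_zero_eq, affRefl_zero_eq, dotProduct_add, hk]
    push_cast
    module
  have hV' : affRefl β (-k) V = V := by
    have := himg 0
    rwa [add_zero, weyl_zero (affRefl_zero_mem_weyl hβr), add_zero] at this
  refine ⟨β, hβr, -k, ⟨hV, by rw [hk]; push_cast; ring⟩, ?_, .inl ⟨?_, ?_⟩⟩
  · rw [(isAffAut_of_mem_affWeyl (affRefl_mem_affWeyl hβr _)).image_segment, himg, hV']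
  · rintro x (hx | ⟨z, hz, rfl⟩)
    · refine ⟨segment_add_subset_apartment hV hd hx, ?_⟩
      obtain ⟨r, h0, -, rfl⟩ := mem_segment_add_iff.1 hx
      rw [dotProduct_add, dotProduct_smul, hk, smul_eq_mul]
      push_cast
      nlinarith
    · refine ⟨sub_mem hV hz.1, ?_⟩
      have := hz.2 β hβ
      rw [dotProduct_sub, hk]
      push_cast
      linarith
  · rintro x ⟨hx, hx'⟩
    refine ⟨⟨segment_add_subset_apartment hV hd' hx, ?_⟩, fun h => ?_⟩
    · obtain ⟨r, h0, -, rfl⟩ := mem_segment_add_iff.1 hx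
      rw [dotProduct_add, dotProduct_smul, hk, smul_eq_mul, hβd']
      push_cast
      nlinarith
    -- A point of the open edge on the wall would force the whole edge into the wall, but its far
    -- end is not on it.
    · have := (hx' β hβ _ h (right_mem_segment ℝ _ _)).2
      rw [dotProduct_add, hk, hβd'] at this
      push_cast at this
      linarith

theorem eps_dotProduct_stepVec_le (hn : 1 ≤ n) (i : Fin n) {a b : Letter X n} (hab : a < b) :
    eps b ⬝ᵥ stepVec X i ≤ eps a ⬝ᵥ stepVec X i := by
  have h := (smul_stepVec_mem_fundAlcove (X := X) hn i zero_le_one le_rfl).2 _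
    (letters_mem_posRoots hab)
  have h1 := h.1
  rw [one_smul, smul_dotProduct, sub_dotProduct, smul_eq_mul] at h1
  have := nonneg_of_mul_nonneg_right h1 (rootScale_pos a b)
  linarith

/-- Every root has a wall through an integral vertex. Each Bruhat step from w up to s w thus gives a
folding in the other direction, from the edge of s w to that of w, unless the two edges coincide. -/
theorem foldings_of_bruhatLE (hn : 1 ≤ n) {V : Amb X n} (hV : Integral V)
    {u v : Equiv.Perm (Amb X n)} (hu : u ∈ weyl X n) (huv : BruhatLE u v) (i : Fin n) :
    Relation.ReflTransGen (PosFolding V) (segment ℝ V (V + v (stepVec X i)))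
      (segment ℝ V (V + u (stepVec X i))) := by
  refine (bruhat_induction (p := fun v => Relation.ReflTransGen (PosFolding V)
    (segment ℝ V (V + v (stepVec X i))) (segment ℝ V (V + u (stepVec X i)))) hu huv .refl ?_).1
  intro w hw a b hab h ih
  have hs := swapRefl_mem_weyl hab.ne
  have hss : swapRefl a b ((swapRefl a b * w) (stepVec X i)) = w (stepVec X i) := by
    rw [← Equiv.Perm.mul_apply, ← mul_assoc, swapRefl_mul_self, one_mul]
  have key : ∀ l, eps l ⬝ᵥ w (stepVec X i) = eps (act w⁻¹ l) ⬝ᵥ stepVec X i := fun l => by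
    rw [eps_act (inv_mem hw), weyl_dotProduct_left (inv_mem hw), inv_inv]
  have key' : ∀ l, eps l ⬝ᵥ (swapRefl a b * w) (stepVec X i) =
      eps (act w⁻¹ (swapLetter a b l)) ⬝ᵥ stepVec X i := fun l => by
    rw [← act_swapRefl hab.ne, ← key, eps_act hs, weyl_dotProduct_left hs, swapRefl_inv]; rfl
  rcases (eps_dotProduct_stepVec_le hn i h).lt_or_eq with h1 | h1
  · refine .head ?_ ih
    have := posFolding_swapRefl hab hV.1
      (weyl_mem_apartment (mul_mem hs hw) (stepVec_mem_apartment i))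
      (hV.2 _ (posRoots_subset_roots (letters_mem_posRoots hab)))
      (by rw [key', key', swapLetter_left, swapLetter_right]; exact h1)
    rwa [hss] at this
  · have : (swapRefl a b * w) (stepVec X i) = w (stepVec X i) := by
      rw [Equiv.Perm.mul_apply, swapRefl, affRefl_zero_apply, sub_dotProduct, key, key, h1, sub_self,
        zero_mul, zero_smul, sub_zero]
    rw [this]
    exact ih

theorem segment_subset_sector {w : Equiv.Perm (Amb X n)} (hw : w ∈ weyl X n) (V : Amb X n)
    {y : Amb X n} (hy : y ∈ domChamber X n) : segment ℝ V (V + w y) ⊆ sector V w := by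
  intro x hx
  obtain ⟨r, h0, -, rfl⟩ := mem_segment_add_iff.1 hx
  refine ⟨r • y, ⟨Submodule.smul_mem _ _ hy.1, fun β hβ => ?_⟩, by rw [weyl_smul hw]⟩
  rw [dotProduct_smul, smul_eq_mul]
  exact mul_nonneg h0 (hy.2 β hβ)

theorem stepVec_mem_domChamber (hn : 1 ≤ n) (i : Fin n) : stepVec X i ∈ domChamber X n := by
  have := smul_stepVec_mem_fundAlcove (X := X) hn i zero_le_one le_rfl
  rw [one_smul] at this
  exact ⟨this.1, fun β hβ => (this.2 β hβ).1⟩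

/-! ### Foldings at the middle vertices -/

/-- The reflection takes ā to b̄ and `b` to `a`, so both letters are replaced by bars of letters of
the column. When `b` is the bar of `a`, only one letter is exchanged. -/
theorem image_swapRefl_eq_exchange {i : Fin n} {c : Finset (Letter X n)} (hc : IsColumn i c)
    (hX : X ≠ A) {a b : Letter X n} (hab : a < b) (ha : a.rev ∈ c) (hb : b ∈ c) :
    c.image (act (swapRefl a b)) = exchange c {a.rev, b} := by
  have hs := swapRefl_mem_weyl hab.ne
  have hrev : ∀ m, m ∈ c → m.rev ∉ c := fun m hm h => hc.2 _ hm _ h (opp_rev hX m)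
  have h1 : a ∉ c := fun h => hrev _ h ha
  have h2 : b.rev ∉ c := hrev _ hb
  ext m
  have h3 : m ∈ c.image (act (swapRefl a b)) ↔ swapLetter a b m ∈ c := by
    rw [← act_swapRefl hab.ne, Finset.mem_image]
    have hss : ∀ l, act (swapRefl a b) (act (swapRefl a b) l) = l := act_inv_act hs
    constructor
    · rintro ⟨l, hl, rfl⟩
      rwa [hss]
    · exact fun h => ⟨_, h, hss m⟩
  have h4 : Opp a m ↔ m = a.rev := ⟨fun h => h.2, fun h => ⟨hX, h⟩⟩
  have h5 : Opp b m ↔ m = b.rev := ⟨fun h => h.2, fun h => ⟨hX, h⟩⟩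
  have h6 : m.rev = b ↔ m = b.rev := by
    constructor
    · rintro rfl; rw [Fin.rev_rev]
    · rintro rfl; rw [Fin.rev_rev]
  rw [h3, mem_exchange, swapLetter]
  simp only [Finset.mem_insert, Finset.mem_singleton, h4, h5, h6, Fin.rev_inj]
  by_cases h7 : m = a
  · simp [h7, hb]
  · by_cases h8 : m = b
    · subst h8
      have : m ≠ m.rev := fun h => h2 (h ▸ hb)
      simp [h7, h1, this]
    · by_cases h9 : m = a.rev
      · have h10 : m ≠ b.rev := fun h => h2 (by rw [← h, h9]; exact ha)
        rw [if_neg h7, if_neg h8, if_pos h9]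
        exact iff_of_false h2 (by tauto)
      · by_cases h10 : m = b.rev
        · rw [if_neg h7, if_neg h8, if_neg h9, if_pos h10]
          simp [h10, ha]
        · simp [h7, h8, h9, h10]

theorem IsColumn.exchange_pair {i : Fin n} {c : Finset (Letter X n)} (hc : IsColumn i c)
    (hX : X ≠ A) {a b : Letter X n} (hab : a < b) (ha : a.rev ∈ c) (hb : b ∈ c) :
    IsColumn i (exchange c {a.rev, b}) := by
  rw [← image_swapRefl_eq_exchange hc hX hab ha hb]
  exact hc.image_act (swapRefl_mem_weyl hab.ne)

theorem dirOf_mem_apartment {i : Fin n} {c : Finset (Letter X n)} (hc : IsColumn i c) :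
    dirOf i c ∈ apartment X n := by
  obtain ⟨σ, hσ, h⟩ := (isStep_iff i _).2 ⟨c, hc, rfl⟩
  rw [h]
  exact weyl_mem_apartment hσ (stepVec_mem_apartment i)

/-- The differences of the coordinates of `V` in the positions occurring in `c` are integral. -/
def IntegralOn (V : Amb X n) (c : Finset (Letter X n)) : Prop :=
  ∀ l m : Letter X n, (l ∈ c ∨ l.rev ∈ c) → (m ∈ c ∨ m.rev ∈ c) →
    ∃ k : ℤ, eps l ⬝ᵥ V - eps m ⬝ᵥ V = k

/-- The direction is negative on `a` and positive on `b`, as a folding requires. For opposite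
letters in type C the root would be a single ε_i, and integrality of differences of coordinates does
not provide a wall for it; hence the last hypothesis. -/
theorem posFolding_exchange_pair {i : Fin n} {c : Finset (Letter X n)} (hc : IsColumn i c)
    (hX : X ≠ A) {V : Amb X n} (hVa : V ∈ apartment X n) (hV : IntegralOn V c) {a b : Letter X n}
    (hab : a < b) (ha : a.rev ∈ c) (hb : b ∈ c) (hC : X = C → ¬Opp a b) :
    PosFolding V (segment ℝ V (V + dirOf i c))
      (segment ℝ V (V + dirOf i (exchange c {a.rev, b}))) := by
  have hr : rootScale a b = 1 := by
    rw [rootScale, if_neg]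
    rintro ⟨h1, h2⟩
    exact hC h2 h1
  rw [← image_swapRefl_eq_exchange hc hX hab ha hb, ← weyl_dirOf (swapRefl_mem_weyl hab.ne)]
  refine posFolding_swapRefl hab hVa (dirOf_mem_apartment hc) ?_ ?_
  · rw [hr, one_smul, sub_dotProduct]
    exact hV a b (.inr ha) (.inl hb)
  · have h1 : a ∉ c := fun h => hc.2 _ h _ ha (opp_rev hX a)
    have h2 : ∃ m ∈ c, Opp a m := ⟨_, ha, opp_rev hX a⟩
    have h3 : ¬∃ m ∈ c, Opp b m := fun ⟨m, hm, h⟩ => hc.2 _ hb _ hm h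
    have h4 := stepScale_pos (X := X) i
    rw [eps_dotProduct_dirOf, eps_dotProduct_dirOf, if_neg h1, if_pos h2, if_neg h3, if_pos hb]
    linarith

theorem IntegralOn.exchange {V : Amb X n} {c S : Finset (Letter X n)} (hV : IntegralOn V c)
    (hS : S ⊆ c) : IntegralOn V (exchange c S) := by
  have h : ∀ l, l ∈ OneSkeleton.exchange c S ∨ l.rev ∈ OneSkeleton.exchange c S →
      l ∈ c ∨ l.rev ∈ c := fun l hl => by
    rw [mem_exchange, mem_exchange, Fin.rev_rev] at hl
    rcases hl with (h | h) | h | h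
    exacts [.inl h.1, .inr (hS h), .inr h.1, .inl (hS h)]
  exact fun l m hl hm => hV l m (h l hl) (h m hm)

theorem exchange_exchange {i : Fin n} {c : Finset (Letter X n)} (hc : IsColumn i c) (hX : X ≠ A)
    {S S₀ : Finset (Letter X n)} (hS : S ⊆ c) (hS₀ : S₀ ⊆ S) :
    exchange (exchange c S₀) (S \ S₀) = exchange c S := by
  ext l
  simp only [mem_exchange, Finset.mem_sdiff]
  have h1 : l.rev ∈ S₀ → l.rev ∈ S := @hS₀ _
  have h2 : l ∈ S₀ → l ∈ S := @hS₀ _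
  have h3 : l ∈ S → l ∈ c := @hS _
  have h4 : l.rev ∈ S → l.rev ∈ c := @hS _
  have h5 : l ∈ c → l.rev ∉ c := fun h h' => hc.2 _ h _ h' (opp_rev hX l)
  tauto

/-- Among the letters exchanged, no initial segment of the unbarred letters has more unbarred
letters before the exchange than after it. -/
def ExchangeUp (S : Finset (Letter X n)) : Prop :=
  ∀ m : ℕ, m < n → (S.filter fun l : Letter X n => (l : ℕ) ≤ m).card ≤ (S.filter fun l : Letter X n => (l.rev : ℕ) ≤ m).card

/-- The letters of `S` are exchanged one or two at a time. Barring an unbarred letter k is not a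
positive folding by itself, so k is paired with a barred letter t whose unbarred form is smaller;
`ExchangeUp` guarantees that t exists. Once only barred letters remain they are unbarred singly in
type B, and in pairs, using the parity of `S`, in type C. -/
theorem foldings_exchange {i : Fin n} (hX : X ≠ A) {V : Amb X n} (hVa : V ∈ apartment X n)
    {c S : Finset (Letter X n)} (hc : IsColumn i c) (hV : IntegralOn V c) (hS : S ⊆ c)
    (hC : X = C → Even S.card) (hup : ExchangeUp S) :
    Relation.ReflTransGen (PosFolding V) (segment ℝ V (V + dirOf i c))
      (segment ℝ V (V + dirOf i (exchange c S))) := by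
  induction hN : S.card using Nat.strong_induction_on generalizing c S with
  | _ N ih =>
  have hrev := fun l : Letter X n => val_rev_of_ne hX l
  have hval := fun l : Letter X n => val_lt_of_ne hX l
  have main : ∀ a b : Letter X n, a < b → a.rev ∈ S → b ∈ S → (X = C → ¬Opp a b) →
      ExchangeUp (S \ {a.rev, b}) → Relation.ReflTransGen (PosFolding V)
        (segment ℝ V (V + dirOf i c)) (segment ℝ V (V + dirOf i (exchange c S))) := by
    intro a b hab ha hb hC' hup'
    have hS₀ : ({a.rev, b} : Finset (Letter X n)) ⊆ S := by simp [Finset.insert_subset_iff, ha, hb]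
    have hcard := Finset.card_sdiff_add_card_eq_card hS₀
    have hpos : 0 < ({a.rev, b} : Finset (Letter X n)).card := Finset.card_pos.2 ⟨b, by simp⟩
    refine .head (posFolding_exchange_pair hc hX hVa hV hab (hS ha) (hS hb) hC') ?_
    rw [← exchange_exchange hc hX hS hS₀]
    refine ih _ (by omega) (hc.exchange_pair hX hab (hS ha) (hS hb)) (hV.exchange (hS₀.trans hS))
      ?_ ?_ hup' rfl
    · intro l hl
      rw [Finset.mem_sdiff] at hl
      exact mem_exchange.2 (.inl ⟨hS hl.1, hl.2⟩)
    · intro h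
      have hne : a.rev ≠ b := fun h' => hC' h ⟨hX, h'.symm⟩
      rw [Finset.card_pair hne] at hcard
      have := hC h
      rw [← hcard] at this
      exact (Nat.even_add.1 this).2 even_two
  by_cases hU : ∃ k ∈ S, (k : ℕ) < n
  · obtain ⟨k, hk, hmin⟩ := Finset.exists_min_image (S.filter fun l : Letter X n => (l : ℕ) < n) id
      (by obtain ⟨k, h1, h2⟩ := hU; exact ⟨k, Finset.mem_filter.2 ⟨h1, h2⟩⟩)
    rw [Finset.mem_filter] at hk
    -- For the least unbarred letter k of `S`, the counting hypothesis at k itself supplies a letter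
    -- whose bar is at most k.
    obtain ⟨t, ht⟩ : (S.filter fun l : Letter X n => (l.rev : ℕ) ≤ k).Nonempty := by
      rw [← Finset.card_pos]
      exact lt_of_lt_of_le (Finset.card_pos.2 ⟨k, by simp [hk.1]⟩) (hup k hk.2)
    rw [Finset.mem_filter] at ht
    have hne : t.rev ≠ k := fun h => hc.2 t (hS ht.1) k (hS hk.1) ⟨hX, h.symm⟩
    have hlt : t.rev < k := lt_of_le_of_ne ht.2 hne
    have h1 := hrev t
    have h2 := hval t
    refine main t.rev k hlt (by rw [Fin.rev_rev]; exact ht.1) hk.1 (fun _ h => ?_) ?_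
    · rw [opp_iff] at h
      have := hk.2
      have := ht.2
      omega
    · rw [Fin.rev_rev]
      intro m hm
      -- Below k the smaller count is empty by minimality of k. From k on, removing t and k lowers
      -- both counts by one.
      by_cases hmk : m < k
      · have : ((S \ {t, k}).filter fun l : Letter X n => (l : ℕ) ≤ m) = ∅ := by
          rw [Finset.filter_eq_empty_iff]
          intro l hl hlm
          have : (k : ℕ) ≤ l := hmin l (Finset.mem_filter.2 ⟨(Finset.mem_sdiff.1 hl).1, by omega⟩)
          omega
        rw [this]
        exact Nat.zero_le _
      · have e1 : (S.filter fun l : Letter X n => (l : ℕ) ≤ m) =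
            insert k ((S \ {t, k}).filter fun l : Letter X n => (l : ℕ) ≤ m) := by
          ext l
          simp only [Finset.mem_filter, Finset.mem_insert, Finset.mem_sdiff, Finset.mem_singleton]
          by_cases h3 : l = k
          · subst h3; simp [hk.1]; omega
          · by_cases h4 : l = t
            · subst h4; simp [h3]; omega
            · simp [h3, h4]
        have e2 : (S.filter fun l : Letter X n => (l.rev : ℕ) ≤ m) =
            insert t ((S \ {t, k}).filter fun l : Letter X n => (l.rev : ℕ) ≤ m) := by
          ext l
          simp only [Finset.mem_filter, Finset.mem_insert, Finset.mem_sdiff, Finset.mem_singleton]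
          by_cases h3 : l = t
          · subst h3; simp only [ht.1, true_and, true_or, iff_true]; omega
          · by_cases h4 : l = k
            · subst h4
              have := hrev l
              simp only [hk.1, h3, true_and, or_true, not_true, false_and, or_false, iff_false]
              omega
            · simp [h3, h4]
        have h3 := hup m hm
        rw [e1, e2, Finset.card_insert_of_notMem (by simp),
          Finset.card_insert_of_notMem (by simp)] at h3
        omega
  · push Not at hU
    have hup' : ∀ S' ⊆ S, ExchangeUp S' := fun S' h m hm => by
      have : (S'.filter fun l : Letter X n => (l : ℕ) ≤ m) = ∅ := by
        rw [Finset.filter_eq_empty_iff]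
        intro l hl hlm
        have := hU l (h hl)
        omega
      rw [this]
      exact Nat.zero_le _
    rcases S.eq_empty_or_nonempty with rfl | ⟨t, ht⟩
    · have : exchange c ∅ = c := by simp [exchange]
      rw [this]
    · have h1 := hrev t
      have h2 := hval t
      have h3 := hU t ht
      by_cases hX' : X = C
      -- An even nonempty set has a second element.
      · obtain ⟨t', ht', hne⟩ : ∃ t' ∈ S, t' ≠ t := by
          by_contra! h
          have : S = {t} := Finset.eq_singleton_iff_unique_mem.2 ⟨ht, h⟩
          have h4 := hC hX'
          rw [this] at h4
          simp at h4
        have h5 := hU t' ht'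
        refine main t.rev t' (by rw [Fin.lt_def]; omega) (by rwa [Fin.rev_rev]) ht'
          (fun _ h => hne ?_) (hup' _ Finset.sdiff_subset)
        rw [h.2, Fin.rev_rev]
      · exact main t.rev t (by rw [Fin.lt_def]; omega) (by rwa [Fin.rev_rev]) ht
          (fun h => absurd h hX') (hup' _ Finset.sdiff_subset)

/-! ### Defining chains -/

/-- Members of the column have the largest value a letter can take on the direction. Dominance makes
the values weakly decreasing along the alphabet, so every letter before a member is a member. -/
theorem IsColumn.eq_initial_of_mem_domChamber {i : Fin n} {c : Finset (Letter X n)}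
    (hc : IsColumn i c) (h : dirOf i c ∈ domChamber X n) :
    c = Finset.univ.filter fun l : Letter X n => (l : ℕ) ≤ i := by
  have hs := stepScale_pos (X := X) i
  have hlow : ∀ l ∈ c, ∀ m : Letter X n, m < l → m ∈ c := by
    intro l hl m hml
    have h1 := h.2 _ (letters_mem_posRoots hml)
    rw [smul_dotProduct, sub_dotProduct, smul_eq_mul] at h1
    have h2 := nonneg_of_mul_nonneg_right h1 (rootScale_pos m l)
    have h3 : ¬∃ k ∈ c, Opp l k := fun ⟨k, hk, h'⟩ => hc.2 l hl k hk h'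
    rw [eps_dotProduct_dirOf, eps_dotProduct_dirOf, if_pos hl, if_neg h3] at h2
    by_contra hm
    rw [if_neg hm] at h2
    split_ifs at h2 <;> linarith
  refine Finset.eq_of_subset_of_card_le (fun l hl => ?_) ?_
  · rw [Finset.mem_filter]
    refine ⟨Finset.mem_univ _, ?_⟩
    have h1 : Finset.Iic l ⊆ c := fun m hm => by
      rcases (Finset.mem_Iic.1 hm).lt_or_eq with h2 | rfl
      · exact hlow l hl m h2
      · exact hl
    have h2 := Finset.card_le_card h1
    rw [Fin.card_Iic, hc.1] at h2
    omega
  · rw [hc.1, (isColumn_initial i).1]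

theorem initCol_succ (w : Equiv.Perm (Amb X n)) (i : ℕ) :
    initCol w (i + 1) = (Finset.univ.filter fun l : Letter X n => (l : ℕ) ≤ i).image (act w) := by
  simp only [initCol, Nat.lt_succ_iff]

/-- Applying `w⁻¹` makes the direction dominant, and the only dominant column of its length consists
of the first letters. -/
theorem letters_eq_initCol {i : Fin n} {d V : Amb X n} (hd : IsStep i d)
    {w : Equiv.Perm (Amb X n)} (hw : w ∈ weyl X n) (h : segment ℝ V (V + d) ⊆ sector V w) :
    letters d = initCol w (letters d).card := by
  obtain ⟨c, hc, rfl⟩ := (isStep_iff i d).1 hd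
  obtain ⟨y, hy, e⟩ := h (right_mem_segment ℝ _ _)
  have hcw := hc.image_act (inv_mem hw)
  have hy' : dirOf i (c.image (act w⁻¹)) ∈ domChamber X n := by
    rw [← weyl_dirOf (inv_mem hw), add_left_cancel e, perm_inv_apply]
    exact hy
  have h1 := hcw.eq_initial_of_mem_domChamber hy'
  rw [hc.letters_dirOf, hc.1, initCol_succ, ← h1, Finset.image_image]
  have : act w ∘ act w⁻¹ = id := funext fun l => act_act_inv hw l
  rw [this, Finset.image_id]

theorem countLE_eq_card_orderEmbOfFin {c : Finset (Letter X n)} {p : ℕ} (h : c.card = p)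
    (l : Letter X n) :
    countLE c l = (Finset.univ.filter fun r => c.orderEmbOfFin h r ≤ l).card := by
  conv_lhs => rw [countLE, ← Finset.map_orderEmbOfFin_univ c h, Finset.filter_map, Finset.card_map]
  rfl

/-- If entry r of `c'` exceeded entry r of `c`, then at most r entries of `c'` would be bounded by
the latter, while r + 1 entries of `c` are. -/
theorem orderEmbOfFin_le_of_countLE {c c' : Finset (Letter X n)} {p p' : ℕ} (h : c.card = p)
    (h' : c'.card = p') (hpp : p ≤ p') (hcc : ∀ l, countLE c l ≤ countLE c' l) (r : Fin p) :
    c'.orderEmbOfFin h' (Fin.castLE hpp r) ≤ c.orderEmbOfFin h r := by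
  by_contra! hlt
  have h1 := hcc (c.orderEmbOfFin h r)
  rw [countLE_eq_card_orderEmbOfFin h, countLE_eq_card_orderEmbOfFin h'] at h1
  have h2 : (Finset.univ.filter fun s => c.orderEmbOfFin h s ≤ c.orderEmbOfFin h r) =
      Finset.Iic r := by ext s; simp
  have h3 : (Finset.univ.filter fun s => c'.orderEmbOfFin h' s ≤ c.orderEmbOfFin h r) ⊆
      Finset.Iio (Fin.castLE hpp r) := by
    intro s hs
    rw [Finset.mem_Iio, ← (c'.orderEmbOfFin h').lt_iff_lt]
    exact lt_of_le_of_lt (Finset.mem_filter.1 hs).2 hlt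
  have h4 := Finset.card_le_card h3
  rw [h2, Fin.card_Iic] at h1
  rw [Fin.card_Iio, Fin.val_castLE] at h4
  omega

theorem countLE_le_of_orderEmbOfFin_le {c c' : Finset (Letter X n)} {p p' : ℕ} (h : c.card = p)
    (h' : c'.card = p') (hpp : p ≤ p')
    (hle : ∀ r, c'.orderEmbOfFin h' (Fin.castLE hpp r) ≤ c.orderEmbOfFin h r) (l : Letter X n) :
    countLE c l ≤ countLE c' l := by
  rw [countLE_eq_card_orderEmbOfFin h, countLE_eq_card_orderEmbOfFin h']
  refine Finset.card_le_card_of_injOn (Fin.castLE hpp) (fun r hr => ?_)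
    (Fin.castLE_injective hpp).injOn
  have hr' : c.orderEmbOfFin h r ≤ l := (Finset.mem_filter.1 hr).2
  exact Finset.mem_coe.2 (Finset.mem_filter.2 ⟨Finset.mem_univ _, (hle r).trans hr'⟩)

theorem card_le_of_countLE {c c' : Finset (Letter X n)} (hcc : ∀ l, countLE c l ≤ countLE c' l) :
    c.card ≤ c'.card := by
  rcases c.eq_empty_or_nonempty with rfl | hne
  · simp
  · have h1 : c.filter (· ≤ c.max' hne) = c :=
      Finset.filter_true_of_mem fun l hl => Finset.le_max' c l hl
    have h2 := hcc (c.max' hne)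
    rw [countLE, h1] at h2
    exact h2.trans (Finset.card_le_card (Finset.filter_subset _ _))

/-- The values are chosen from the last index backwards, each depending on its successor. -/
theorem exists_descending_chain {α : Type*} [Inhabited α] (N : ℕ) (Q : ℕ → α → Prop)
    (R : α → α → Prop) (hlast : ∀ k, k + 1 = N → ∃ w, Q k w)
    (hstep : ∀ k, k + 1 < N → ∀ w, Q (k + 1) w → ∃ v, Q k v ∧ R w v) :
    ∃ τ : ℕ → α, ∀ k < N, Q k (τ k) ∧ (k + 1 < N → R (τ (k + 1)) (τ k)) := by
  suffices ∀ m ≤ N, ∃ τ : ℕ → α, ∀ k < N, N ≤ k + m →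
      Q k (τ k) ∧ (k + 1 < N → R (τ (k + 1)) (τ k)) by
    obtain ⟨τ, h⟩ := this N le_rfl
    exact ⟨τ, fun k hk => h k hk (by omega)⟩
  intro m
  induction m with
  | zero => exact fun _ => ⟨default, fun k hk h => by omega⟩
  | succ m ih =>
    intro hm
    obtain ⟨τ, hτ⟩ := ih (by omega)
    obtain ⟨v, hv, hv'⟩ : ∃ v, Q (N - (m + 1)) v ∧
        (N - (m + 1) + 1 < N → R (τ (N - (m + 1) + 1)) v) := by
      by_cases h : N - (m + 1) + 1 < N
      · obtain ⟨v, h1, h2⟩ := hstep _ h _ (hτ _ h (by omega)).1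
        exact ⟨v, h1, fun _ => h2⟩
      · obtain ⟨v, h1⟩ := hlast (N - (m + 1)) (by omega)
        exact ⟨v, h1, fun h' => absurd h' h⟩
    refine ⟨Function.update τ (N - (m + 1)) v, fun k hk hkm => ?_⟩
    rw [Function.update_of_ne (show k + 1 ≠ N - (m + 1) by omega)]
    by_cases h : k = N - (m + 1)
    · subst h
      rw [Function.update_self]
      exact ⟨hv, hv'⟩
    · rw [Function.update_of_ne h]
      exact hτ k hk (by omega)

theorem image_initial_eq {i : Fin n} {c : Finset (Letter X n)} (hc : IsColumn i c)
    {w : Equiv.Perm (Amb X n)} (hw : w ∈ weyl X n) {p : ℕ} (hp : p ≤ n) (hcp : c.card = p)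
    (h : ∀ r, act w (firstLetters X hp r) = c.orderEmbOfFin hcp r) : w (stepVec X i) = dirOf i c := by
  rw [stepVec_eq_dirOf, weyl_dirOf hw]
  congr 1
  refine Finset.eq_of_subset_of_card_le ?_ ?_
  · rw [Finset.image_subset_iff]
    intro l hl
    have hl' : (l : ℕ) ≤ i := (Finset.mem_filter.1 hl).2
    have hc1 := hc.1
    have := h ⟨l, by omega⟩
    rw [show firstLetters X hp ⟨l, by omega⟩ = l from rfl] at this
    rw [this]
    exact Finset.orderEmbOfFin_mem c hcp _
  · rw [((isColumn_initial i).image_act hw).1, hc.1]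

/-- The last column is realised by transitivity of W. Given `τ (k + 1)` realising column k + 1 in
increasing order, its first values lie entrywise below the shorter or equally long column k, and
`exists_bruhatLE_of_le` lifts it to `τ k`. -/
theorem exists_chain (N : ℕ) (d : ℕ → Amb X n) (i : ℕ → Fin n) (hd : ∀ k < N, IsStep (i k) (d k))
    (h : ∀ k, k + 1 < N → ∀ l, countLE (letters (d k)) l ≤ countLE (letters (d (k + 1))) l) :
    ∃ τ : ℕ → Equiv.Perm (Amb X n), (∀ k < N, τ k ∈ weyl X n ∧ τ k (stepVec X (i k)) = d k) ∧
      ∀ k, k + 1 < N → BruhatLE (τ (k + 1)) (τ k) := by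
  have hcol : ∀ k < N, IsColumn (i k) (letters (d k)) := fun k hk => (hd k hk).isColumn_letters
  have hp : ∀ k < N, (letters (d k)).card ≤ n := fun k hk => by
    rw [(hcol k hk).1]; exact (i k).2
  have hopp : ∀ k < N, ∀ r s : Fin (letters (d k)).card,
      ¬Opp ((letters (d k)).orderEmbOfFin rfl r) ((letters (d k)).orderEmbOfFin rfl s) :=
    fun k hk r s => (hcol k hk).2 _ (Finset.orderEmbOfFin_mem _ _ _) _
      (Finset.orderEmbOfFin_mem _ _ _)
  obtain ⟨τ, hτ⟩ := exists_descending_chain N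
    (fun k w => w ∈ weyl X n ∧ ∀ (hk : k < N) (r : Fin (letters (d k)).card),
      act w (firstLetters X (hp k hk) r) = (letters (d k)).orderEmbOfFin rfl r) BruhatLE
    (fun k hk => by
      obtain ⟨v, hv, h1⟩ := exists_weyl_eq_column (hp k (by omega))
        ((letters (d k)).orderEmbOfFin rfl).strictMono (hopp k (by omega))
      exact ⟨v, hv, fun _ => h1⟩)
    (fun k hk w hw => by
      have hle := card_le_of_countLE (h k hk)
      have hact : ∀ r : Fin (letters (d k)).card, act w (firstLetters X (hp k (by omega)) r) =
          (letters (d (k + 1))).orderEmbOfFin rfl (Fin.castLE hle r) := fun r =>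
        hw.2 hk (Fin.castLE hle r)
      obtain ⟨v, hv, h1, h2⟩ := exists_bruhatLE_of_le (hp k (by omega))
        ((letters (d k)).orderEmbOfFin rfl).strictMono (hopp k (by omega)) hw.1
        (fun r s hrs => by
          simp only [hact]
          exact ((letters (d (k + 1))).orderEmbOfFin rfl).strictMono hrs)
        (fun r => by
          rw [hact]
          exact orderEmbOfFin_le_of_countLE rfl rfl hle (h k hk) r)
      exact ⟨v, ⟨hv, fun _ => h2⟩, h1⟩)
  refine ⟨τ, fun k hk => ⟨(hτ k hk).1.1, ?_⟩, fun k hk => (hτ k (by omega)).2 hk⟩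
  rw [image_initial_eq (hcol k hk) (hτ k hk).1.1 (hp k hk) rfl ((hτ k hk).1.2 hk),
    (hd k hk).dirOf_letters]

/-! ### Local foldings along a gallery -/

theorem isEdge_segment_add (hn : 1 ≤ n) {V : Amb X n} (hV : Integral V) {i : Fin n} {d : Amb X n}
    (hd : IsStep i d) : IsEdge (segment ℝ V (V + d)) := by
  obtain ⟨σ, hσ, rfl⟩ := hd
  obtain ⟨w, hw, h1, h2⟩ := (conj_step_iff (s := stepVec X i) hV (one_mem (affWeyl X n)) rfl).2
    ⟨σ, hσ, rfl⟩
  have := (hV.isEdgePair hn i).map (isAffAut_of_mem_affWeyl hw)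
  rw [h1, h2] at this
  exact this.isEdge

theorem isEdge_second_segment (hn : 1 ≤ n) {V : Amb X n} (hV : Integral V) {i : Fin n}
    (hm : mult X i = 2) {d : Amb X n} (hd : IsStep i d) :
    IsEdge (segment ℝ (V + d) (V + d + d)) := by
  obtain ⟨σ, hσ, rfl⟩ := hd
  obtain ⟨w, hw, h1, h2⟩ := (conj_second_step_iff (s := stepVec X i) (d := σ (stepVec X i)) hn
    (ne_A_of_mult_two hm) hV (one_mem (affWeyl X n)) rfl).2
    ⟨σ, hσ, rfl, by rw [sub_self]; exact zero_mem _⟩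
  have := (hV.isEdgePair_second hn hm).map (isAffAut_of_mem_affWeyl hw)
  rw [h1, h2] at this
  exact this.isEdge

/-- At an integral point the values of letters differ by integers, and the step changes those
occurring in `c`, barred or not, by 1/2 or -1/2. -/
theorem integralOn_add_dirOf {V : Amb X n} (hV : Integral V) {i : Fin n} (hm : mult X i = 2)
    {c : Finset (Letter X n)} (hc : IsColumn i c) : IntegralOn (V + dirOf i c) c := by
  have hX := ne_A_of_mult_two hm
  have h1 : ∀ l m : Letter X n, ∃ k : ℤ, eps l ⬝ᵥ V - eps m ⬝ᵥ V = k := fun l m => by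
    by_cases hlm : l = m
    · exact ⟨0, by rw [hlm]; simp⟩
    · obtain ⟨k, hk⟩ := hV.2 _ (letters_mem_roots hlm)
      rw [smul_dotProduct, sub_dotProduct, smul_eq_mul, rootScale] at hk
      split_ifs at hk
      · exact ⟨2 * k, by push_cast; linarith⟩
      · exact ⟨k, by linarith⟩
  have h2 : ∀ l : Letter X n, l ∈ c ∨ l.rev ∈ c →
      eps l ⬝ᵥ dirOf i c = 1 / 2 ∨ eps l ⬝ᵥ dirOf i c = -(1 / 2) := by
    intro l hl
    rw [eps_dotProduct_dirOf, stepScale_of_mult_two hm, if_neg hX]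
    by_cases h : l ∈ c
    · have h3 : ¬∃ m ∈ c, Opp l m := fun ⟨m, hm, h'⟩ => hc.2 l h m hm h'
      left
      rw [if_pos h, if_neg h3]; norm_num
    · have h3 : ∃ m ∈ c, Opp l m := ⟨_, hl.resolve_left h, opp_rev hX l⟩
      right
      rw [if_neg h, if_pos h3]; norm_num
  intro l m hl hm
  obtain ⟨k, hk⟩ := h1 l m
  simp only [dotProduct_add]
  rcases h2 l hl with h | h <;> rcases h2 m hm with h' | h' <;> rw [h, h']
  exacts [⟨k, by linarith⟩, ⟨k + 1, by push_cast; linarith⟩, ⟨k - 1, by push_cast; linarith⟩,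
    ⟨k, by linarith⟩]

/-- The letters of `c` outside `S` contribute equally to both counts and cancel. -/
theorem exchangeUp_of_countLE {c S : Finset (Letter X n)} (hS : S ⊆ c)
    (h : ∀ l, countLE c l ≤ countLE (exchange c S) l) : ExchangeUp S := by
  intro m hm
  have hle := le_alphabetSize X n
  have h1 := h ⟨m, by omega⟩
  set l : Letter X n := ⟨m, by omega⟩ with hl
  have h2 : countLE c l = ((c \ S).filter (· ≤ l)).card + (S.filter (· ≤ l)).card := by
    rw [countLE, ← Finset.card_union_of_disjoint, ← Finset.filter_union,
      Finset.sdiff_union_of_subset hS]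
    exact Finset.disjoint_filter_filter Finset.sdiff_disjoint
  have h3 : countLE (exchange c S) l ≤
      ((c \ S).filter (· ≤ l)).card + (S.filter fun k : Letter X n => k.rev ≤ l).card := by
    rw [countLE, exchange, Finset.filter_union]
    refine (Finset.card_union_le _ _).trans ?_
    rw [Finset.filter_image, Finset.card_image_of_injective _ Fin.rev_injective]
  have h4 : (S.filter (· ≤ l)).card ≤ (S.filter fun k : Letter X n => k.rev ≤ l).card := by omega
  exact h4

/-- Going straight on with direction d is minimal, and `foldings_exchange` folds that edge onto the
actual one. -/
theorem posFoldedPair_middle (hn : 1 ≤ n) {V : Amb X n} (hV : Integral V) {i : Fin n}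
    (hm : mult X i = 2) {d d' : Amb X n} (hd : IsStep i d) (hd' : IsStep i d')
    (hT : d - d' ∈ latticeT X n) (h : ∀ l, countLE (letters d) l ≤ countLE (letters d') l) :
    PosFoldedPair V (segment ℝ V (V + d)) (V + d) (segment ℝ (V + d) (V + d + d')) := by
  have hX := ne_A_of_mult_two hm
  refine ⟨segment ℝ (V + d) (V + d + d), isEdge_second_segment hn hV hm hd,
    left_mem_segment ℝ _ _, ?_, ?_⟩
  · obtain ⟨σ, hσ, rfl⟩ := hd
    exact ⟨σ, hσ, segment_subset_sector hσ _ (stepVec_mem_domChamber hn i),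
      segment_subset_sector hσ _ (stepVec_mem_domChamber hn i)⟩
  · obtain ⟨c, hc, rfl⟩ := (isStep_iff i d).1 hd
    obtain ⟨c', hc', rfl⟩ := (isStep_iff i d').1 hd'
    obtain ⟨S, hS, hC, rfl⟩ := (dirOf_sub_mem_latticeT_iff hm hc hc').1 hT
    rw [hc.letters_dirOf, hc'.letters_dirOf] at h
    exact foldings_exchange hX (add_mem hV.1 (dirOf_mem_apartment hc)) hc
      (integralOn_add_dirOf hV hm hc) hS hC (exchangeUp_of_countLE hS h)

/-- The edge of type i' in the sector of class τ continues the gallery minimally, and the Bruhat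
relation folds it onto the edge of class τ'. -/
theorem posFoldedPair_special (hn : 1 ≤ n) {V₀ V : Amb X n} (hV : Integral V)
    {τ τ' : Equiv.Perm (Amb X n)} (hτ : τ ∈ weyl X n) (hτ' : τ' ∈ weyl X n)
    (h : BruhatLE τ' τ) (i i' : Fin n) :
    PosFoldedPair V₀ (segment ℝ V₀ (V₀ + τ (stepVec X i))) V
      (segment ℝ V (V + τ' (stepVec X i'))) :=
  ⟨segment ℝ V (V + τ (stepVec X i')), isEdge_segment_add hn hV ⟨τ, hτ, rfl⟩,
    left_mem_segment ℝ _ _, ⟨τ, hτ, segment_subset_sector hτ _ (stepVec_mem_domChamber hn i),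
      segment_subset_sector hτ _ (stepVec_mem_domChamber hn i')⟩,
    foldings_of_bruhatLE hn hV hτ' h i'⟩

theorem StepsOK.vertex_cases (hn : 1 ≤ n) {L : List (Fin n)} {ds : List (Amb X n)}
    (h : StepsOK L ds) {V : Amb X n} (hV : Integral V) {k : ℕ} (hk : k < ds.length) :
    Integral (V + (ds.take k).sum) ∨ ∃ k' i, k = k' + 1 ∧ Integral (V + (ds.take k').sum) ∧
      mult X i = 2 ∧ IsStep i (ds.getD k' 0) ∧ IsStep i (ds.getD k 0) ∧
        ds.getD k' 0 - ds.getD k 0 ∈ latticeT X n := by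
  induction L generalizing V ds k with
  | nil =>
    rw [show ds = [] from h] at hk
    simp at hk
  | cons i L ih =>
    rcases h with ⟨hm, d, ds, rfl, h1, h⟩ | ⟨hm, d, d', ds, rfl, h1, h2, hT, h⟩
    · have hV' : Integral (V + d) := by
        have : StepsOK [i] [d] := .inl ⟨hm, d, [], rfl, h1, rfl⟩
        simpa using this.integral hn hV
      cases k with
      | zero => left; simpa using hV
      | succ k =>
        rcases ih h hV' (k := k) (by simpa using hk) with h3 | ⟨k', i', rfl, h3, h4, h5, h6, h7⟩
        · left
          simpa [add_assoc] using h3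
        · right
          exact ⟨k' + 1, i', rfl, by simpa [add_assoc] using h3, h4, h5, h6, h7⟩
    · have hV' : Integral (V + d + d') := by
        have : StepsOK [i] [d, d'] := .inr ⟨hm, d, d', [], rfl, h1, h2, hT, rfl⟩
        simpa [add_assoc] using this.integral hn hV
      match k with
      | 0 => left; simpa using hV
      | 1 => right; exact ⟨0, i, rfl, by simpa using hV, hm, h1, h2, hT⟩
      | k + 2 =>
        rcases ih h hV' (k := k) (by simpa using hk) with h3 | ⟨k', i', rfl, h3, h4, h5, h6, h7⟩
        · left
          simpa [add_assoc] using h3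
        · right
          exact ⟨k' + 2, i', rfl, by simpa [add_assoc] using h3, h4, h5, h6, h7⟩

/-- A defining chain alone forces the inequalities: passing to τ_k lowers the count for a fixed
length, and the column k + 1 is at least as long as the column k. Conversely the inequalities
produce a chain, and each vertex is either integral, where the chain gives the foldings, or the
middle of a two-step block, where the exchange of letters does. -/
theorem posFolded_iff (hn : 1 ≤ n) {L : List (Fin n)} {ds : List (Amb X n)} (h : StepsOK L ds)
    (hL : ∀ k, k + 1 < ds.length →
      (letters (ds.getD k 0)).card ≤ (letters (ds.getD (k + 1) 0)).card) :
    Gallery.PosFolded ⟨0, pathSteps 0 ds⟩ ↔ ∀ k, k + 1 < ds.length → ∀ l,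
      countLE (letters (ds.getD k 0)) l ≤ countLE (letters (ds.getD (k + 1) 0)) l := by
  have hsize : Gallery.size ⟨0, pathSteps 0 ds⟩ = ds.length := length_pathSteps 0 ds
  have hE : ∀ k < ds.length, Gallery.E ⟨0, pathSteps 0 ds⟩ k =
      segment ℝ (Gallery.V ⟨0, pathSteps 0 ds⟩ k)
        (Gallery.V ⟨0, pathSteps 0 ds⟩ k + ds.getD k 0) := fun k hk => by
    rw [E_pathSteps _ _ hk, V_pathSteps _ _ hk.le, List.getD_eq_getElem _ _ hk]
  have hV : ∀ k < ds.length, Gallery.V ⟨0, pathSteps 0 ds⟩ (k + 1) =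
      Gallery.V ⟨0, pathSteps 0 ds⟩ k + ds.getD k 0 := fun k hk => by
    rw [V_pathSteps _ _ hk, V_pathSteps _ _ hk.le, List.getD_eq_getElem _ _ hk, add_assoc,
      List.sum_take_succ]
  have hstep : ∀ k, ∃ i, k < ds.length → IsStep i (ds.getD k 0) := fun k => by
    by_cases hk : k < ds.length
    · have h1 := ((stepsOK_iff L ds).1 h).1
      have h2 := List.forall₂_iff_get.1 h1
      refine ⟨(expand X L)[k]'(by rw [h2.1]; exact hk), fun _ => ?_⟩
      rw [List.getD_eq_getElem _ _ hk]
      exact h2.2 k _ hk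
    · exact ⟨⟨0, hn⟩, fun h => absurd h hk⟩
  choose i hi using hstep
  constructor
  · rintro ⟨-, τ, h1, h2⟩ k hk l
    rw [hsize] at h1 h2
    have key : ∀ k < ds.length, letters (ds.getD k 0) =
        initCol (τ k) (letters (ds.getD k 0)).card := fun k hk => by
      obtain ⟨h3, h4⟩ := h1 k hk
      rw [hE k hk] at h4
      exact letters_eq_initCol (hi k hk) h3 h4
    rw [key k (by omega), key (k + 1) hk]
    exact (countLE_initCol_anti (h1 (k + 1) hk).1 (h2 k hk) _ l).trans
      (countLE_initCol_mono _ (hL k hk) l)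
  · intro hle
    obtain ⟨τ, h1, h2⟩ := exists_chain ds.length (fun k => ds.getD k 0) i hi hle
    refine ⟨fun k hk => ?_, τ, fun k hk => ?_, fun k hk => ?_⟩
    · rw [hsize] at hk
      rw [hE k (by omega), hE (k + 1) hk]
      rcases h.vertex_cases hn integral_zero hk with h3 | ⟨k', i', e, h3, h4, h5, h6, h7⟩
      · rw [← V_pathSteps _ _ hk.le] at h3
        have := posFoldedPair_special hn (V₀ := Gallery.V ⟨0, pathSteps 0 ds⟩ k) h3
          (h1 k (by omega)).1 (h1 (k + 1) hk).1 (h2 k hk) (i k) (i (k + 1))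
        rwa [(h1 k (by omega)).2, (h1 (k + 1) hk).2] at this
      · obtain rfl : k = k' := by omega
        rw [← V_pathSteps _ _ (by omega)] at h3
        rw [hV k (by omega)]
        exact posFoldedPair_middle hn h3 h4 h5 h6 h7 (hle k hk)
    · rw [hsize] at hk
      obtain ⟨h3, h4⟩ := h1 k hk
      rw [hE k hk, ← h4]
      exact ⟨h3, segment_subset_sector h3 _ (stepVec_mem_domChamber hn _)⟩
    · rw [hsize] at hk
      exact h2 k hk

/-! ### Columns of fillings -/

theorem expand_blocks (a : Fin n → ℕ) : expand X (blocks a) =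
    (List.finRange n).flatMap fun i => List.replicate (a i * mult X i) i := by
  rw [expand, blocks, List.flatMap_assoc]
  simp only [List.flatMap_replicate, List.flatten_replicate_replicate]

theorem pairwise_expand_blocks (a : Fin n → ℕ) : (expand X (blocks a)).Pairwise (· ≤ ·) := by
  rw [expand_blocks, List.pairwise_flatMap]
  refine ⟨fun i _ => List.pairwise_replicate.2 (.inr le_rfl), ?_⟩
  refine (List.pairwise_lt_finRange n).imp fun {i j} hij x hx y hy => ?_
  rw [(List.mem_replicate.1 hx).2, (List.mem_replicate.1 hy).2]
  exact hij.le

theorem length_expand_blocks (a : Fin n → ℕ) : (expand X (blocks a)).length = numCols X a := by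
  rw [expand_blocks, List.length_flatMap, numCols, ← Fin.sum_univ_def]
  simp only [List.length_replicate, mul_comm]

theorem countP_expand_blocks (a : Fin n → ℕ) (r : Fin n) :
    (expand X (blocks a)).countP (fun i => decide (i < r)) + shape X a r = numCols X a := by
  rw [expand_blocks, List.countP_flatMap, ← Fin.sum_univ_def, shape, Finset.sum_filter, numCols,
    ← Finset.sum_add_distrib]
  refine Finset.sum_congr rfl fun i _ => ?_
  rw [Function.comp_apply, List.countP_replicate]
  by_cases h : i < r
  · simp [h, mul_comm]
  · simp [h, not_lt.1 h]

theorem le_getElem_iff_countP {E : List (Fin n)} (hE : E.Pairwise (· ≤ ·)) {k : ℕ} {i : Fin n}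
    (hk : E[k]? = some i) (r : Fin n) : r ≤ i ↔ E.countP (fun i => decide (i < r)) ≤ k := by
  induction E generalizing k with
  | nil => simp at hk
  | cons e E ih =>
    rw [List.pairwise_cons] at hE
    by_cases h : e < r
    · rw [List.countP_cons_of_pos (by simpa using h)]
      cases k with
      | zero =>
        obtain rfl : e = i := by simpa using hk
        simp [h]
      | succ k =>
        rw [ih hE.2 (by simpa using hk)]
        omega
    · have h1 : (e :: E).countP (fun i => decide (i < r)) = 0 := by
        rw [List.countP_eq_zero]
        intro x hx
        rcases List.mem_cons.1 hx with rfl | hx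
        · simpa using h
        · simpa using (not_lt.1 h).trans (hE.1 x hx)
      rw [h1]
      have h2 : i ∈ e :: E := List.mem_of_getElem? hk
      refine iff_of_true ((not_lt.1 h).trans ?_) (Nat.zero_le _)
      rcases List.mem_cons.1 h2 with rfl | h2
      · exact le_rfl
      · exact hE.1 i h2

/-- The list of steps is weakly increasing, so its entries below r fill exactly the first `numCols X
a - shape X a r` positions. Hence entry number k gives the length of the column `C_{k+1}`. -/
theorem row_le_iff {a : Fin n → ℕ} {k : ℕ} {i : Fin n} (hk : (expand X (blocks a))[k]? = some i)
    (r : Fin n) : r ≤ i ↔ numCols X a ≤ k + shape X a r := by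
  rw [le_getElem_iff_countP (pairwise_expand_blocks a) hk, ← countP_expand_blocks (X := X) a r]
  omega

theorem exists_getElem?_expand_blocks {a : Fin n → ℕ} {k : ℕ} (hk : k < numCols X a) :
    ∃ i, (expand X (blocks a))[k]? = some i := by
  rw [← length_expand_blocks] at hk
  exact ⟨_, List.getElem?_eq_getElem hk⟩

theorem lt_numCols_of_getElem? {a : Fin n → ℕ} {k : ℕ} {i : Fin n}
    (hk : (expand X (blocks a))[k]? = some i) : k < numCols X a := by
  rw [← length_expand_blocks]
  exact (List.getElem?_eq_some_iff.1 hk).1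

theorem shape_le_numCols (a : Fin n → ℕ) (r : Fin n) : shape X a r ≤ numCols X a := by
  have := countP_expand_blocks (X := X) a r
  omega

/-- The filling with columns `cs 0`, `cs 1`, … from right to left. -/
def fillingOf (a : Fin n → ℕ) (cs : ℕ → Finset (Letter X n)) : Filling X a := fun i j =>
  ((cs (numCols X a - j - 1)).sort (· ≤ ·)).getD i (Fin.castLE (le_alphabetSize X n) i)

/-- The columns `cs` have the lengths of the columns of the shape. -/
def HasColumnLengths (a : Fin n → ℕ) (cs : ℕ → Finset (Letter X n)) : Prop :=
  ∀ (k : ℕ) (i : Fin n), (expand X (blocks a))[k]? = some i → (cs k).card = i + 1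

section fillings

variable {a : Fin n → ℕ} {cs : ℕ → Finset (Letter X n)}

theorem fillingOf_apply {k : ℕ} {r : Fin n} (j : Fin (shape X a r))
    (hj : (j : ℕ) + k + 1 = numCols X a) (hr : (r : ℕ) < (cs k).card) :
    fillingOf a cs r j = (cs k).orderEmbOfFin rfl ⟨r, hr⟩ := by
  -- Boxes are counted from the left and columns from the right, both here from 0.
  have e : numCols X a - j - 1 = k := by omega
  rw [fillingOf, e, Finset.orderEmbOfFin_apply, List.getD_eq_getElem]
  rfl

theorem HasColumnLengths.exists_of_box (hcs : HasColumnLengths a cs) {r : Fin n}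
    (j : Fin (shape X a r)) :
    ∃ k, (j : ℕ) + k + 1 = numCols X a ∧ (r : ℕ) < (cs k).card := by
  have hj := j.2
  have hs := shape_le_numCols (X := X) a r
  refine ⟨numCols X a - j - 1, by omega, ?_⟩
  obtain ⟨i, hi⟩ := exists_getElem?_expand_blocks (X := X) (a := a) (k := numCols X a - j - 1)
    (by omega)
  have h1 := (row_le_iff hi r).2 (by omega)
  rw [hcs _ _ hi]
  have : (r : ℕ) ≤ i := h1
  omega

theorem HasColumnLengths.exists_box (hcs : HasColumnLengths a cs) {k : ℕ} (hk : k < numCols X a)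
    {r : ℕ} (hr : r < (cs k).card) :
    ∃ (r' : Fin n) (j : Fin (shape X a r')), (r' : ℕ) = r ∧ (j : ℕ) + k + 1 = numCols X a := by
  obtain ⟨i, hi⟩ := exists_getElem?_expand_blocks hk
  rw [hcs _ _ hi] at hr
  have hi' := i.2
  have h1 := (row_le_iff hi ⟨r, by omega⟩).1 (by rw [Fin.le_def]; exact Nat.lt_succ_iff.1 hr)
  exact ⟨⟨r, by omega⟩, ⟨numCols X a - k - 1, by omega⟩, rfl, by simp only; omega⟩

theorem HasColumnLengths.columnStrict (hcs : HasColumnLengths a cs) :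
    ColumnStrict (fillingOf a cs) := by
  intro r r' j j' hr hj
  obtain ⟨k, hk, h1⟩ := hcs.exists_of_box j'
  have hr' : (r : ℕ) < r' := hr
  rw [fillingOf_apply j' hk h1, fillingOf_apply (k := k) j (by omega) (by omega)]
  exact ((cs k).orderEmbOfFin rfl).strictMono hr

theorem HasColumnLengths.column_fillingOf (hcs : HasColumnLengths a cs) {k : ℕ}
    (hk : k < numCols X a) : column (fillingOf a cs) (k + 1) = cs k := by
  ext l
  simp only [column, Finset.mem_filter, Finset.mem_univ, true_and]
  constructor
  · rintro ⟨r, j, hj, rfl⟩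
    obtain ⟨k', hk', h1⟩ := hcs.exists_of_box j
    obtain rfl : k = k' := by omega
    rw [fillingOf_apply j hk' h1]
    exact Finset.orderEmbOfFin_mem _ _ _
  · intro hl
    obtain ⟨r, rfl⟩ : ∃ r, (cs k).orderEmbOfFin rfl r = l := by
      have : l ∈ Set.range ((cs k).orderEmbOfFin rfl) := by
        rw [Finset.range_orderEmbOfFin]; exact hl
      exact this
    obtain ⟨r', j, e, hj⟩ := hcs.exists_box hk r.2
    refine ⟨r', j, by omega, ?_⟩
    rw [fillingOf_apply j hj (by omega)]
    congr 1
    exact Fin.ext e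

theorem column_eq_image {T : Filling X a} {k : ℕ} {i : Fin n}
    (hk : (expand X (blocks a))[k]? = some i) :
    ∃ f : Fin (i + 1) → Letter X n, column T (k + 1) = Finset.univ.image f ∧
      (ColumnStrict T → StrictMono f) ∧
      ∀ r (j : Fin (shape X a r)) (_ : (j : ℕ) + k + 1 = numCols X a) (hr : (r : ℕ) < i + 1),
        T r j = f ⟨r, hr⟩ := by
  have hlt := lt_numCols_of_getElem? hk
  have hi := i.2
  have hrow : ∀ r : Fin n, r ≤ i → numCols X a - k - 1 < shape X a r := fun r hr => by
    have := (row_le_iff hk r).1 hr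
    omega
  refine ⟨fun r => T ⟨r, by omega⟩ ⟨numCols X a - k - 1, hrow _ (Nat.lt_succ_iff.1 r.2)⟩,
    ?_, ?_, ?_⟩
  · ext l
    simp only [column, Finset.mem_filter, Finset.mem_univ, true_and, Finset.mem_image]
    constructor
    · rintro ⟨r, j, hj, rfl⟩
      have hj' := j.2
      have h1 : (r : ℕ) ≤ i := (row_le_iff hk r).2 (by omega)
      refine ⟨⟨r, by omega⟩, ?_⟩
      congr 1
      exact Fin.ext (by simp only; omega)
    · rintro ⟨r, rfl⟩
      exact ⟨_, _, by simp only; omega, rfl⟩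
  · intro hT r s hrs
    exact hT _ _ _ _ hrs rfl
  · intro r j hj hr
    show T r j = T r _
    congr 1
    exact Fin.ext (by simp only; omega)

theorem card_column {T : Filling X a} (hT : ColumnStrict T) :
    HasColumnLengths a fun k => column T (k + 1) := by
  intro k i hk
  obtain ⟨f, h1, h2, -⟩ := column_eq_image (T := T) hk
  show (column T (k + 1)).card = i + 1
  rw [h1, Finset.card_image_of_injective _ (h2 hT).injective, Finset.card_univ, Fintype.card_fin]

theorem fillingOf_column {T : Filling X a} (hT : ColumnStrict T)
    (hcs : ∀ k < numCols X a, cs k = column T (k + 1)) : fillingOf a cs = T := by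
  funext r j
  have hlen := card_column hT
  obtain ⟨k, hk, hr⟩ := hlen.exists_of_box j
  have hk' : k < numCols X a := by omega
  obtain ⟨i, hi⟩ := exists_getElem?_expand_blocks hk'
  obtain ⟨f, h1, h2, h3⟩ := column_eq_image (T := T) hi
  have hcard : (cs k).card = i + 1 := by rw [hcs k hk']; exact hlen k i hi
  have hr' : (r : ℕ) < i + 1 := by rwa [← hlen k i hi]
  have hf : f = (cs k).orderEmbOfFin hcard := by
    refine Finset.orderEmbOfFin_unique hcard (fun x => ?_) (h2 hT)
    rw [hcs k hk', h1]
    exact Finset.mem_image_of_mem f (Finset.mem_univ x)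
  rw [fillingOf_apply j hk (by omega), h3 r j hk hr', hf, Finset.orderEmbOfFin_apply,
    Finset.orderEmbOfFin_apply]
  rfl

theorem HasColumnLengths.card_le (hcs : HasColumnLengths a cs) {k : ℕ} (hk : k + 1 < numCols X a) :
    (cs k).card ≤ (cs (k + 1)).card := by
  obtain ⟨i, hi⟩ := exists_getElem?_expand_blocks hk
  obtain ⟨i', hi'⟩ := exists_getElem?_expand_blocks (X := X) (a := a) (k := k) (by omega)
  have h1 := (row_le_iff hi' i').1 le_rfl
  have h2 : (i' : ℕ) ≤ i := (row_le_iff hi i').2 (by omega)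
  rw [hcs _ _ hi, hcs _ _ hi']
  omega

/-- For two columns, the inequality of counts says that the entries in common rows are in order. It
suffices to compare neighbouring columns, since the counts compose. -/
theorem HasColumnLengths.rowWeak_iff (hcs : HasColumnLengths a cs) :
    RowWeak (fillingOf a cs) ↔
      ∀ k, k + 1 < numCols X a → ∀ l, countLE (cs k) l ≤ countLE (cs (k + 1)) l := by
  constructor
  · intro h k hk
    have hle := hcs.card_le hk
    refine countLE_le_of_orderEmbOfFin_le rfl rfl hle fun r => ?_
    obtain ⟨r', j, e, hj⟩ := hcs.exists_box (k := k) (by omega) r.2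
    have hj' := j.2
    have h1 := h r' (show (⟨j - 1, by omega⟩ : Fin (shape X a r')) ≤ j by
      rw [Fin.le_def]; simp only; omega)
    obtain ⟨s, j', e', hj''⟩ := hcs.exists_box (k := k + 1) hk (Fin.castLE hle r).2
    obtain rfl : r' = s := Fin.ext (e.trans e'.symm)
    have h2 := h r' (show j' ≤ j by rw [Fin.le_def]; omega)
    obtain ⟨r, hr⟩ := r
    obtain rfl : (r' : ℕ) = r := e
    rw [fillingOf_apply j' hj'' (by omega), fillingOf_apply j hj hr] at h2
    exact h2
  · intro h r j j' hjj
    have hle : ∀ m k, k + m < numCols X a → ∀ l, countLE (cs k) l ≤ countLE (cs (k + m)) l := by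
      intro m
      induction m with
      | zero => exact fun k _ l => le_rfl
      | succ m ih => exact fun k hk l => (ih k (by omega) l).trans (h (k + m) hk l)
    obtain ⟨k, hk, h1⟩ := hcs.exists_of_box j
    obtain ⟨k', hk', h1'⟩ := hcs.exists_of_box j'
    have hjj' : (j : ℕ) ≤ j' := hjj
    have hkk : k = k' + (k - k') := by omega
    rw [fillingOf_apply j hk h1, fillingOf_apply j' hk' h1']
    have h2 := hle (k - k') k' (by omega)
    rw [← hkk] at h2
    exact orderEmbOfFin_le_of_countLE rfl rfl (card_le_of_countLE h2) h2 ⟨r, h1'⟩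

end fillings

/-! ### Young tableaux in terms of columns -/

theorem column_eq_empty {a : Fin n → ℕ} (T : Filling X a) {k : ℕ}
    (hk : ∀ k' < numCols X a, k ≠ k' + 1) : column T k = ∅ := by
  rw [column, Finset.filter_eq_empty_iff]
  rintro l - ⟨r, j, hj, -⟩
  have h1 := j.2
  have h2 := shape_le_numCols (X := X) a r
  exact hk (k - 1) (by omega) (by omega)

theorem noBarPair_iff (hX : X ≠ A) {a : Fin n → ℕ} {T : Filling X a} (hT : ColumnStrict T) :
    NoBarPair T ↔ ∀ k i, (expand X (blocks a))[k]? = some i → IsColumn i (column T (k + 1)) := by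
  constructor
  · intro h k i hk
    refine ⟨card_column hT k i hk, fun l hl m hm hlm => ?_⟩
    rw [hlm.2] at hm
    exact h _ l hl hm
  · intro h k l hl hl'
    by_cases hk : ∃ k' < numCols X a, k = k' + 1
    · obtain ⟨k, hk, rfl⟩ := hk
      obtain ⟨i, hi⟩ := exists_getElem?_expand_blocks hk
      exact (h k i hi).2 l hl _ hl' (opp_rev hX l)
    · push Not at hk
      rw [column_eq_empty T hk] at hl
      simp at hl

theorem isYoungTableau_iff {a : Fin n → ℕ} {T : Filling X a} : IsYoungTableau T ↔
    ColumnStrict T ∧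
      (∀ k i, (expand X (blocks a))[k]? = some i → IsColumn i (column T (k + 1))) ∧
      PairCond X (blocks a) fun k => ∃ S ⊆ column T (k + 1), (X = C → Even S.card) ∧
        column T (k + 2) = exchange (column T (k + 1)) S := by
  refine and_congr_right fun hT => ?_
  cases X with
  | A =>
    refine iff_of_true trivial ⟨fun k i hk => ⟨card_column hT k i hk, fun l _ m _ h => h.1 rfl⟩,
      pairCond_blocks_A a _⟩
  | B =>
    rw [← noBarPair_iff (by simp) hT, pairCond_blocks_B]
    refine and_congr_right fun _ => forall₂_congr fun q hq => ?_
    have hq1 := (Finset.mem_Icc.1 hq).1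
    have e1 : 2 * (q - 1) + 1 = 2 * q - 1 := by omega
    have e2 : 2 * (q - 1) + 2 = 2 * q := by omega
    rw [e1, e2]
    simp
  | C =>
    rw [← noBarPair_iff (by simp) hT, pairCond_blocks_C]
    refine and_congr_right fun _ => forall₂_congr fun q hq => ?_
    have hq1 := (Finset.mem_Icc.1 hq).1
    have e1 : ∀ m, m + 2 * (q - 1) + 1 = m + 2 * q - 1 := by omega
    have e2 : ∀ m, m + 2 * (q - 1) + 2 = m + 2 * q := by omega
    rw [e1, e2]
    simp

/-- `PairCond` only looks at positions where a two-step block starts; there the next entry of the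
list belongs to the same block. -/
theorem pairCond_iff {L : List (Fin n)} {P Q : ℕ → Prop}
    (h : ∀ k i, (expand X L)[k]? = some i → (expand X L)[k + 1]? = some i → mult X i = 2 →
      (P k ↔ Q k)) : PairCond X L P ↔ PairCond X L Q := by
  induction L generalizing P Q with
  | nil => rfl
  | cons i L ih =>
    rw [PairCond, PairCond]
    have hget : ∀ k, (expand X (i :: L))[k + mult X i]? = (expand X L)[k]? := fun k => by
      rw [expand_cons, List.getElem?_append_right (by simp)]
      simp
    refine and_congr (forall_congr' fun hm => h 0 i ?_ ?_ hm) (ih fun k j h1 h2 hm => ?_)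
    · rw [expand_cons, hm]; rfl
    · rw [expand_cons, hm]; rfl
    · refine h _ j ?_ ?_ hm
      · rw [hget, h1]
      · rw [add_right_comm, hget, h2]

/-! ### The correspondence -/

theorem tableauOf_pathSteps {a : Fin n → ℕ} {ds : List (Amb X n)}
    (hlen : ds.length = numCols X a) :
    tableauOf ⟨0, pathSteps 0 ds⟩ = fillingOf a fun k => letters (ds.getD k 0) := by
  funext r j
  have hj := j.2
  have hs := shape_le_numCols (X := X) a r
  have h1 : numCols X a - j - 1 < ds.length := by omega
  have e : numCols X a - j = numCols X a - j - 1 + 1 := by omega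
  have : Gallery.V ⟨0, pathSteps 0 ds⟩ (numCols X a - j) -
      Gallery.V ⟨0, pathSteps 0 ds⟩ (numCols X a - j - 1) = ds.getD (numCols X a - j - 1) 0 := by
    conv_lhs => enter [1]; rw [e]
    rw [V_pathSteps _ _ h1, V_pathSteps _ _ h1.le, List.sum_take_succ _ _ h1,
      List.getD_eq_getElem _ _ h1]
    abel
  rw [tableauOf, this, fillingOf]

theorem StepsOK.isStep {L : List (Fin n)} {ds : List (Amb X n)} (h : StepsOK L ds) {k : ℕ}
    {i : Fin n} (hk : (expand X L)[k]? = some i) : IsStep i (ds.getD k 0) := by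
  have h1 := List.forall₂_iff_get.1 ((stepsOK_iff L ds).1 h).1
  obtain ⟨h2, rfl⟩ := List.getElem?_eq_some_iff.1 hk
  rw [List.getD_eq_getElem _ _ (by omega)]
  exact h1.2 k h2 _

theorem StepsOK.length_eq {L : List (Fin n)} {ds : List (Amb X n)} (h : StepsOK L ds) :
    ds.length = (expand X L).length :=
  (((stepsOK_iff L ds).1 h).1.length_eq).symm

theorem StepsOK.hasColumnLengths {a : Fin n → ℕ} {ds : List (Amb X n)}
    (h : StepsOK (blocks a) ds) : HasColumnLengths a fun k => letters (ds.getD k 0) :=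
  fun _ _ hk => (h.isStep hk).isColumn_letters.1

theorem StepsOK.isYoungTableau {a : Fin n → ℕ} {ds : List (Amb X n)}
    (h : StepsOK (blocks a) ds) :
    IsYoungTableau (fillingOf a fun k => letters (ds.getD k 0)) := by
  have hcs := h.hasColumnLengths
  refine isYoungTableau_iff.2 ⟨hcs.columnStrict, fun k i hk => ?_, ?_⟩
  · rw [hcs.column_fillingOf (lt_numCols_of_getElem? hk)]
    exact (h.isStep hk).isColumn_letters
  · refine (pairCond_iff fun k i h1 h2 hm => ?_).1 ((stepsOK_iff _ ds).1 h).2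
    rw [show k + 2 = k + 1 + 1 from rfl, hcs.column_fillingOf (lt_numCols_of_getElem? h1),
      hcs.column_fillingOf (lt_numCols_of_getElem? h2),
      ← dirOf_sub_mem_latticeT_iff hm (h.isStep h1).isColumn_letters
        (h.isStep h2).isColumn_letters, (h.isStep h1).dirOf_letters, (h.isStep h2).dirOf_letters]

theorem eq_of_fillingOf_eq {a : Fin n → ℕ} {ds ds' : List (Amb X n)} (h : StepsOK (blocks a) ds)
    (h' : StepsOK (blocks a) ds')
    (e : fillingOf a (fun k => letters (ds.getD k 0)) = fillingOf a fun k => letters (ds'.getD k 0)) :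
    ds = ds' := by
  refine List.ext_getElem (h.length_eq.trans h'.length_eq.symm) fun k hk hk' => ?_
  have hN : k < numCols X a := by rwa [← length_expand_blocks, ← h.length_eq]
  obtain ⟨i, hi⟩ := exists_getElem?_expand_blocks hN
  have h1 := h.hasColumnLengths.column_fillingOf hN
  rw [e, h'.hasColumnLengths.column_fillingOf hN] at h1
  rw [← List.getD_eq_getElem ds 0 hk, ← List.getD_eq_getElem ds' 0 hk',
    ← (h.isStep hi).dirOf_letters, ← (h'.isStep hi).dirOf_letters, h1]

theorem exists_stepsOK {a : Fin n → ℕ} {T : Filling X a} (hT : IsYoungTableau T) :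
    ∃ ds, StepsOK (blocks a) ds ∧ fillingOf a (fun k => letters (ds.getD k 0)) = T := by
  obtain ⟨h1, h2, h3⟩ := isYoungTableau_iff.1 hT
  -- The steps are read off from the columns, entry k of the list of blocks giving the length of
  -- column k + 1.
  set ds := List.ofFn fun k : Fin (expand X (blocks a)).length =>
    dirOf ((expand X (blocks a)).get k) (column T (k + 1)) with hds
  have hget : ∀ k i, (expand X (blocks a))[k]? = some i →
      ds.getD k 0 = dirOf i (column T (k + 1)) := fun k i hk => by
    obtain ⟨h4, rfl⟩ := List.getElem?_eq_some_iff.1 hk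
    rw [List.getD_eq_getElem _ _ (by rw [hds, List.length_ofFn]; exact h4)]
    simp [hds]
  refine ⟨ds, (stepsOK_iff _ ds).2 ⟨?_, ?_⟩, fillingOf_column h1 fun k hk => ?_⟩
  · refine List.forall₂_iff_get.2 ⟨by simp [hds], fun k hk hk' => ?_⟩
    have hk2 : (expand X (blocks a))[k]? = some ((expand X (blocks a)).get ⟨k, hk⟩) :=
      List.getElem?_eq_getElem hk
    have := hget k _ hk2
    rw [List.getD_eq_getElem _ _ hk'] at this
    exact (isStep_iff _ _).2 ⟨_, h2 k _ hk2, this⟩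
  · refine (pairCond_iff fun k i h4 h5 hm => ?_).1 h3
    rw [hget k i h4, hget (k + 1) i h5, dirOf_sub_mem_latticeT_iff hm (h2 k i h4)
      (h2 (k + 1) i h5)]
  · obtain ⟨i, hi⟩ := exists_getElem?_expand_blocks hk
    rw [hget k i hi, (h2 k i hi).letters_dirOf]

theorem bijOn_tableauOf (hn : 1 ≤ n) (a : Fin n → ℕ) :
    Set.BijOn (tableauOf (a := a)) (galleries X n a) (tableaux X a) := by
  have hlen : ∀ {ds : List (Amb X n)}, StepsOK (blocks a) ds → ds.length = numCols X a :=
    fun h => h.length_eq.trans (length_expand_blocks a)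
  refine ⟨fun γ hγ => ?_, fun γ hγ γ' hγ' e => ?_, fun T hT => ?_⟩
  · obtain ⟨ds, h, rfl⟩ := (mem_galleries_iff hn a γ).1 hγ
    rw [tableauOf_pathSteps (hlen h)]
    exact h.isYoungTableau
  · obtain ⟨ds, h, rfl⟩ := (mem_galleries_iff hn a γ).1 hγ
    obtain ⟨ds', h', rfl⟩ := (mem_galleries_iff hn a γ').1 hγ'
    rw [tableauOf_pathSteps (hlen h), tableauOf_pathSteps (hlen h')] at e
    rw [eq_of_fillingOf_eq h h' e]
  · obtain ⟨ds, h, e⟩ := exists_stepsOK hT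
    exact ⟨_, (mem_galleries_iff hn a _).2 ⟨ds, h, rfl⟩, by rw [tableauOf_pathSteps (hlen h), e]⟩

theorem posFolded_iff_rowWeak (hn : 1 ≤ n) {a : Fin n → ℕ} {γ : Gallery X n}
    (hγ : γ ∈ galleries X n a) : γ.PosFolded ↔ RowWeak (tableauOf (a := a) γ) := by
  obtain ⟨ds, h, rfl⟩ := (mem_galleries_iff hn a γ).1 hγ
  have hlen := h.length_eq.trans (length_expand_blocks a)
  have hcs := h.hasColumnLengths
  rw [tableauOf_pathSteps hlen, hcs.rowWeak_iff, posFolded_iff hn h fun k hk =>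
    hcs.card_le (hlen ▸ hk), hlen]

end OneSkeleton

end

/-! ### The two bijections -/

theorem mainTheorem8 (X : OneSkeleton.ClassicalType) (n : ℕ) (hn : 1 ≤ n) (a : Fin n → ℕ) :
    Set.BijOn (OneSkeleton.tableauOf (a := a)) (OneSkeleton.galleries X n a)
      (OneSkeleton.tableaux X a) ∧
    Set.BijOn (OneSkeleton.tableauOf (a := a))
      {γ | γ ∈ OneSkeleton.galleries X n a ∧ γ.PosFolded}
      (OneSkeleton.semistandardTableaux X a) := by
  have h := OneSkeleton.bijOn_tableauOf (X := X) hn a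
  refine ⟨h, fun γ hγ => ⟨h.mapsTo hγ.1, (OneSkeleton.posFolded_iff_rowWeak hn hγ.1).1 hγ.2⟩,
    h.injOn.mono fun γ hγ => hγ.1, fun T hT => ?_⟩
  obtain ⟨γ, hγ, rfl⟩ := h.surjOn hT.1
  exact ⟨γ, ⟨hγ, (OneSkeleton.posFolded_iff_rowWeak hn hγ).2 hT.2⟩, rfl⟩
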